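/- Let $D=\coprod_{j\in J}D_j$ be a finite disjoint union of connected smooth manifolds with boundary, of possibly different dimensions $\dim D_j\ge 1$. Let $H=(D,F,G,R)$ be a hybrid dynamical system: $F$ is a smooth vector field on $D$, the guard $G$ is an open subset of $\partial D$, and the reset map $R:G\to D$ is smooth; assume that $F$ is outward-pointing on $G$. An execution is a right-continuous function $x$ from an interval to $D$ that satisfies $\dot x(t)=F(x(t))$ wherever it is continuous, and such that, wherever it is discontinuous, $x(t^-)$ exists, lies in $G$, and $R(x(t^-))=x(t)$. Let $\gamma:\mathbb R\to D$ be a nonconstant periodic execution with minimal period $\tau>0$ and with finitely many discontinuities per period, and assume that $\gamma(t)\notin\overline G$ for all $t$ (so $\gamma$ meets $\overline G$ only at its exit points $\gamma(t^-)\in G$). The points of the orbit are the $\gamma(t)$ together with the exit points. A Poincaré map $P:U\to\Sigma$ for $\gamma$ is given by an embedded codimension-1 submanifold $\Sigma$ of some $D_j$ that meets the orbit at exactly one point $\xi$ and satisfies $F(\xi)\notin T_\xi\Sigma$, and by an open neighbourhood $U\subset\Sigma$ of $\xi$ such that the execution from each $x\in U$, traced forward in time (starting with the reset if $x\in G$),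 meets $\Sigma$ again, for the first time at the point $P(x)$; $P(\xi)=\xi$, and both $P$ and the return time are continuous at $\xi$. Let $P:U\to\Sigma$ and $\hat P:\hat U\to\hat\Sigma$ be two Poincaré maps for $\gamma$, with fixed points $\xi$ and $\hat\xi$, on sections that may lie in domains of different dimensions. Then $P$ is differentiable at $\xi$, $\hat P$ is differentiable at $\hat\xi$, and, for the complex spectra, $$\operatorname{spec}DP(\xi)\setminus\{0\}=\operatorname{spec}D\hat P(\hat\xi)\setminus\{0\}.$$ Moreover, if the Jordan canonical forms of $DP(\xi)$ and $D\hat P(\hat\xi)$ over $\mathbb C$ (or any block-diagonal matrices similar to them) are $$\begin{pmatrix}A&0\\0&N\end{pmatrix},\qquad\begin{pmatrix}\hat A&0\\0&\hat N\end{pmatrix}$$ with $0\notin\operatorname{spec}A\cup\operatorname{spec}\hat A$ and $N,\hat N$ nilpotent, then $A$ and $\hat A$ have the same size and are similar. -/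

import Mathlib

open Set Filter
open scoped Manifold ContDiff Topology

noncomputable section

/-- A hybrid dynamical system `(D, F, G, R)` on the disjoint union `Σ j, D j` of smooth manifolds
with boundary, where `D j` has dimension `d j + 1`. The reset map `R` is a total function in Lean;
only its values on the guard `G` are ever used. -/
structure HybridSystem {J : Type*} (d : J → ℕ) (D : J → Type*)
    [∀ j, TopologicalSpace (D j)] [∀ j, ChartedSpace (EuclideanHalfSpace (d j + 1)) (D j)]
    [∀ j, IsManifold (𝓡∂ (d j + 1)) ∞ (D j)] where
  /-- the vector field -/
  F : ∀ (j : J) (x : D j), TangentSpace (𝓡∂ (d j + 1)) x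
  /-- the guard -/
  G : Set (Σ j, D j)
  /-- the reset map -/
  R : (Σ j, D j) → (Σ j, D j)
  /-- the vector field is smooth -/
  smooth_F : ∀ j, ContMDiff (𝓡∂ (d j + 1)) (𝓡∂ (d j + 1)).tangent ∞
    (fun x : D j => (⟨x, F j x⟩ : TangentBundle (𝓡∂ (d j + 1)) (D j)))
  /-- the guard is a (relatively) open subset of the boundary -/
  isOpen_G : ∃ O : Set (Σ j, D j), IsOpen O ∧
    G = O ∩ {p | p.2 ∈ (𝓡∂ (d p.1 + 1)).boundary (D p.1)}
  /-- the reset map is smooth on the guard: near each point of the guard it takes values in one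
  component and is smooth there as a map on the guard -/
  smooth_R : ∀ (j : J) (x : D j), (⟨j, x⟩ : Σ j, D j) ∈ G →
    ∃ (l : J) (r : D j → D l),
      (∀ᶠ y in 𝓝[{y : D j | (⟨j, y⟩ : Σ j, D j) ∈ G}] x, R ⟨j, y⟩ = ⟨l, r y⟩) ∧
      ContMDiffWithinAt (𝓡∂ (d j + 1)) (𝓡∂ (d l + 1)) ∞ r
        {y : D j | (⟨j, y⟩ : Σ j, D j) ∈ G} x

namespace HybridSystem

variable {J : Type*} {d : J → ℕ} {D : J → Type*}
  [∀ j, TopologicalSpace (D j)] [∀ j, ChartedSpace (EuclideanHalfSpace (d j + 1)) (D j)]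
  [∀ j, IsManifold (𝓡∂ (d j + 1)) ∞ (D j)]

/-- `F` is outward-pointing on the guard: in every smooth chart around a point of `G`, the
coordinate of `F` normal to the boundary (coordinate `0` for the half space `0 ≤ x 0`) is
negative. -/
def OutwardOnGuard (H : HybridSystem d D) : Prop :=
  ∀ (j : J) (x : D j), (⟨j, x⟩ : Σ j, D j) ∈ H.G →
    ∀ φ ∈ IsManifold.maximalAtlas (𝓡∂ (d j + 1)) ∞ (D j), x ∈ φ.source →
      let v : EuclideanSpace ℝ (Fin (d j + 1)) :=
        mfderiv (𝓡∂ (d j + 1)) 𝓘(ℝ, EuclideanSpace ℝ (Fin (d j + 1)))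
          (φ.extend (𝓡∂ (d j + 1))) x (H.F j x)
      v 0 < 0

/-- `x : T → D` is an execution of `H` over the interval `T`: it is right-continuous, it follows the
vector field at its continuity points, and at a discontinuity the limit from the left exists, lies
in the guard and is sent by the reset map to the new state. Values of `x` off `T` are irrelevant. -/
structure IsExecution (H : HybridSystem d D) (T : Set ℝ) (x : ℝ → Σ j, D j) : Prop where
  ordConnected : T.OrdConnected
  rightCont : ∀ t ∈ T, ContinuousWithinAt x (T ∩ Ici t) t
  flow : ∀ t ∈ T, ContinuousWithinAt x T t →
    ∃ (j : J) (c : ℝ → D j), (∀ᶠ s in 𝓝[T] t, x s = ⟨j, c s⟩) ∧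
      HasMFDerivWithinAt 𝓘(ℝ, ℝ) (𝓡∂ (d j + 1)) c T t
        ((1 : ℝ →L[ℝ] ℝ).smulRight (H.F j (c t)))
  jump : ∀ t ∈ T, ¬ ContinuousWithinAt x T t →
    ∃ y ∈ H.G, Tendsto x (𝓝[T ∩ Iio t] t) (𝓝 y) ∧ H.R y = x t

/-- `γ : ℝ → D` is a periodic orbit with (minimal) period `τ`. -/
structure IsPeriodicOrbit (H : HybridSystem d D) (γ : ℝ → Σ j, D j) (τ : ℝ) : Prop where
  isExecution : H.IsExecution univ γ
  pos : 0 < τ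
  periodic : Function.Periodic γ τ
  minimal : ∀ σ : ℝ, 0 < σ → σ < τ → ¬ Function.Periodic γ σ

/-- The `τ`-periodic `γ` undergoes finitely many discrete transitions per period. -/
def IsolatedTransitions (γ : ℝ → Σ j, D j) (τ : ℝ) : Prop :=
  {t ∈ Ico 0 τ | ¬ ContinuousAt γ t}.Finite

/-- The set of points of `D` on the orbit `γ`: the states, together with the exit points
`γ (t⁻)` on the guard, which a right-continuous function does not attain. -/
def orbitSet (γ : ℝ → Σ j, D j) : Set (Σ j, D j) :=
  {p | ∃ t : ℝ, γ t = p ∨ Tendsto γ (𝓝[<] t) (𝓝 p)}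

/-- The execution from `p`, traced forward, meets the set `A` for the first time after elapsed time
`t`, at the point `q`. If `p` lies on the guard, then the execution starts by resetting `p`. At a
discontinuity `s` the limit from the left is passed before the value at `s`. An execution over
`[0, t]` may end on the guard, without a reset. -/
def FirstHit (H : HybridSystem d D) (A : Set (Σ j, D j)) (p q : Σ j, D j) (t : ℝ) : Prop :=
  ∃ x : ℝ → Σ j, D j, H.IsExecution (Icc 0 t) x ∧
    ((p ∉ H.G ∧ 0 < t ∧ x 0 = p ∧ ∀ s ∈ Ioo 0 t, x s ∉ A) ∨
      (p ∈ H.G ∧ 0 ≤ t ∧ x 0 = H.R p ∧ ∀ s ∈ Ico 0 t, x s ∉ A)) ∧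
    (∀ s ∈ Ioc 0 t, ¬ ContinuousWithinAt x (Icc 0 t) s →
      ∀ z, Tendsto x (𝓝[Ico 0 s] s) (𝓝 z) → z ∉ A) ∧
    x t = q ∧ q ∈ A

/-- `ι : S → D j` is a smooth embedding of a manifold `S` of dimension `d j`; its image is an
embedded codimension-1 submanifold that meets the orbit `γ` at exactly one point `ι ξ`, and the
vector field is transverse to it at that point. -/
structure IsPoincareSection (H : HybridSystem d D) (γ : ℝ → Σ j, D j) {j : J}
    {B : Type*} [TopologicalSpace B] (I : ModelWithCorners ℝ (EuclideanSpace ℝ (Fin (d j))) B)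
    {S : Type*} [TopologicalSpace S] [ChartedSpace B S] (ι : S → D j) (ξ : S) : Prop where
  smooth : ContMDiff I (𝓡∂ (d j + 1)) ∞ ι
  immersion : ∀ s : S, Function.Injective (mfderiv I (𝓡∂ (d j + 1)) ι s)
  isEmbedding : Topology.IsEmbedding ι
  inter_orbit : orbitSet γ ∩ range (fun s : S => (⟨j, ι s⟩ : Σ j, D j)) = {⟨j, ι ξ⟩}
  transverse : H.F j (ι ξ) ∉ range (mfderiv I (𝓡∂ (d j + 1)) ι ξ)

/-- `P : U → Σ` is a Poincaré map for the orbit `γ`, where the section `Σ` is the image of the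
embedding `ι : S → D j`, `U` is open, and points of `Σ` are named by their preimages in `S`: each
`x ∈ U` is sent to the point where its execution first meets `Σ`. The map and the elapsed time
are continuous at the fixed point `ξ`; no differentiability is assumed. -/
structure IsPoincareMap (H : HybridSystem d D) (γ : ℝ → Σ j, D j) {j : J}
    {B : Type*} [TopologicalSpace B] (I : ModelWithCorners ℝ (EuclideanSpace ℝ (Fin (d j))) B)
    {S : Type*} [TopologicalSpace S] [ChartedSpace B S] (ι : S → D j) (U : Set S) (P : S → S)
    (ξ : S) : Prop where
  isSection : H.IsPoincareSection γ I ι ξ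
  isOpen : IsOpen U
  mem : ξ ∈ U
  fixed : P ξ = ξ
  continuousAt : ContinuousAt P ξ
  firstReturn : ∃ ρ : S → ℝ, ContinuousAt ρ ξ ∧
    ∀ x ∈ U, H.FirstHit (range fun s : S => (⟨j, ι s⟩ : Σ j, D j)) ⟨j, ι x⟩ ⟨j, ι (P x)⟩ (ρ x)

end HybridSystem

/-- The matrix, with entries regarded as complex numbers, of the linearization `DP(ξ)` of a self-map
`P` at a fixed point `ξ = P ξ`, in the coordinates of the preferred chart at `ξ`. -/
def linearizationMatrix {n : ℕ} {B : Type*} [TopologicalSpace B]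
    (I : ModelWithCorners ℝ (EuclideanSpace ℝ (Fin n)) B)
    {S : Type*} [TopologicalSpace S] [ChartedSpace B S] (P : S → S) (ξ : S) :
    Matrix (Fin n) (Fin n) ℂ :=
  let L : EuclideanSpace ℝ (Fin n) →L[ℝ] EuclideanSpace ℝ (Fin n) := mfderiv I I P ξ
  (LinearMap.toMatrix (EuclideanSpace.basisFun (Fin n) ℝ).toBasis
    (EuclideanSpace.basisFun (Fin n) ℝ).toBasis (L : EuclideanSpace ℝ (Fin n) →ₗ[ℝ] _)).map
    (algebraMap ℝ ℂ)

/-- Similarity of complex square matrices, with possibly different (then equipotent) index types. -/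
def MatrixSimilar {α β : Type*} [Fintype α] [DecidableEq α] [Fintype β] [DecidableEq β]
    (A : Matrix α α ℂ) (B : Matrix β β ℂ) : Prop :=
  ∃ (S : Matrix α β ℂ) (T : Matrix β α ℂ), S * T = 1 ∧ T * S = 1 ∧ A = S * B * T

/-- `A` is the non-nilpotent part in a block-diagonal form `diag (A, N)` of `M` (for instance in a
Jordan canonical form): `M` is similar to `diag (A, N)`, `0 ∉ spec A`, and `N` is nilpotent. -/
def IsBlockForm {n r m : ℕ} (M : Matrix (Fin n) (Fin n) ℂ) (A : Matrix (Fin r) (Fin r) ℂ)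
    (N : Matrix (Fin m) (Fin m) ℂ) : Prop :=
  MatrixSimilar M (Matrix.fromBlocks A 0 0 N) ∧ (0 : ℂ) ∉ spectrum ℂ A ∧ IsNilpotent N

end

/-! The motion is linearized around the whole orbit, not only on a section. Between two points `p`,
`q` of the orbit (states or exit points) there is a linear map `Φ` of tangent spaces, possibly of
different dimensions, that gives the first-order dependence of the end point on the starting point
and carries `F(p)` to `F(q)`. With a map `Ψ` for the rest of the way, from `q` to `p`, one turn
around the orbit expands as `ΨΦ` at `p` and as `ΦΨ` at `q`. If `L` is the inclusion of the tangent
space of the section and `l` the projection onto it along `F`, then `DP(ξ) = lΨΦL`. Velocities go to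
velocities and `l` kills `F`, so the projection `L'l'` at the other section may be inserted in the
middle. Hence `DP(ξ) = XY` and `DP'(ξ') = YX` with rectangular `X = lΨL'` and `Y = l'ΦL`. The
algebra of such products gives both conclusions (`Matrix.spectrum_mul_comm_diff_zero`,
`IsBlockForm.similar_of_mul_comm`).

No local flow is constructed, since near the boundary nearby trajectories need not exist for a
prescribed time. Instead `ExpandsOn` is an estimate for all motions that do exist near the given
one. The chain rule `ExpandsOn.comp` then needs to know that a motion can be cut near the
intermediate point. This is `Tracks`, or `Sharp` when the second leg takes no time.

There are three kinds of legs. Off the closure of the guard, Gronwall's inequality and the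
variational equation in a chart give the expansion (`IsTrajectory.exists_expansion`). On arrival at
the guard, the outward velocity controls the exit time (`IsJumpBox.dichotomy`). At the reset, the
exit time is eliminated because the normal coordinate vanishes at the exit
(`exists_expandsOn_reset`). A supremum argument joins the legs (`IsExecution.transports`).

Uniqueness of executions shows that the return time at the fixed point is `τ` (`FirstHit.time_eq`).
Continuity of `P` and of the return time brings nearby returns into the range of the expansion, and
`Asymptotics.isLittleO_return` solves for `P` to first order. Thus differentiability of `P` is a
conclusion and not an assumption. -/

noncomputable section

/-! ### Block-diagonal forms of `X * Y` and `Y * X` -/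

/-- If `A` is invertible and `N` is nilpotent, then an intertwiner `A * X = X * N` vanishes. -/
theorem Matrix.eq_zero_of_mul_eq_mul_nilpotent {a b : Type*} [Fintype a] [DecidableEq a]
    [Fintype b] [DecidableEq b] {A : Matrix a a ℂ} {N : Matrix b b ℂ} {X : Matrix a b ℂ}
    (hA : IsUnit A) (hN : IsNilpotent N) (h : A * X = X * N) : X = 0 := by
  obtain ⟨k, hk⟩ := hN
  have h1 : ∀ n : ℕ, A ^ n * X = X * N ^ n := by
    intro n
    induction n with
    | zero => simp
    | succ n ih => rw [pow_succ, Matrix.mul_assoc, h, ← Matrix.mul_assoc, ih, Matrix.mul_assoc,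
        ← pow_succ]
  have h2 : A ^ k * X = 0 := by rw [h1, hk, Matrix.mul_zero]
  obtain ⟨B, hB⟩ := (hA.pow k).exists_left_inv
  calc X = (B * A ^ k) * X := by rw [hB, Matrix.one_mul]
    _ = 0 := by rw [Matrix.mul_assoc, h2, Matrix.mul_zero]

/-- The transposed version of `Matrix.eq_zero_of_mul_eq_mul_nilpotent`. -/
theorem Matrix.eq_zero_of_nilpotent_mul_eq_mul {a b : Type*} [Fintype a] [DecidableEq a]
    [Fintype b] [DecidableEq b] {A : Matrix a a ℂ} {N : Matrix b b ℂ} {X : Matrix b a ℂ}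
    (hA : IsUnit A) (hN : IsNilpotent N) (h : N * X = X * A) : X = 0 := by
  obtain ⟨k, hk⟩ := hN
  have h1 : ∀ n : ℕ, N ^ n * X = X * A ^ n := by
    intro n
    induction n with
    | zero => simp
    | succ n ih => rw [pow_succ, Matrix.mul_assoc, h, ← Matrix.mul_assoc, ih, Matrix.mul_assoc,
        ← pow_succ]
  have h2 : X * A ^ k = 0 := by rw [← h1, hk, Matrix.zero_mul]
  obtain ⟨B, hB⟩ := (hA.pow k).exists_right_inv
  calc X = X * (A ^ k * B) := by rw [hB, Matrix.mul_one]
    _ = 0 := by rw [← Matrix.mul_assoc, h2, Matrix.zero_mul]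

/-- Both products being invertible, `X` has the two-sided inverse `Y * A⁻¹ = B⁻¹ * Y`, and it
intertwines `A` with `B`. Equality of the sizes comes out as part of similarity. -/
theorem matrixSimilar_of_mul_comm {a b : Type*} [Fintype a] [DecidableEq a]
    [Fintype b] [DecidableEq b] {A : Matrix a a ℂ} {B : Matrix b b ℂ} {X : Matrix a b ℂ}
    {Y : Matrix b a ℂ} (hA : IsUnit A) (hB : IsUnit B) (h1 : A = X * Y) (h2 : B = Y * X) :
    MatrixSimilar A B := by
  obtain ⟨A', hA1⟩ := hA.exists_right_inv
  obtain ⟨B', hB1⟩ := hB.exists_left_inv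
  have e1 : B * Y = Y * A := by rw [h1, h2, Matrix.mul_assoc]
  have e3 : A * X = X * B := by rw [h1, h2, Matrix.mul_assoc]
  have e2 : Y * A' = B' * Y := by
    calc Y * A' = (B' * B) * Y * A' := by rw [hB1, Matrix.one_mul]
      _ = B' * (Y * A) * A' := by rw [Matrix.mul_assoc B', e1]
      _ = B' * Y * (A * A') := by simp only [Matrix.mul_assoc]
      _ = B' * Y := by rw [hA1, Matrix.mul_one]
  refine ⟨X, Y * A', ?_, ?_, ?_⟩
  · rw [← Matrix.mul_assoc, ← h1, hA1]
  · rw [e2, Matrix.mul_assoc, ← h2, hB1]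
  · rw [← e3, Matrix.mul_assoc, ← Matrix.mul_assoc X, ← h1, hA1, Matrix.mul_one]

/-- If `M = X * Y` and `M' = Y * X`, then the non-nilpotent parts of block-diagonal forms of `M` and
`M'` are similar. -/
theorem IsBlockForm.similar_of_mul_comm {n n' r m r' m' : ℕ} {M : Matrix (Fin n) (Fin n) ℂ}
    {M' : Matrix (Fin n') (Fin n') ℂ} {A : Matrix (Fin r) (Fin r) ℂ} {N : Matrix (Fin m) (Fin m) ℂ}
    {A' : Matrix (Fin r') (Fin r') ℂ} {N' : Matrix (Fin m') (Fin m') ℂ}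
    {X : Matrix (Fin n) (Fin n') ℂ} {Y : Matrix (Fin n') (Fin n) ℂ}
    (hM : M = X * Y) (hM' : M' = Y * X) (h : IsBlockForm M A N) (h' : IsBlockForm M' A' N') :
    MatrixSimilar A A' := by
  obtain ⟨⟨S, T, hST, hTS, hS⟩, hA, hN⟩ := h
  obtain ⟨⟨S', T', hST', hTS', hS'⟩, hA', hN'⟩ := h'
  replace hA : IsUnit A := spectrum.zero_notMem_iff ℂ |>.1 hA
  replace hA' : IsUnit A' := spectrum.zero_notMem_iff ℂ |>.1 hA'
  set X1 := T * X * S' with hX1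
  set Y1 := T' * Y * S with hY1
  have e1 : X1 * Y1 = Matrix.fromBlocks A 0 0 N := by
    calc X1 * Y1 = T * X * (S' * T') * Y * S := by simp only [hX1, hY1, Matrix.mul_assoc]
      _ = T * M * S := by rw [hST', hM, Matrix.mul_one]; simp only [Matrix.mul_assoc]
      _ = (T * S) * Matrix.fromBlocks A 0 0 N * (T * S) := by rw [hS]; simp only [Matrix.mul_assoc]
      _ = _ := by rw [hTS, Matrix.one_mul, Matrix.mul_one]
  have e2 : Y1 * X1 = Matrix.fromBlocks A' 0 0 N' := by
    calc Y1 * X1 = T' * Y * (S * T) * X * S' := by simp only [hX1, hY1, Matrix.mul_assoc]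
      _ = T' * M' * S' := by rw [hST, hM', Matrix.mul_one]; simp only [Matrix.mul_assoc]
      _ = (T' * S') * Matrix.fromBlocks A' 0 0 N' * (T' * S') := by
        rw [hS']; simp only [Matrix.mul_assoc]
      _ = _ := by rw [hTS', Matrix.one_mul, Matrix.mul_one]
  -- By associativity `X1` intertwines the two block-diagonal matrices. Its off-diagonal blocks
  -- intertwine an invertible matrix with a nilpotent one and so vanish; the corners of `e1` and
  -- `e2` then factor `A` and `A'` as the two products of one pair of blocks.
  have hXi : Matrix.fromBlocks A 0 0 N * X1 = X1 * Matrix.fromBlocks A' 0 0 N' := by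
    rw [← e1, ← e2, Matrix.mul_assoc]
  rw [← Matrix.fromBlocks_toBlocks X1, ← Matrix.fromBlocks_toBlocks Y1] at e1 e2
  rw [← Matrix.fromBlocks_toBlocks X1] at hXi
  simp only [Matrix.fromBlocks_multiply, Matrix.zero_mul, Matrix.mul_zero, add_zero, zero_add,
    Matrix.fromBlocks_inj] at e1 e2 hXi
  have hX12 := Matrix.eq_zero_of_mul_eq_mul_nilpotent hA hN' hXi.2.1
  have hX21 := Matrix.eq_zero_of_nilpotent_mul_eq_mul hA' hN hXi.2.2.1
  have hA1 := e1.1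
  have hA2 := e2.1
  rw [hX12, Matrix.zero_mul, add_zero] at hA1
  rw [hX21, Matrix.mul_zero, add_zero] at hA2
  exact matrixSimilar_of_mul_comm hA hA' hA1.symm hA2.symm

/-- The nonzero spectra of `X * Y` and `Y * X` agree, also for rectangular matrices. -/
theorem Matrix.spectrum_mul_comm_diff_zero {a b : Type*} [Fintype a] [DecidableEq a]
    [Fintype b] [DecidableEq b] (X : Matrix a b ℂ) (Y : Matrix b a ℂ) :
    spectrum ℂ (X * Y) \ {0} = spectrum ℂ (Y * X) \ {0} := by
  ext μ
  simp only [Set.mem_sdiff, mem_singleton_iff, Matrix.mem_spectrum_iff_isRoot_charpoly,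
    and_congr_left_iff]
  intro hμ
  -- The two characteristic polynomials agree up to powers of the indeterminate, which do not vanish
  -- at `μ ≠ 0`.
  have h := congrArg (Polynomial.eval μ) (Matrix.charpoly_mul_comm' X Y)
  simp only [Polynomial.eval_mul, Polynomial.eval_pow, Polynomial.eval_X] at h
  simp only [Polynomial.IsRoot]
  constructor
  · intro h0
    rw [h0, mul_zero] at h
    exact (mul_eq_zero.1 h.symm).resolve_left (pow_ne_zero _ hμ)
  · intro h0
    rw [h0, mul_zero] at h
    exact (mul_eq_zero.1 h).resolve_left (pow_ne_zero _ hμ)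

end

noncomputable section

set_option linter.unusedSectionVars false

/-! ### First-order expansion of trajectories of an autonomous vector field -/

section Field

variable {E : Type*} [NormedAddCommGroup E] [NormedSpace ℝ E]

/-- `f` is a bounded Lipschitz vector field on `K` with a Lipschitz derivative `A`; the constant `C`
serves for all the bounds. -/
structure IsTameField (f : E → E) (A : E → E →L[ℝ] E) (K : Set E) (C : ℝ) : Prop where
  pos : 0 < C
  norm_le : ∀ x ∈ K, ‖f x‖ ≤ C
  lip : ∀ x ∈ K, ∀ y ∈ K, ‖f x - f y‖ ≤ C * ‖x - y‖
  deriv_norm_le : ∀ x ∈ K, ‖A x‖ ≤ C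
  deriv_lip : ∀ x ∈ K, ∀ y ∈ K, ‖A x - A y‖ ≤ C * ‖x - y‖
  quad : ∀ x ∈ K, ∀ y ∈ K, ‖f y - f x - A x (y - x)‖ ≤ C * ‖y - x‖ ^ 2

/-- `y` is a trajectory of `f` in `K` over `[0, T]`. -/
structure IsTrajectory (f : E → E) (K : Set E) (T : ℝ) (y : ℝ → E) : Prop where
  nonneg : 0 ≤ T
  cont : ContinuousOn y (Icc 0 T)
  deriv : ∀ s ∈ Ico 0 T, HasDerivWithinAt y (f (y s)) (Ici s) s
  mem : ∀ s ∈ Icc 0 T, y s ∈ K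

variable {f : E → E} {A : E → E →L[ℝ] E} {K : Set E} {C T T₀ : ℝ} {y c : ℝ → E}

theorem IsTrajectory.mono {K' : Set E} {T' : ℝ} (hy : IsTrajectory f K T y) (h0 : 0 ≤ T')
    (hT : T' ≤ T) (hK : K ⊆ K') : IsTrajectory f K' T' y :=
  ⟨h0, hy.cont.mono (Icc_subset_Icc_right hT), fun s hs => hy.deriv s ⟨hs.1, hs.2.trans_le hT⟩,
    fun s hs => hK (hy.mem s ⟨hs.1, hs.2.trans hT⟩)⟩

theorem IsTrajectory.shift (hy : IsTrajectory f K T y) {h : ℝ} (h0 : 0 ≤ h) (hT : h ≤ T) :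
    IsTrajectory f K (T - h) (fun s => y (h + s)) := by
  refine ⟨by linarith, ?_, ?_, ?_⟩
  · exact hy.cont.comp (by fun_prop) fun s hs => ⟨by linarith [hs.1], by linarith [hs.2]⟩
  · intro s hs
    have h1 := hy.deriv (h + s) ⟨by linarith [hs.1], by linarith [hs.2]⟩
    have h2 : HasDerivWithinAt (fun s : ℝ => h + s) 1 (Ici s) s :=
      ((hasDerivAt_id s).const_add h).hasDerivWithinAt
    have h3 := HasDerivWithinAt.scomp s h1 h2
      (fun u hu => by simp only [mem_Ici] at hu ⊢; linarith)
    rwa [one_smul] at h3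
  · exact fun s hs => hy.mem _ ⟨by linarith [hs.1], by linarith [hs.2]⟩

theorem IsTrajectory.norm_sub_le (hf : IsTameField f A K C) (hy : IsTrajectory f K T y) {s t : ℝ}
    (hs : 0 ≤ s) (hst : s ≤ t) (ht : t ≤ T) : ‖y t - y s‖ ≤ C * (t - s) := by
  refine norm_image_sub_le_of_norm_deriv_right_le_segment (f' := fun u => f (y u))
    (hy.cont.mono (Icc_subset_Icc hs ht)) ?_ ?_ t ⟨hst, le_rfl⟩
  · exact fun u hu => hy.deriv u ⟨hs.trans hu.1, hu.2.trans_le ht⟩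
  · exact fun u hu => hf.norm_le _ (hy.mem u ⟨hs.trans hu.1, hu.2.le.trans ht⟩)

/-- Gronwall's inequality; `T ≤ 1` absorbs the time into the constant `Real.exp C`. -/
theorem IsTrajectory.dist_le (hf : IsTameField f A K C) (hy : IsTrajectory f K T y)
    (hc : IsTrajectory f K T c) (hT : T ≤ 1) {t : ℝ} (ht : t ∈ Icc 0 T) :
    ‖y t - c t‖ ≤ Real.exp C * ‖y 0 - c 0‖ := by
  have h := norm_le_gronwallBound_of_norm_deriv_right_le (f := fun s => y s - c s)
    (f' := fun s => f (y s) - f (c s)) (δ := ‖y 0 - c 0‖) (K := C) (ε := 0)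
    (hy.cont.sub hc.cont) (fun s hs => (hy.deriv s hs).sub (hc.deriv s hs)) le_rfl
    (fun s hs => by
      rw [add_zero]
      exact hf.lip _ (hy.mem s ⟨hs.1, hs.2.le⟩) _ (hc.mem s ⟨hs.1, hs.2.le⟩)) t ht
  rw [gronwallBound_ε0, sub_zero, mul_comm] at h
  refine h.trans (mul_le_mul_of_nonneg_right ?_ (norm_nonneg _))
  exact Real.exp_le_exp.2 (by nlinarith [hf.pos, ht.2])

/-- The variational equation along a short trajectory has a solution. -/
theorem IsTrajectory.exists_variational [CompleteSpace E] (hf : IsTameField f A K C)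
    (hc : IsTrajectory f K T c) (hT : 2 * C * T ≤ 1) :
    ∃ M : ℝ → E →L[ℝ] E, M 0 = ContinuousLinearMap.id ℝ E ∧ ContinuousOn M (Icc 0 T) ∧
      ∀ t ∈ Ico 0 T, HasDerivWithinAt M ((A (c t)).comp (M t)) (Ici t) t := by
  have hC := hf.pos
  have hnn := hc.nonneg
  -- On the unit ball around the identity `‖X‖ ≤ 2`, so the right-hand side has norm at most `2 *
  -- C`, and `hT` keeps the solution in that ball up to time `T`.
  have hPL : IsPicardLindelof (fun t (X : E →L[ℝ] E) => (A (c t)).comp X)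
      (⟨0, left_mem_Icc.2 hnn⟩ : Icc (0 : ℝ) T) (ContinuousLinearMap.id ℝ E) 1 0
      (⟨2 * C, by positivity⟩) (⟨C, hC.le⟩) := by
    refine ⟨?_, ?_, ?_, ?_⟩
    · intro t ht
      refine LipschitzOnWith.of_dist_le_mul fun X _ Y _ => ?_
      rw [dist_eq_norm, dist_eq_norm, ← ContinuousLinearMap.comp_sub]
      refine (ContinuousLinearMap.opNorm_comp_le _ _).trans ?_
      exact mul_le_mul_of_nonneg_right (hf.deriv_norm_le _ (hc.mem t ht)) (norm_nonneg _)
    · intro X _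
      have hA : ContinuousOn (fun t => A (c t)) (Icc 0 T) := by
        have : LipschitzOnWith (⟨C, hC.le⟩) A K := LipschitzOnWith.of_dist_le_mul fun x hx y hy => by
          rw [dist_eq_norm, dist_eq_norm]; exact hf.deriv_lip x hx y hy
        exact this.continuousOn.comp hc.cont hc.mem
      exact hA.clm_comp continuousOn_const
    · intro t ht X hX
      have h1 : ‖X‖ ≤ 2 := by
        have h2 : ‖X - ContinuousLinearMap.id ℝ E‖ ≤ 1 := by
          simpa [dist_eq_norm] using hX
        have h3 := ContinuousLinearMap.norm_id_le (𝕜 := ℝ) (E := E)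
        have h4 := norm_le_norm_add_norm_sub' X (ContinuousLinearMap.id ℝ E)
        linarith
      refine (ContinuousLinearMap.opNorm_comp_le _ _).trans ?_
      have := hf.deriv_norm_le _ (hc.mem t ht)
      change _ ≤ 2 * C
      nlinarith [norm_nonneg X, norm_nonneg (A (c t))]
    · change 2 * C * max (T - 0) (0 - 0) ≤ 1 - 0
      rw [sub_zero, sub_zero, sub_zero, max_eq_left hnn]
      exact hT
  obtain ⟨M, hM0, hM⟩ := hPL.exists_eq_forall_mem_Icc_hasDerivWithinAt₀
  refine ⟨M, hM0, fun t ht => (hM t ht).continuousWithinAt, fun t ht => ?_⟩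
  refine (hM t ⟨ht.1, ht.2.le⟩).mono_of_mem_nhdsWithin ?_
  exact mem_of_superset (Icc_mem_nhdsGE_of_mem ⟨le_rfl, ht.2⟩) (Icc_subset_Icc_left ht.1)

theorem norm_variational_le (hf : IsTameField f A K C) (hc : IsTrajectory f K T c) (hT : T ≤ 1)
    {M : ℝ → E →L[ℝ] E} (hM0 : M 0 = ContinuousLinearMap.id ℝ E) (hMc : ContinuousOn M (Icc 0 T))
    (hM : ∀ t ∈ Ico 0 T, HasDerivWithinAt M ((A (c t)).comp (M t)) (Ici t) t) {t : ℝ}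
    (ht : t ∈ Icc 0 T) : ‖M t‖ ≤ Real.exp C := by
  have h := norm_le_gronwallBound_of_norm_deriv_right_le (δ := 1) (K := C) (ε := 0) hMc hM
    (by rw [hM0]; exact ContinuousLinearMap.norm_id_le)
    (fun s hs => by
      rw [add_zero]
      exact (ContinuousLinearMap.opNorm_comp_le _ _).trans (mul_le_mul_of_nonneg_right
        (hf.deriv_norm_le _ (hc.mem s ⟨hs.1, hs.2.le⟩)) (norm_nonneg _))) t ht
  rw [gronwallBound_ε0, sub_zero, one_mul] at h
  exact h.trans (Real.exp_le_exp.2 (by nlinarith [hf.pos, ht.2]))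

/-- The error satisfies the variational equation along `c` with the Taylor remainder of `f` as
forcing term. That term is quadratic in `y - c`, hence by `IsTrajectory.dist_le` quadratic in the
initial deviation, and Gronwall's inequality preserves this. -/
theorem norm_sub_variational_le (hf : IsTameField f A K C) (hy : IsTrajectory f K T y)
    (hc : IsTrajectory f K T c) (hT : T ≤ 1)
    {M : ℝ → E →L[ℝ] E} (hM0 : M 0 = ContinuousLinearMap.id ℝ E) (hMc : ContinuousOn M (Icc 0 T))
    (hM : ∀ t ∈ Ico 0 T, HasDerivWithinAt M ((A (c t)).comp (M t)) (Ici t) t) {t : ℝ}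
    (ht : t ∈ Icc 0 T) :
    ‖y t - c t - M t (y 0 - c 0)‖ ≤ Real.exp C ^ 3 * ‖y 0 - c 0‖ ^ 2 := by
  have hC := hf.pos
  set v := y 0 - c 0 with hv
  have h := norm_le_gronwallBound_of_norm_deriv_right_le (f := fun s => y s - c s - M s v)
    (f' := fun s => f (y s) - f (c s) - A (c s) (M s v)) (δ := 0) (K := C)
    (ε := C * (Real.exp C * ‖v‖) ^ 2)
    ((hy.cont.sub hc.cont).sub (hMc.clm_apply continuousOn_const))
    (fun s hs => ((hy.deriv s hs).sub (hc.deriv s hs)).sub (by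
      have := (hM s hs).clm_apply (hasDerivWithinAt_const s (Ici s) v)
      simpa using this))
    (by simp [hM0, ← hv])
    (fun s hs => by
      have hs' : s ∈ Icc 0 T := ⟨hs.1, hs.2.le⟩
      have h1 := hf.quad _ (hc.mem s hs') _ (hy.mem s hs')
      have h2 : f (y s) - f (c s) - A (c s) (M s v) =
          A (c s) (y s - c s - M s v) + (f (y s) - f (c s) - A (c s) (y s - c s)) := by
        simp only [map_sub]; abel
      rw [h2]
      refine (norm_add_le _ _).trans (add_le_add ?_ (h1.trans ?_))
      · exact (ContinuousLinearMap.le_opNorm _ _).trans (mul_le_mul_of_nonneg_right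
          (hf.deriv_norm_le _ (hc.mem s hs')) (norm_nonneg _))
      · gcongr
        exact hy.dist_le hf hc hT hs') t ht
  rw [gronwallBound_of_K_ne_0 hC.ne'] at h
  refine h.trans ?_
  have h3 : Real.exp (C * (t - 0)) ≤ Real.exp C := Real.exp_le_exp.2 (by nlinarith [ht.2, ht.1])
  have h4 : C * (Real.exp C * ‖v‖) ^ 2 / C = (Real.exp C * ‖v‖) ^ 2 := by field_simp
  simp only [h4, zero_mul, zero_add]
  calc (Real.exp C * ‖v‖) ^ 2 * (Real.exp (C * (t - 0)) - 1)
      ≤ (Real.exp C * ‖v‖) ^ 2 * Real.exp C := by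
        gcongr; linarith
    _ = _ := by ring

/-- A trajectory is close to its tangent line. -/
theorem IsTrajectory.norm_sub_sub_smul_le (hy : IsTrajectory f K T y) {a b B : ℝ} {w : E}
    (ha : 0 ≤ a) (hab : a ≤ b) (hb : b ≤ T) (hB : ∀ u ∈ Ico a b, ‖f (y u) - w‖ ≤ B) :
    ‖y b - y a - (b - a) • w‖ ≤ B * (b - a) := by
  have h := norm_image_sub_le_of_norm_deriv_right_le_segment (f := fun u => y u - u • w)
    (f' := fun u => f (y u) - w) (a := a) (b := b) (C := B)
    ((hy.cont.mono (Icc_subset_Icc ha hb)).sub (by fun_prop)) ?_ hB b ⟨hab, le_rfl⟩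
  · convert h using 2
    rw [sub_smul]; abel
  · intro u hu
    have h1 := (hasDerivAt_id u).smul_const w
    simpa using (hy.deriv u ⟨ha.trans hu.1, hu.2.trans_le hb⟩).fun_sub h1.hasDerivWithinAt

/-- The first-order expansion of trajectories that start near the reference trajectory `c` and are
evaluated at times near `T₀`. -/
theorem IsTrajectory.exists_expansion [CompleteSpace E] (hf : IsTameField f A K C)
    (hc : IsTrajectory f K T₀ c) (hT₀ : T₀ ≤ 1) (hT₀' : 2 * C * T₀ ≤ 1) :
    ∃ Φ : E →L[ℝ] E, Φ (f (c 0)) = f (c T₀) ∧ ∃ B > 0, ∀ T ≤ 1, ∀ y, IsTrajectory f K T y →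
      ‖y T - c T₀ - Φ (y 0 - c 0) - (T - T₀) • f (c T₀)‖ ≤ B * (‖y 0 - c 0‖ + |T - T₀|) ^ 2 := by
  have hC := hf.pos
  obtain ⟨M, hM0, hMc, hM⟩ := hc.exists_variational hf hT₀'
  have hexp := Real.exp_pos C
  set B := Real.exp C ^ 3 + 2 * C * Real.exp C + 3 * C ^ 2 with hB
  have hBpos : 0 < B := by positivity
  have key : ∀ T ≤ 1, ∀ y, IsTrajectory f K T y →
      ‖y T - c T₀ - M T₀ (y 0 - c 0) - (T - T₀) • f (c T₀)‖ ≤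
        B * (‖y 0 - c 0‖ + |T - T₀|) ^ 2 := by
    intro T hT y hy
    have hT0 := hy.nonneg
    have hT00 := hc.nonneg
    -- Neither curve need continue beyond its own duration, since it may end on the boundary. They
    -- are compared at the last common time, and the rest of the longer one is replaced by its
    -- tangent `f (c T₀)`.
    set m := min T T₀ with hm
    have hm0 : 0 ≤ m := le_min hT0 hT00
    have hmT : m ≤ T := min_le_left _ _
    have hmT₀ : m ≤ T₀ := min_le_right _ _
    set δ := ‖y 0 - c 0‖ with hδ
    have hδ0 : 0 ≤ δ := norm_nonneg _
    set s := |T - T₀| with hs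
    have hs0 : 0 ≤ s := abs_nonneg _
    have hTm : T - m ≤ s := by
      rcases le_total T T₀ with h | h
      · rw [hm, min_eq_left h, sub_self]; exact hs0
      · rw [hm, min_eq_right h]; exact le_abs_self _
    have hT₀m : T₀ - m ≤ s := by
      rcases le_total T T₀ with h | h
      · rw [hm, min_eq_left h]; rw [hs, abs_sub_comm]; exact le_abs_self _
      · rw [hm, min_eq_right h, sub_self]; exact hs0
    have hym := hy.mono hm0 hmT subset_rfl
    have hcm := hc.mono hm0 hmT₀ subset_rfl
    have hIcc : Icc 0 m ⊆ Icc 0 T₀ := Icc_subset_Icc_right hmT₀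
    have hM' : ∀ t ∈ Ico 0 m, HasDerivWithinAt M ((A (c t)).comp (M t)) (Ici t) t :=
      fun t ht => hM t ⟨ht.1, ht.2.trans_le hmT₀⟩
    have d1 : ‖y m - c m - M m (y 0 - c 0)‖ ≤ Real.exp C ^ 3 * δ ^ 2 :=
      norm_sub_variational_le hf hym hcm (hmT.trans hT) hM0 (hMc.mono hIcc) hM' ⟨hm0, le_rfl⟩
    have d2 : ‖M T₀ (y 0 - c 0) - M m (y 0 - c 0)‖ ≤ C * Real.exp C * s * δ := by
      have h1 : ‖M T₀ - M m‖ ≤ C * Real.exp C * (T₀ - m) := by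
        refine norm_image_sub_le_of_norm_deriv_right_le_segment (f' := fun t => (A (c t)).comp (M t))
          (hMc.mono (Icc_subset_Icc_left hm0)) (fun t ht => hM t ⟨hm0.trans ht.1, ht.2⟩) ?_ T₀
          ⟨hmT₀, le_rfl⟩
        intro t ht
        have ht' : t ∈ Icc 0 T₀ := ⟨hm0.trans ht.1, ht.2.le⟩
        exact (ContinuousLinearMap.opNorm_comp_le _ _).trans (mul_le_mul
          (hf.deriv_norm_le _ (hc.mem t ht')) (norm_variational_le hf hc hT₀ hM0 hMc hM ht')
          (norm_nonneg _) hC.le)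
      rw [← sub_apply]
      refine ((M T₀ - M m).le_opNorm _).trans ?_
      refine mul_le_mul_of_nonneg_right (h1.trans ?_) hδ0
      gcongr
    have d3 : ‖c T₀ - c m - (T₀ - m) • f (c T₀)‖ ≤ C * (C * s) * (T₀ - m) := by
      refine hc.norm_sub_sub_smul_le hm0 hmT₀ le_rfl fun u hu => ?_
      refine (hf.lip _ (hc.mem u ⟨hm0.trans hu.1, hu.2.le⟩) _ (hc.mem _ ⟨hT00, le_rfl⟩)).trans ?_
      gcongr
      rw [norm_sub_rev]
      refine (hc.norm_sub_le hf (hm0.trans hu.1) hu.2.le le_rfl).trans ?_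
      gcongr
      linarith [hu.1]
    have dm : ‖y m - c m‖ ≤ Real.exp C * δ := hym.dist_le hf hcm (hmT.trans hT) ⟨hm0, le_rfl⟩
    have dm' : ‖c m - c T₀‖ ≤ C * s := by
      rw [norm_sub_rev]
      refine (hc.norm_sub_le hf hm0 hmT₀ le_rfl).trans ?_
      gcongr
    have d4 : ‖y T - y m - (T - m) • f (c T₀)‖ ≤ C * (C * s + Real.exp C * δ + C * s) * (T - m) := by
      refine hy.norm_sub_sub_smul_le hm0 hmT le_rfl fun u hu => ?_
      refine (hf.lip _ (hy.mem u ⟨hm0.trans hu.1, hu.2.le⟩) _ (hc.mem _ ⟨hT00, le_rfl⟩)).trans ?_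
      gcongr
      have h1 : ‖y u - y m‖ ≤ C * s := by
        refine (hy.norm_sub_le hf hm0 hu.1 hu.2.le).trans ?_
        gcongr
        linarith [hu.2]
      calc ‖y u - c T₀‖ = ‖(y u - y m) + (y m - c m) + (c m - c T₀)‖ := by congr 1; abel
        _ ≤ ‖y u - y m‖ + ‖y m - c m‖ + ‖c m - c T₀‖ := norm_add₃_le
        _ ≤ _ := by gcongr
    have e : y T - c T₀ - M T₀ (y 0 - c 0) - (T - T₀) • f (c T₀) =
        (y m - c m - M m (y 0 - c 0)) - (M T₀ (y 0 - c 0) - M m (y 0 - c 0)) -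
        (c T₀ - c m - (T₀ - m) • f (c T₀)) + (y T - y m - (T - m) • f (c T₀)) := by
      have : (T - T₀) • f (c T₀) = (T - m) • f (c T₀) - (T₀ - m) • f (c T₀) := by
        rw [← sub_smul]; congr 1; ring
      rw [this]; abel
    rw [e]
    have e2 : ‖(y m - c m - M m (y 0 - c 0)) - (M T₀ (y 0 - c 0) - M m (y 0 - c 0)) -
        (c T₀ - c m - (T₀ - m) • f (c T₀)) + (y T - y m - (T - m) • f (c T₀))‖ ≤
        Real.exp C ^ 3 * δ ^ 2 + C * Real.exp C * s * δ + C * (C * s) * s +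
          C * (C * s + Real.exp C * δ + C * s) * s := by
      refine (norm_add_le _ _).trans (add_le_add ((_root_.norm_sub_le _ _).trans (add_le_add
        ((_root_.norm_sub_le _ _).trans (add_le_add d1 d2)) (d3.trans ?_))) (d4.trans ?_)) <;> gcongr
    refine e2.trans ?_
    have p1 : 0 ≤ δ * s := mul_nonneg hδ0 hs0
    have hE3 : 0 ≤ Real.exp C ^ 3 := by positivity
    have q1 : Real.exp C ^ 3 * δ ^ 2 ≤ Real.exp C ^ 3 * (δ + s) ^ 2 := by gcongr; linarith
    have q2 : 2 * C * Real.exp C * (δ * s) ≤ 2 * C * Real.exp C * (δ + s) ^ 2 := by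
      gcongr; nlinarith
    have q3 : 3 * C ^ 2 * s ^ 2 ≤ 3 * C ^ 2 * (δ + s) ^ 2 := by gcongr; linarith
    rw [hB]
    linarith
  -- To see that `M T₀` carries the initial velocity to the final one, apply `key` to the shifted
  -- curve `c (h + ·)` of duration `T₀ - h`, which also ends at `c T₀`; divide by `h` and let `h`
  -- tend to `0`. For `T₀ = 0` the map is the identity.
  refine ⟨M T₀, ?_, B, hBpos, key⟩
  rcases hc.nonneg.eq_or_lt with h0 | h0
  · rw [← h0, hM0]; rfl
  · have hlim : Tendsto (fun h : ℝ => M T₀ (h⁻¹ • (c h - c 0)) - f (c T₀)) (𝓝[>] 0)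
        (𝓝 (M T₀ (f (c 0)) - f (c T₀))) := by
      have h1 := (hasDerivWithinAt_iff_tendsto_slope' (x := (0 : ℝ)) (s := Ioi 0) (by simp)).1
        ((hc.deriv 0 ⟨le_rfl, h0⟩).mono Ioi_subset_Ici_self)
      have h2 : Tendsto (fun h : ℝ => h⁻¹ • (c h - c 0)) (𝓝[>] 0) (𝓝 (f (c 0))) := by
        refine h1.congr fun h => ?_
        simp [slope_def_module]
      exact (((M T₀).continuous.tendsto _).comp h2).sub tendsto_const_nhds
    have hlim0 : Tendsto (fun h : ℝ => M T₀ (h⁻¹ • (c h - c 0)) - f (c T₀)) (𝓝[>] 0) (𝓝 0) := by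
      refine squeeze_zero_norm' (a := fun h : ℝ => B * (C + 1) ^ 2 * h) ?_ ?_
      · filter_upwards [Ioc_mem_nhdsGT h0] with h hh
        have h1 := key (T₀ - h) (by linarith [hh.1]) _ (hc.shift hh.1.le hh.2)
        have h2 : ‖c h - c 0‖ ≤ C * h := by simpa using hc.norm_sub_le hf le_rfl hh.1.le hh.2
        have h3 : |T₀ - h - T₀| = h := by rw [show T₀ - h - T₀ = -h by ring, abs_neg, abs_of_pos hh.1]
        simp only [add_sub_cancel, sub_self, zero_sub, add_zero] at h1
        rw [h3] at h1
        have h4 : M T₀ (h⁻¹ • (c h - c 0)) - f (c T₀) =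
            -(h⁻¹ • (-(M T₀) (c h - c 0) - (T₀ - h - T₀) • f (c T₀))) := by
          rw [map_smul, show T₀ - h - T₀ = -h by ring, neg_smul, sub_neg_eq_add, smul_add, smul_neg,
            smul_smul, inv_mul_cancel₀ hh.1.ne', one_smul]
          abel
        rw [h4, norm_neg, norm_smul, norm_inv, Real.norm_eq_abs, abs_of_pos hh.1,
          inv_mul_le_iff₀ hh.1]
        refine h1.trans ?_
        calc B * (‖c h - c 0‖ + h) ^ 2 ≤ B * (C * h + h) ^ 2 := by
              have := hh.1; gcongr
          _ = h * (B * (C + 1) ^ 2 * h) := by ring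
      · have : Tendsto (fun h : ℝ => B * (C + 1) ^ 2 * h) (𝓝 0) (𝓝 (B * (C + 1) ^ 2 * 0)) :=
          tendsto_const_nhds.mul tendsto_id
        rw [mul_zero] at this
        exact this.mono_left nhdsWithin_le_nhds
    exact sub_eq_zero.1 (tendsto_nhds_unique hlim hlim0)

end Field

end

noncomputable section

set_option linter.unusedSectionVars false

/-! ### Vector fields in charts -/

section Charts

variable {E : Type*} [NormedAddCommGroup E] [NormedSpace ℝ E]
  {H : Type*} [TopologicalSpace H] {I : ModelWithCorners ℝ E H}
  {M : Type*} [TopologicalSpace M] [ChartedSpace H M] [IsManifold I ∞ M]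

/-- The coordinate expression of the vector field `v` in the preferred chart at `q`. -/
def chartField (I : ModelWithCorners ℝ E H) [IsManifold I ∞ M] (v : M → E) (q : M) (u : E) : E :=
  tangentCoordChange I ((extChartAt I q).symm u) q ((extChartAt I q).symm u)
    (v ((extChartAt I q).symm u))

theorem chartField_extChartAt (v : M → E) {q x : M}
    (hx : x ∈ (chartAt H q).source) :
    chartField I v q (extChartAt I q x) = tangentCoordChange I x q x (v x) := by
  rw [chartField, (extChartAt I q).left_inv (by rwa [extChartAt_source])]

theorem chartField_extChartAt_self (v : M → E) (q : M) :
    chartField I v q (extChartAt I q q) = v q := by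
  rw [chartField_extChartAt v (mem_chart_source H q)]
  exact tangentCoordChange_self (mem_extChartAt_source q)

/-- The trivialization of the tangent bundle at `q` reads off this coordinate expression, so
smoothness of the section is smoothness of its fibre part. Two derivatives suffice for a quadratic
remainder. Differentiability is within `range I` because `q` may be a boundary point. -/
theorem contDiffWithinAt_chartField {v : M → E}
    (hv : ContMDiff I I.tangent ∞ (fun x => (⟨x, (v x : TangentSpace I x)⟩ : TangentBundle I M))) (q : M) {u : E}
    (hu : u ∈ (extChartAt I q).target) : ContDiffWithinAt ℝ 2 (chartField I v q) (range I) u := by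
  have : IsManifold I (2 + 1) M := IsManifold.of_le (n := ∞) (by
    rw [show (2 + 1 : ℕ∞ω) = 3 by norm_num]; exact ENat.LEInfty.out)
  have h1 : ContMDiffOn I 𝓘(ℝ, E) 2
      (fun x => (trivializationAt E (TangentSpace I) q ⟨x, (v x : TangentSpace I x)⟩).2) (chartAt H q).source := by
    refine (Bundle.Trivialization.contMDiffOn_section_iff (IB := I)
      (trivializationAt E (TangentSpace I) q) (chartAt H q).open_source ?_).1 ?_
    · rw [TangentBundle.trivializationAt_baseSet]
    · exact (hv.of_le (ENat.LEInfty.out)).contMDiffOn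
  have h2 : ContMDiffOn 𝓘(ℝ, E) 𝓘(ℝ, E) 2
      ((fun x => (trivializationAt E (TangentSpace I) q ⟨x, (v x : TangentSpace I x)⟩).2) ∘ (extChartAt I q).symm)
      (extChartAt I q).target := by
    have : IsManifold I 2 M := IsManifold.of_le (n := ∞) (ENat.LEInfty.out)
    refine h1.comp (contMDiffOn_extChartAt_symm q) fun x hx => ?_
    have := (extChartAt I q).map_target hx
    rwa [extChartAt_source] at this
  have h3 := (contMDiffOn_iff_contDiffOn.1 h2) u hu
  refine ContDiffWithinAt.congr_of_mem ?_ (fun y hy => rfl) (extChartAt_target_subset_range q hu)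
  refine h3.mono_of_mem_nhdsWithin (extChartAt_target_mem_nhdsWithin_of_mem hu)

theorem IsTameField.mono {f : E → E} {A : E → E →L[ℝ] E} {K K' : Set E} {C : ℝ}
    (h : IsTameField f A K C) (hK : K' ⊆ K) : IsTameField f A K' C :=
  ⟨h.pos, fun x hx => h.norm_le x (hK hx), fun x hx y hy => h.lip x (hK hx) y (hK hy),
    fun x hx => h.deriv_norm_le x (hK hx), fun x hx y hy => h.deriv_lip x (hK hx) y (hK hy),
    fun x hx y hy => h.quad x (hK hx) y (hK hy)⟩

/-- The part of a closed ball inside the range of the model with corners. -/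
def modelBall (I : ModelWithCorners ℝ E H) (u : E) (r : ℝ) : Set E :=
  range I ∩ Metric.closedBall u r

/-- A `C²` field and its derivative are locally Lipschitz. The model ball is convex, also at the
boundary, so the mean value inequality along segments gives the quadratic remainder bound. -/
theorem exists_isTameField {v : M → E}
    (hv : ContMDiff I I.tangent ∞ (fun x => (⟨x, (v x : TangentSpace I x)⟩ : TangentBundle I M))) (q : M) :
    ∃ A : E → E →L[ℝ] E, ∃ C, ∃ r > 0,
      IsTameField (chartField I v q) A (modelBall I (extChartAt I q q) r) C ∧
      modelBall I (extChartAt I q q) r ⊆ (extChartAt I q).target := by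
  set f := chartField I v q with hf
  set u₀ := extChartAt I q q with hu₀
  have hmem : u₀ ∈ range I := extChartAt_target_subset_range q (mem_extChartAt_target q)
  have hf2 : ContDiffWithinAt ℝ 2 f (range I) u₀ :=
    contDiffWithinAt_chartField hv q (mem_extChartAt_target q)
  set A := fderivWithin ℝ f (range I) with hA
  have hA1 : ContDiffWithinAt ℝ 1 A (range I) u₀ :=
    hf2.fderivWithin_right I.uniqueDiffOn (by norm_num) hmem
  obtain ⟨K1, t1, ht1, hL1⟩ := (hf2.of_le one_le_two).exists_lipschitzOnWith I.convex_range
  obtain ⟨K2, t2, ht2, hL2⟩ := hA1.exists_lipschitzOnWith I.convex_range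
  have h3 : ∀ᶠ u in 𝓝[range I] u₀, ‖f u‖ < ‖f u₀‖ + 1 :=
    (hf2.continuousWithinAt.norm).eventually (gt_mem_nhds (lt_add_one _))
  have h4 : ∀ᶠ u in 𝓝[range I] u₀, ‖A u‖ < ‖A u₀‖ + 1 :=
    (hA1.continuousWithinAt.norm).eventually (gt_mem_nhds (lt_add_one _))
  have h5 : ∀ᶠ u in 𝓝[range I] u₀, u ∈ t1 ∧ u ∈ t2 ∧ u ∈ (extChartAt I q).target ∧
      ‖f u‖ < ‖f u₀‖ + 1 ∧ ‖A u‖ < ‖A u₀‖ + 1 := by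
    filter_upwards [ht1, ht2, extChartAt_target_mem_nhdsWithin q, h3, h4] with u a b c d e
    exact ⟨a, b, c, d, e⟩
  obtain ⟨r, hr, hr'⟩ := (nhdsWithin_hasBasis Metric.nhds_basis_closedBall _).eventually_iff.1 h5
  have hr'' : ∀ u ∈ modelBall I u₀ r, u ∈ t1 ∧ u ∈ t2 ∧ u ∈ (extChartAt I q).target ∧
      ‖f u‖ < ‖f u₀‖ + 1 ∧ ‖A u‖ < ‖A u₀‖ + 1 := fun u hu => hr' ⟨hu.2, hu.1⟩
  have hconv : Convex ℝ (modelBall I u₀ r) := I.convex_range.inter (convex_closedBall _ _)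
  refine ⟨A, max (max K1 K2) (max (‖f u₀‖ + 1) (‖A u₀‖ + 1)), r, hr, ⟨?_, ?_, ?_, ?_, ?_, ?_⟩,
    fun u hu => (hr'' u hu).2.2.1⟩
  · exact lt_max_of_lt_right (lt_max_of_lt_left (by positivity))
  · exact fun x hx => (hr'' x hx).2.2.2.1.le.trans
      ((le_max_left _ _).trans (le_max_right _ _))
  · intro x hx y hy
    have := hL1.dist_le_mul x (hr'' x hx).1 y (hr'' y hy).1
    rw [dist_eq_norm, dist_eq_norm] at this
    refine this.trans (mul_le_mul_of_nonneg_right ?_ (norm_nonneg _))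
    exact (le_max_left _ _).trans (le_max_left _ _)
  · exact fun x hx => (hr'' x hx).2.2.2.2.le.trans
      ((le_max_right _ _).trans (le_max_right _ _))
  · intro x hx y hy
    have := hL2.dist_le_mul x (hr'' x hx).2.1 y (hr'' y hy).2.1
    rw [dist_eq_norm, dist_eq_norm] at this
    refine this.trans (mul_le_mul_of_nonneg_right ?_ (norm_nonneg _))
    exact (le_max_right _ _).trans (le_max_left _ _)
  · intro x hx y hy
    have hseg : segment ℝ x y ⊆ modelBall I u₀ r := hconv.segment_subset hx hy
    have hder : ∀ z ∈ segment ℝ x y, HasFDerivWithinAt f (A z) (segment ℝ x y) z := fun z hz =>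
      (((contDiffWithinAt_chartField hv q (hr'' z (hseg hz)).2.2.1).differentiableWithinAt
        (by norm_num)).hasFDerivWithinAt).mono (hseg.trans inter_subset_left)
    have hbd : ∀ z ∈ segment ℝ x y, ‖A z - A x‖ ≤ K2 * ‖y - x‖ := by
      intro z hz
      have := hL2.dist_le_mul z (hr'' z (hseg hz)).2.1 x (hr'' x hx).2.1
      rw [dist_eq_norm, dist_eq_norm] at this
      refine this.trans (mul_le_mul_of_nonneg_left ?_ K2.2)
      have hz' : z ∈ segment ℝ y x := by rwa [segment_symm]
      have := norm_sub_le_of_mem_segment hz'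
      rw [norm_sub_rev z x]
      obtain ⟨a, b, ha, hb, hab, rfl⟩ := hz
      have e : x - (a • x + b • y) = b • (x - y) := by
        have : a = 1 - b := by linarith
        rw [this]; module
      rw [e, norm_smul, Real.norm_eq_abs, abs_of_nonneg hb, norm_sub_rev x y]
      exact mul_le_of_le_one_left (norm_nonneg _) (by linarith)
    have := Convex.norm_image_sub_le_of_norm_hasFDerivWithin_le' hder hbd (convex_segment x y)
      (left_mem_segment ℝ x y) (right_mem_segment ℝ x y)
    refine this.trans ?_
    rw [mul_assoc, ← sq]
    refine mul_le_mul_of_nonneg_right ?_ (by positivity)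
    exact (le_max_right _ _).trans (le_max_left _ _)

theorem hasMFDerivWithinAt_real_iff {c : ℝ → M} {s : Set ℝ} {t : ℝ} {w : E} :
    HasMFDerivWithinAt 𝓘(ℝ, ℝ) I c s t ((1 : ℝ →L[ℝ] ℝ).smulRight w : ℝ →L[ℝ] E) ↔
      ContinuousWithinAt c s t ∧ HasFDerivWithinAt (extChartAt I (c t) ∘ c)
        (ContinuousLinearMap.toSpanSingleton ℝ w) s t := by
  have hs : (extChartAt 𝓘(ℝ, ℝ) t).symm ⁻¹' s ∩ range 𝓘(ℝ, ℝ) = s := by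
    rw [extChartAt_model_space_eq_id]; simp
  have hw : ((1 : ℝ →L[ℝ] ℝ).smulRight w : ℝ →L[ℝ] E) =
      ContinuousLinearMap.toSpanSingleton ℝ w := by ext; simp
  refine and_congr_right fun _ => ?_
  constructor
  · intro h
    have h' : HasFDerivWithinAt (extChartAt I (c t) ∘ c)
      ((1 : ℝ →L[ℝ] ℝ).smulRight w : ℝ →L[ℝ] E)
      ((extChartAt 𝓘(ℝ, ℝ) t).symm ⁻¹' s ∩ range 𝓘(ℝ, ℝ)) t := h
    rwa [hs, hw] at h'
  · intro h
    have h' : HasFDerivWithinAt (extChartAt I (c t) ∘ c)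
      ((1 : ℝ →L[ℝ] ℝ).smulRight w : ℝ →L[ℝ] E)
      ((extChartAt 𝓘(ℝ, ℝ) t).symm ⁻¹' s ∩ range 𝓘(ℝ, ℝ)) t := by rwa [hs, hw]
    exact h'

/-- The coordinate expression of a curve tangent to `v`. -/
theorem HasMFDerivWithinAt.hasDerivWithinAt_extChartAt {v : M → E} {c : ℝ → M}
    {s : Set ℝ} {t : ℝ} {q : M}
    (h : HasMFDerivWithinAt 𝓘(ℝ, ℝ) I c s t ((1 : ℝ →L[ℝ] ℝ).smulRight (v (c t)) : ℝ →L[ℝ] E))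
    (hq : c t ∈ (chartAt H q).source) :
    HasDerivWithinAt (extChartAt I q ∘ c) (chartField I v q (extChartAt I q (c t))) s t := by
  have h1 : HasDerivWithinAt (extChartAt I (c t) ∘ c) (v (c t)) s t := by
    rw [hasDerivWithinAt_iff_hasFDerivWithinAt]
    exact hasMFDerivWithinAt_real_iff.1 h
      |>.2
  have hq' : c t ∈ (extChartAt I q).source := by rwa [extChartAt_source]
  have h2 := hasFDerivWithinAt_tangentCoordChange (I := I) (x := c t) (y := q) (z := c t)
    ⟨mem_extChartAt_source _, hq'⟩
  have h3 := HasFDerivWithinAt.comp_hasDerivWithinAt (f := extChartAt I (c t) ∘ c) t h2 h1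
    (fun u _ => by simp [extChartAt])
  rw [chartField_extChartAt v hq]
  have hev : ∀ᶠ u in 𝓝[s] t, c u ∈ (chartAt H (c t)).source :=
    h.1.preimage_mem_nhdsWithin (chart_source_mem_nhds H (c t))
  refine h3.congr_of_eventuallyEq ?_ ?_
  · filter_upwards [hev] with u hu
    simp only [Function.comp_apply]
    rw [(extChartAt I (c t)).left_inv (by rwa [extChartAt_source])]
  · simp only [Function.comp_apply]
    rw [(extChartAt I (c t)).left_inv (mem_extChartAt_source _)]

/-- The converse of `HasMFDerivWithinAt.hasDerivWithinAt_extChartAt`. -/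
theorem hasMFDerivWithinAt_of_hasDerivWithinAt_extChartAt {v : M → E}
    {c : ℝ → M} {s : Set ℝ} {t : ℝ} {q : M} (hc : ContinuousWithinAt c s t)
    (hq : c t ∈ (chartAt H q).source)
    (h : HasDerivWithinAt (extChartAt I q ∘ c) (chartField I v q (extChartAt I q (c t))) s t) :
    HasMFDerivWithinAt 𝓘(ℝ, ℝ) I c s t ((1 : ℝ →L[ℝ] ℝ).smulRight (v (c t))) := by
  have hq' : c t ∈ (extChartAt I q).source := by rwa [extChartAt_source]
  have h2 := hasFDerivWithinAt_tangentCoordChange (I := I) (x := q) (y := c t) (z := c t)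
    ⟨hq', mem_extChartAt_source _⟩
  have h3 := HasFDerivWithinAt.comp_hasDerivWithinAt (f := extChartAt I q ∘ c) t h2 h
    (fun u _ => by simp [extChartAt])
  rw [chartField_extChartAt v hq, tangentCoordChange_comp
    ⟨⟨mem_extChartAt_source _, hq'⟩, mem_extChartAt_source _⟩,
    tangentCoordChange_self (mem_extChartAt_source _)] at h3
  have hev : ∀ᶠ u in 𝓝[s] t, c u ∈ (chartAt H q).source :=
    hc.preimage_mem_nhdsWithin ((chartAt H q).open_source.mem_nhds hq)
  have h4 : HasDerivWithinAt (extChartAt I (c t) ∘ c) (v (c t)) s t := by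
    refine h3.congr_of_eventuallyEq ?_ ?_
    · filter_upwards [hev] with u hu
      simp only [Function.comp_apply]
      rw [(extChartAt I q).left_inv (by rwa [extChartAt_source])]
    · simp only [Function.comp_apply]
      rw [(extChartAt I q).left_inv hq']
  rw [hasDerivWithinAt_iff_hasFDerivWithinAt] at h4
  exact hasMFDerivWithinAt_real_iff.2 ⟨hc, h4⟩

end Charts

end

noncomputable section

set_option linter.unusedSectionVars false

namespace HybridSystem

variable {J : Type*} {d : J → ℕ} {D : J → Type*}
  [∀ j, TopologicalSpace (D j)] [∀ j, ChartedSpace (EuclideanHalfSpace (d j + 1)) (D j)]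
  [∀ j, IsManifold (𝓡∂ (d j + 1)) ∞ (D j)]

/-! ### Coordinates on the total space -/

/-- The component in `D q.1` of a point of the total space; junk for points of other components. -/
def proj (q m : Σ j, D j) : D q.1 := open scoped Classical in
  if h : m.1 = q.1 then h ▸ m.2 else q.2

@[simp] theorem proj_mk (q : Σ j, D j) (a : D q.1) : proj q ⟨q.1, a⟩ = a := by simp [proj]

theorem mk_proj {q m : Σ j, D j} (h : m.1 = q.1) : (⟨q.1, proj q m⟩ : Σ j, D j) = m := by
  obtain ⟨j, x⟩ := q
  obtain ⟨l, y⟩ := m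
  obtain rfl : l = j := h
  simp [proj]

variable (d) in
/-- Coordinates in the preferred chart at `q`. -/
def coord (q m : Σ j, D j) : EuclideanSpace ℝ (Fin (d q.1 + 1)) :=
  extChartAt (𝓡∂ (d q.1 + 1)) q.2 (proj q m)

@[simp] theorem coord_mk (q : Σ j, D j) (a : D q.1) :
    coord d q ⟨q.1, a⟩ = extChartAt (𝓡∂ (d q.1 + 1)) q.2 a := by simp [coord]

theorem coord_self (q : Σ j, D j) : coord d q q = extChartAt (𝓡∂ (d q.1 + 1)) q.2 q.2 :=
  coord_mk q q.2

variable (d) in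
/-- The domain of the preferred chart at `q`. -/
def dom (q : Σ j, D j) : Set (Σ j, D j) :=
  Sigma.mk q.1 '' (chartAt (EuclideanHalfSpace (d q.1 + 1)) q.2).source

theorem mk_mem_dom {q : Σ j, D j} {a : D q.1} :
    (⟨q.1, a⟩ : Σ j, D j) ∈ dom d q ↔
      a ∈ (chartAt (EuclideanHalfSpace (d q.1 + 1)) q.2).source := by
  simp [dom]

theorem isOpen_dom (q : Σ j, D j) : IsOpen (dom d q) :=
  isOpenMap_sigmaMk _ (chartAt (EuclideanHalfSpace (d q.1 + 1)) q.2).open_source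

theorem self_mem_dom (q : Σ j, D j) : q ∈ dom d q :=
  mk_mem_dom.2 (mem_chart_source _ _)

theorem fst_eq_of_mem_dom {q m : Σ j, D j} (h : m ∈ dom d q) : m.1 = q.1 := by
  obtain ⟨a, _, rfl⟩ := h
  rfl

variable (d) in
/-- The point with coordinates `u` in the preferred chart at `q`. -/
def pt (q : Σ j, D j) (u : EuclideanSpace ℝ (Fin (d q.1 + 1))) : Σ j, D j :=
  ⟨q.1, (extChartAt (𝓡∂ (d q.1 + 1)) q.2).symm u⟩

theorem pt_coord {q m : Σ j, D j} (h : m ∈ dom d q) : pt d q (coord d q m) = m := by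
  obtain ⟨a, ha, rfl⟩ := h
  rw [pt, coord_mk, (extChartAt (𝓡∂ (d q.1 + 1)) q.2).left_inv (by rwa [extChartAt_source])]

theorem coord_pt {q : Σ j, D j} {u : EuclideanSpace ℝ (Fin (d q.1 + 1))}
    (h : u ∈ (extChartAt (𝓡∂ (d q.1 + 1)) q.2).target) : coord d q (pt d q u) = u := by
  rw [pt, coord_mk, (extChartAt (𝓡∂ (d q.1 + 1)) q.2).right_inv h]

theorem pt_mem_dom {q : Σ j, D j} {u : EuclideanSpace ℝ (Fin (d q.1 + 1))}
    (h : u ∈ (extChartAt (𝓡∂ (d q.1 + 1)) q.2).target) : pt d q u ∈ dom d q := by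
  rw [pt, mk_mem_dom, ← extChartAt_source (𝓡∂ (d q.1 + 1))]
  exact (extChartAt (𝓡∂ (d q.1 + 1)) q.2).map_target h

theorem coord_mem_target {q m : Σ j, D j} (h : m ∈ dom d q) :
    coord d q m ∈ (extChartAt (𝓡∂ (d q.1 + 1)) q.2).target := by
  obtain ⟨a, ha, rfl⟩ := h
  rw [coord_mk]
  exact (extChartAt (𝓡∂ (d q.1 + 1)) q.2).map_source (by rwa [extChartAt_source])

theorem coord_mem_range (q m : Σ j, D j) : coord d q m ∈ range (𝓡∂ (d q.1 + 1)) := by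
  simp only [coord, extChartAt, OpenPartialHomeomorph.extend_coe, Function.comp_apply]
  exact mem_range_self _

theorem coord_nonneg (q m : Σ j, D j) : 0 ≤ coord d q m 0 := by
  have h := coord_mem_range (d := d) q m
  rw [range_modelWithCornersEuclideanHalfSpace] at h
  exact h

theorem continuousAt_proj {q m : Σ j, D j} (h : m.1 = q.1) : ContinuousAt (proj q) m := by
  obtain ⟨j, x⟩ := q
  obtain ⟨l, y⟩ := m
  obtain rfl : l = j := h
  rw [ContinuousAt, Sigma.nhds_mk, tendsto_map'_iff]
  have h1 : proj (⟨l, x⟩ : Σ j, D j) ∘ Sigma.mk l = id := by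
    funext a
    exact proj_mk (⟨l, x⟩ : Σ j, D j) a
  rw [h1]
  simpa [proj] using tendsto_id

theorem continuousAt_coord {q m : Σ j, D j} (h : m ∈ dom d q) : ContinuousAt (coord d q) m := by
  have h1 : proj q m ∈ (extChartAt (𝓡∂ (d q.1 + 1)) q.2).source := by
    obtain ⟨a, ha, rfl⟩ := h
    rwa [proj_mk, extChartAt_source]
  exact ContinuousAt.comp (continuousAt_extChartAt' h1) (continuousAt_proj (fst_eq_of_mem_dom h))

theorem continuousOn_pt (q : Σ j, D j) :
    ContinuousOn (pt d q) (extChartAt (𝓡∂ (d q.1 + 1)) q.2).target :=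
  continuous_sigmaMk.comp_continuousOn (continuousOn_extChartAt_symm q.2)

variable (d) in
/-- A closed coordinate ball. -/
def box (q : Σ j, D j) (r : ℝ) : Set (Σ j, D j) :=
  {m | m ∈ dom d q ∧ ‖coord d q m - coord d q q‖ ≤ r}

theorem coord_mem_modelBall {q m : Σ j, D j} {r : ℝ} (h : m ∈ box d q r) :
    coord d q m ∈ modelBall (𝓡∂ (d q.1 + 1)) (coord d q q) r :=
  ⟨coord_mem_range q m, by simpa [dist_eq_norm] using h.2⟩

theorem box_mem_nhds (q : Σ j, D j) {r : ℝ} (hr : 0 < r) : box d q r ∈ 𝓝 q := by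
  have h1 : ∀ᶠ m in 𝓝 q, ‖coord d q m - coord d q q‖ < r := by
    have := (continuousAt_coord (self_mem_dom (d := d) q)).eventually
      (Metric.ball_mem_nhds _ hr)
    simpa [dist_eq_norm] using this
  filter_upwards [h1, (isOpen_dom (d := d) q).mem_nhds (self_mem_dom q)] with m hm hm'
  exact ⟨hm', hm.le⟩

theorem box_mono (q : Σ j, D j) {r r' : ℝ} (h : r ≤ r') : box d q r ⊆ box d q r' :=
  fun _ hm => ⟨hm.1, hm.2.trans h⟩

theorem exists_box_subset (q : Σ j, D j) {N : Set (Σ j, D j)} (hN : N ∈ 𝓝 q) :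
    ∃ r > 0, box d q r ⊆ N := by
  have hc : ContinuousWithinAt (pt d q) (extChartAt (𝓡∂ (d q.1 + 1)) q.2).target (coord d q q) :=
    continuousOn_pt q _ (coord_mem_target (self_mem_dom q))
  have h1 : ∀ᶠ u in 𝓝[(extChartAt (𝓡∂ (d q.1 + 1)) q.2).target] (coord d q q), pt d q u ∈ N := by
    have := hc.tendsto
    rw [pt_coord (self_mem_dom q)] at this
    exact this hN
  obtain ⟨r, hr, h⟩ := (nhdsWithin_hasBasis Metric.nhds_basis_closedBall _).eventually_iff.1 h1
  refine ⟨r, hr, fun m hm => ?_⟩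
  have := h ⟨by simpa [dist_eq_norm] using hm.2, coord_mem_target hm.1⟩
  rwa [pt_coord hm.1] at this

/-- The box is the image of a compact piece of the half space under the inverse chart, and the
manifold is Hausdorff. Closedness keeps limits of states, in particular exit points, inside the box.
-/
theorem isClosed_box [∀ j, T2Space (D j)] (q : Σ j, D j) {r : ℝ}
    (h : modelBall (𝓡∂ (d q.1 + 1)) (coord d q q) r ⊆ (extChartAt (𝓡∂ (d q.1 + 1)) q.2).target) :
    IsClosed (box d q r) := by
  have h1 : box d q r = pt d q '' modelBall (𝓡∂ (d q.1 + 1)) (coord d q q) r := by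
    ext m
    constructor
    · exact fun hm => ⟨_, coord_mem_modelBall hm, pt_coord hm.1⟩
    · rintro ⟨u, hu, rfl⟩
      refine ⟨pt_mem_dom (h hu), ?_⟩
      rw [coord_pt (h hu)]
      simpa [dist_eq_norm] using hu.2
  rw [h1]
  refine (IsCompact.image_of_continuousOn ?_ ((continuousOn_pt q).mono h)).isClosed
  exact (isCompact_closedBall _ _).inter_left (𝓡∂ (d q.1 + 1)).isClosed_range

/-- Being a boundary point can be tested in any chart of the atlas, and the chart target is open in
the half space, so its frontier and that of the half space agree at points of the target. -/
theorem mem_boundary_iff {q m : Σ j, D j} (h : m ∈ dom d q) :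
    m.2 ∈ (𝓡∂ (d m.1 + 1)).boundary (D m.1) ↔ coord d q m 0 = 0 := by
  obtain ⟨a, ha, rfl⟩ := h
  rw [coord_mk]
  have h1 := (𝓡∂ (d q.1 + 1)).isBoundaryPoint_iff_of_mem_atlas (n := ∞) (by simp)
    (chart_mem_atlas (EuclideanHalfSpace (d q.1 + 1)) q.2) ha
  change (𝓡∂ (d q.1 + 1)).IsBoundaryPoint a ↔ _
  have ht : extChartAt (𝓡∂ (d q.1 + 1)) q.2 a ∈ (extChartAt (𝓡∂ (d q.1 + 1)) q.2).target :=
    (extChartAt (𝓡∂ (d q.1 + 1)) q.2).map_source (by rwa [extChartAt_source])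
  have hN := extChartAt_target_mem_nhdsWithin_of_mem ht
  rw [h1]
  have h2 : extChartAt (𝓡∂ (d q.1 + 1)) q.2 a ∈ frontier (extChartAt (𝓡∂ (d q.1 + 1)) q.2).target ↔
      extChartAt (𝓡∂ (d q.1 + 1)) q.2 a ∈ frontier (range (𝓡∂ (d q.1 + 1))) := by
    have hr := extChartAt_target_subset_range q.2 ht
    rw [← not_iff_not, ← mem_interior_iff_notMem_frontier ht, ← mem_interior_iff_notMem_frontier hr,
      mem_interior_iff_mem_nhds, mem_interior_iff_mem_nhds]
    constructor
    · exact fun h => mem_of_superset h (extChartAt_target_subset_range q.2)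
    · intro h
      rwa [nhdsWithin_eq_nhds.2 h] at hN
  refine h2.trans ?_
  rw [frontier_range_modelWithCornersEuclideanHalfSpace]
  exact eq_comm

end HybridSystem

end

noncomputable section

set_option linter.unusedSectionVars false

namespace HybridSystem

variable {J : Type*} {d : J → ℕ} {D : J → Type*}
  [∀ j, TopologicalSpace (D j)] [∀ j, ChartedSpace (EuclideanHalfSpace (d j + 1)) (D j)]
  [∀ j, IsManifold (𝓡∂ (d j + 1)) ∞ (D j)] (H : HybridSystem d D)

/-! ### The vector field in coordinates, and curves tangent to it -/

/-- The vector field on the component `D j`, with values in the model space. -/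
def fld (j : J) (x : D j) : EuclideanSpace ℝ (Fin (d j + 1)) := H.F j x

/-- The vector field in the preferred chart at `q`. -/
def vec (q : Σ j, D j) : EuclideanSpace ℝ (Fin (d q.1 + 1)) → EuclideanSpace ℝ (Fin (d q.1 + 1)) :=
  chartField (𝓡∂ (d q.1 + 1)) (H.fld q.1) q.2

/-- The velocity at `q`, in the preferred chart at `q`. -/
def vel (q : Σ j, D j) : EuclideanSpace ℝ (Fin (d q.1 + 1)) := H.fld q.1 q.2

theorem vec_coord_self (q : Σ j, D j) : H.vec q (coord d q q) = H.vel q := by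
  rw [coord_self]
  exact chartField_extChartAt_self (H.fld q.1) q.2

theorem contDiffWithinAt_vec (q : Σ j, D j) {u : EuclideanSpace ℝ (Fin (d q.1 + 1))}
    (hu : u ∈ (extChartAt (𝓡∂ (d q.1 + 1)) q.2).target) :
    ContDiffWithinAt ℝ 2 (H.vec q) (range (𝓡∂ (d q.1 + 1))) u :=
  contDiffWithinAt_chartField (v := H.fld q.1) (H.smooth_F q.1) q.2 hu

theorem exists_isTameField_vec (q : Σ j, D j) :
    ∃ A, ∃ C, ∃ r > 0, IsTameField (H.vec q) A (modelBall (𝓡∂ (d q.1 + 1)) (coord d q q) r) C ∧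
      modelBall (𝓡∂ (d q.1 + 1)) (coord d q q) r ⊆ (extChartAt (𝓡∂ (d q.1 + 1)) q.2).target := by
  rw [coord_self]
  exact exists_isTameField (v := H.fld q.1) (H.smooth_F q.1) q.2

theorem continuousWithinAt_vec_coord {q : Σ j, D j} {x : ℝ → Σ j, D j} {T : Set ℝ} {t : ℝ}
    (hx : ContinuousWithinAt x T t) (hq : x t ∈ dom d q) :
    ContinuousWithinAt (fun s => H.vec q (coord d q (x s))) T t := by
  have h1 := (H.contDiffWithinAt_vec q (coord_mem_target hq)).continuousWithinAt
  exact ContinuousWithinAt.comp (g := H.vec q) (f := fun s => coord d q (x s)) h1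
    ((continuousAt_coord hq).comp_continuousWithinAt hx) fun s _ => coord_mem_range _ _

/-- The curve `x` is tangent at time `t` to the vector field, within the set `T` of times. -/
def FlowsWithin (x : ℝ → Σ j, D j) (T : Set ℝ) (t : ℝ) : Prop :=
  ∃ (j : J) (c : ℝ → D j), (∀ᶠ s in 𝓝[T] t, x s = ⟨j, c s⟩) ∧
    HasMFDerivWithinAt 𝓘(ℝ, ℝ) (𝓡∂ (d j + 1)) c T t
      ((1 : ℝ →L[ℝ] ℝ).smulRight (H.F j (c t)))

variable {H} {x : ℝ → Σ j, D j} {T T' : Set ℝ} {t a b : ℝ} {q z : Σ j, D j}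

theorem FlowsWithin.hasDerivWithinAt (h : H.FlowsWithin x T t) (ht : t ∈ T) (hq : x t ∈ dom d q) :
    HasDerivWithinAt (fun s => coord d q (x s)) (H.vec q (coord d q (x t))) T t := by
  obtain ⟨j, c, hc, hm⟩ := h
  have h0 : x t = ⟨j, c t⟩ := hc.self_of_nhdsWithin ht
  rw [h0] at hq
  obtain ⟨l, y⟩ := q
  obtain rfl : j = l := fst_eq_of_mem_dom hq
  have h1 := HasMFDerivWithinAt.hasDerivWithinAt_extChartAt (v := H.fld j) hm
    (mk_mem_dom (q := ⟨j, y⟩) |>.1 hq)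
  have h2 : ∀ a : D j, coord d (⟨j, y⟩ : Σ j, D j) ⟨j, a⟩ = extChartAt (𝓡∂ (d j + 1)) y a :=
    fun a => coord_mk (⟨j, y⟩ : Σ j, D j) a
  rw [h0, h2]
  refine h1.congr_of_eventuallyEq ?_ ?_
  · filter_upwards [hc] with s hs
    rw [hs, h2]; rfl
  · rw [h0, h2]; rfl

theorem FlowsWithin.continuousWithinAt (h : H.FlowsWithin x T t) (ht : t ∈ T) :
    ContinuousWithinAt x T t := by
  obtain ⟨j, c, hc, hm⟩ := h
  have h0 : x t = ⟨j, c t⟩ := hc.self_of_nhdsWithin ht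
  have h1 : ContinuousWithinAt (fun s => (⟨j, c s⟩ : Σ j, D j)) T t :=
    continuous_sigmaMk.continuousAt.comp_continuousWithinAt hm.1
  exact h1.congr_of_eventuallyEq hc h0

theorem flowsWithin_of_hasDerivWithinAt (hc : ContinuousWithinAt x T t) (hq : x t ∈ dom d q)
    (h : HasDerivWithinAt (fun s => coord d q (x s)) (H.vec q (coord d q (x t))) T t) :
    H.FlowsWithin x T t := by
  refine ⟨q.1, fun s => proj q (x s), ?_, ?_⟩
  · filter_upwards [hc.preimage_mem_nhdsWithin ((isOpen_dom q).mem_nhds hq)] with s hs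
    exact (mk_proj (fst_eq_of_mem_dom hs)).symm
  · refine hasMFDerivWithinAt_of_hasDerivWithinAt_extChartAt (v := H.fld q.1) (q := q.2)
      ((continuousAt_proj (fst_eq_of_mem_dom hq)).comp_continuousWithinAt hc) ?_ h
    rw [← mk_proj (fst_eq_of_mem_dom hq)] at hq
    exact mk_mem_dom.1 hq

theorem FlowsWithin.mono_of_mem (h : H.FlowsWithin x T t) (hT : T ∈ 𝓝[T'] t) :
    H.FlowsWithin x T' t := by
  obtain ⟨j, c, hc, hm⟩ := h
  exact ⟨j, c, nhdsWithin_le_of_mem hT hc, hm.mono_of_mem_nhdsWithin hT⟩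

theorem FlowsWithin.mono (h : H.FlowsWithin x T t) (hT : T' ⊆ T) : H.FlowsWithin x T' t :=
  h.mono_of_mem (mem_of_superset self_mem_nhdsWithin hT)

theorem FlowsWithin.congr {y : ℝ → Σ j, D j} (h : H.FlowsWithin x T t)
    (hxy : ∀ᶠ s in 𝓝[T] t, y s = x s) : H.FlowsWithin y T t := by
  obtain ⟨j, c, hc, hm⟩ := h
  refine ⟨j, c, ?_, hm⟩
  filter_upwards [hc, hxy] with s h1 h2
  rw [h2, h1]

theorem flowsWithin_singleton (x : ℝ → Σ j, D j) (t : ℝ) : H.FlowsWithin x {t} t := by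
  refine flowsWithin_of_hasDerivWithinAt (q := x t) continuousWithinAt_singleton (self_mem_dom _) ?_
  exact HasFDerivWithinAt.of_subsingleton (by simp)

theorem FlowsWithin.comp_add (h : H.FlowsWithin x T (a + t)) (ht : a + t ∈ T) :
    H.FlowsWithin (fun s => x (a + s)) ((fun s => a + s) ⁻¹' T) t := by
  have hmt : MapsTo (fun s => a + s) ((fun s => a + s) ⁻¹' T) T := fun s hs => hs
  refine flowsWithin_of_hasDerivWithinAt (q := x (a + t)) ?_ (self_mem_dom _) ?_
  · exact ContinuousWithinAt.comp (f := fun s => a + s) (h.continuousWithinAt ht)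
      (by fun_prop) hmt
  · have h1 := h.hasDerivWithinAt ht (self_mem_dom (x (a + t)))
    have h2 : HasDerivWithinAt (fun s : ℝ => a + s) 1 ((fun s => a + s) ⁻¹' T) t :=
      ((hasDerivAt_id t).const_add a).hasDerivWithinAt
    have h3 := HasDerivWithinAt.scomp t h1 h2 hmt
    rwa [one_smul] at h3

/-- A curve that is tangent to the field on `(a, b)` and right-continuous at `a` is tangent to the
field at `a`. -/
theorem flowsWithin_left_end (hab : a < b) (hx : ∀ s ∈ Ioo a b, H.FlowsWithin x (Ioo a b) s)
    (hc : ContinuousWithinAt x (Ici a) a) : H.FlowsWithin x (Ici a) a := by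
  have hq := self_mem_dom (d := d) (x a)
  have hev : ∀ᶠ s in 𝓝[>] a, x s ∈ dom d (x a) :=
    (hc.mono Ioi_subset_Ici_self).preimage_mem_nhdsWithin ((isOpen_dom _).mem_nhds hq)
  obtain ⟨e, he, hsub⟩ := mem_nhdsGT_iff_exists_Ioo_subset.1
    (inter_mem hev (Ioo_mem_nhdsGT hab))
  have hder : ∀ s ∈ Ioo a e, HasDerivAt (fun s => coord d (x a) (x s))
      (H.vec (x a) (coord d (x a) (x s))) s := fun s hs =>
    ((hx s (hsub hs).2).hasDerivWithinAt (hsub hs).2 (hsub hs).1).hasDerivAt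
      (Ioo_mem_nhds (hsub hs).2.1 (hsub hs).2.2)
  refine flowsWithin_of_hasDerivWithinAt (q := x a) hc hq ?_
  -- The one-sided derivative at the end point is the limit of the derivatives inside, and this
  -- limit is the field at `x a` by continuity of the curve and of the field.
  refine hasDerivWithinAt_Ici_of_tendsto_deriv (s := Ioo a e)
    (fun s hs => (hder s hs).differentiableAt.differentiableWithinAt) ?_
    (Ioo_mem_nhdsGT he) ?_
  · exact ((continuousAt_coord hq).comp_continuousWithinAt hc).mono
      (Ioo_subset_Ico_self.trans Ico_subset_Ici_self)
  · refine Tendsto.congr' ?_ ((continuousWithinAt_vec_coord H hc hq).mono Ioi_subset_Ici_self)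
    filter_upwards [Ioo_mem_nhdsGT he] with s hs
    exact (hder s hs).deriv.symm

/-- A curve that is tangent to the field on `(a, b)` and left-continuous at `b` is tangent to the
field at `b`. -/
theorem flowsWithin_right_end (hab : a < b) (hx : ∀ s ∈ Ioo a b, H.FlowsWithin x (Ioo a b) s)
    (hc : ContinuousWithinAt x (Iic b) b) : H.FlowsWithin x (Iic b) b := by
  have hq := self_mem_dom (d := d) (x b)
  have hev : ∀ᶠ s in 𝓝[<] b, x s ∈ dom d (x b) :=
    (hc.mono Iio_subset_Iic_self).preimage_mem_nhdsWithin ((isOpen_dom _).mem_nhds hq)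
  obtain ⟨e, he, hsub⟩ := mem_nhdsLT_iff_exists_Ioo_subset.1
    (inter_mem hev (Ioo_mem_nhdsLT hab))
  have hder : ∀ s ∈ Ioo e b, HasDerivAt (fun s => coord d (x b) (x s))
      (H.vec (x b) (coord d (x b) (x s))) s := fun s hs =>
    ((hx s (hsub hs).2).hasDerivWithinAt (hsub hs).2 (hsub hs).1).hasDerivAt
      (Ioo_mem_nhds (hsub hs).2.1 (hsub hs).2.2)
  refine flowsWithin_of_hasDerivWithinAt (q := x b) hc hq ?_
  refine hasDerivWithinAt_Iic_of_tendsto_deriv (s := Ioo e b)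
    (fun s hs => (hder s hs).differentiableAt.differentiableWithinAt) ?_
    (Ioo_mem_nhdsLT he) ?_
  · exact ((continuousAt_coord hq).comp_continuousWithinAt hc).mono
      (Ioo_subset_Ioc_self.trans Ioc_subset_Iic_self)
  · refine Tendsto.congr' ?_ ((continuousWithinAt_vec_coord H hc hq).mono Iio_subset_Iic_self)
    filter_upwards [Ioo_mem_nhdsLT he] with s hs
    exact (hder s hs).deriv.symm

/-! ### Executions -/

theorem IsExecution.flowsWithin (h : H.IsExecution T x) (ht : t ∈ T)
    (hc : ContinuousWithinAt x T t) : H.FlowsWithin x T t :=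
  h.flow t ht hc

/-- Left- and right-continuity, within an interval. -/
theorem IsExecution.continuousWithinAt_of_Iic (h : H.IsExecution T x) (ht : t ∈ T)
    (hc : ContinuousWithinAt x (T ∩ Iic t) t) : ContinuousWithinAt x T t := by
  have := hc.union (h.rightCont t ht)
  rwa [← inter_union_distrib_left, Iic_union_Ici, inter_univ] at this

/-- At a new left end point `a` a jump of the original execution becomes invisible, and the original
axioms then say nothing about the velocity there; this is what `ha` supplies. At later times
continuity on the left, with right-continuity, is continuity in the larger interval. -/
theorem IsExecution.restrict (h : H.IsExecution T x) (hab : Icc a b ⊆ T)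
    (ha : H.FlowsWithin x (Icc a b) a) : H.IsExecution (Icc a b) x := by
  have hfull : ∀ t ∈ Icc a b, t ≠ a → ContinuousWithinAt x (Icc a b) t →
      ContinuousWithinAt x T t := by
    intro t ht hta hc
    refine h.continuousWithinAt_of_Iic (hab ht) ?_
    have hlt : a < t := lt_of_le_of_ne ht.1 (Ne.symm hta)
    have : Icc a b ∈ 𝓝[T ∩ Iic t] t := by
      have h1 : Ioi a ∈ 𝓝[T ∩ Iic t] t := mem_nhdsWithin_of_mem_nhds (Ioi_mem_nhds hlt)
      filter_upwards [h1, self_mem_nhdsWithin] with s hs hs'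
      exact ⟨le_of_lt hs, hs'.2.trans ht.2⟩
    exact hc.mono_of_mem_nhdsWithin this
  refine ⟨ordConnected_Icc, fun t ht => (h.rightCont t (hab ht)).mono
    (inter_subset_inter_left _ hab), ?_, ?_⟩
  · intro t ht hc
    by_cases hta : t = a
    · rw [hta]; exact ha
    · exact (h.flowsWithin (hab ht) (hfull t ht hta hc)).mono hab
  · intro t ht hc
    have hta : t ≠ a := by
      rintro rfl
      exact hc (ha.continuousWithinAt ht)
    obtain ⟨y, hy, hlim, hR⟩ := h.jump t (hab ht) fun hc' => hc (hc'.mono hab)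
    exact ⟨y, hy, hlim.mono_left (nhdsWithin_mono _ (inter_subset_inter_left _ hab)), hR⟩

theorem IsExecution.comp_add (h : H.IsExecution T x) (a : ℝ) :
    H.IsExecution ((fun s => a + s) ⁻¹' T) (fun s => x (a + s)) := by
  have hback : ∀ (A : Set ℝ) (t : ℝ),
      ContinuousWithinAt (fun s => x (a + s)) ((fun s => a + s) ⁻¹' A) t →
      ContinuousWithinAt x A (a + t) := by
    intro A t hc
    have h1 : ContinuousWithinAt (fun s : ℝ => s - a) A (a + t) := by fun_prop
    have h2 : MapsTo (fun s : ℝ => s - a) A ((fun s => a + s) ⁻¹' A) := fun s hs => by simpa using hs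
    have h3 := ContinuousWithinAt.comp (g := fun s => x (a + s)) (f := fun s : ℝ => s - a)
      (x := a + t) (by simpa using hc) h1 h2
    refine h3.congr (fun s _ => by simp) (by simp)
  have hforw : ∀ (A : Set ℝ) (t : ℝ), ContinuousWithinAt x A (a + t) →
      ContinuousWithinAt (fun s => x (a + s)) ((fun s => a + s) ⁻¹' A) t := fun A t hc =>
    ContinuousWithinAt.comp (f := fun s => a + s) hc (by fun_prop) fun s hs => hs
  refine ⟨?_, ?_, ?_, ?_⟩
  · refine ⟨fun u hu v hv w hw => ?_⟩
    exact h.ordConnected.out hu hv ⟨by linarith [hw.1], by linarith [hw.2]⟩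
  · intro t ht
    have h1 := hforw _ t (h.rightCont (a + t) ht)
    refine h1.mono fun s hs => ⟨hs.1, ?_⟩
    have := hs.2
    simp only [mem_Ici] at this ⊢
    linarith
  · exact fun t ht hc => (h.flowsWithin ht (hback T t hc)).comp_add ht
  · intro t ht hc
    obtain ⟨y, hy, hlim, hR⟩ := h.jump (a + t) ht fun hc' => hc (hforw T t hc')
    refine ⟨y, hy, hlim.comp ?_, hR⟩
    refine tendsto_nhdsWithin_of_tendsto_nhds_of_eventually_within _ ?_ ?_
    · exact (by fun_prop : Continuous fun s : ℝ => a + s).continuousAt.tendsto.mono_left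
        nhdsWithin_le_nhds
    · filter_upwards [self_mem_nhdsWithin] with s hs
      refine ⟨hs.1, ?_⟩
      have := hs.2
      simp only [mem_Iio] at this ⊢
      linarith

/-- A segment of an execution, reparametrized to start at time `0`. -/
theorem IsExecution.segment (h : H.IsExecution T x) (hab : Icc a b ⊆ T)
    (ha : H.FlowsWithin x (Icc a b) a) :
    H.IsExecution (Icc 0 (b - a)) (fun s => x (a + s)) := by
  have h1 := (h.restrict hab ha).comp_add a
  have h2 : (fun s => a + s) ⁻¹' Icc a b = Icc 0 (b - a) := by
    ext s; simp only [mem_preimage, mem_Icc]; constructor <;> rintro ⟨h, h'⟩ <;>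
      constructor <;> linarith
  rwa [h2] at h1

/-- The outward velocity on the guard. -/
theorem vel_neg (hout : H.OutwardOnGuard) (hz : z ∈ H.G) : H.vel z 0 < 0 := by
  have h := hout z.1 z.2 hz (chartAt _ z.2)
    (IsManifold.chart_mem_maximalAtlas z.2) (mem_chart_source _ _)
  -- The preferred chart at `z` has the identity as its derivative at `z`, so the outward condition
  -- for this chart is about `H.vel z` itself.
  have h1 := (hasMFDerivAt_extChartAt (I := 𝓡∂ (d z.1 + 1)) (x := z.2) (y := z.2)
    (mem_chart_source _ _)).mfderiv
  rw [mfderiv_chartAt_eq_tangentCoordChange (mem_chart_source _ _)] at h1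
  have h2 : tangentCoordChange (𝓡∂ (d z.1 + 1)) z.2 z.2 z.2 (H.vel z) = H.vel z :=
    tangentCoordChange_self (mem_extChartAt_source z.2)
  have h3 : (mfderiv (𝓡∂ (d z.1 + 1)) 𝓘(ℝ, EuclideanSpace ℝ (Fin (d z.1 + 1)))
      (extChartAt (𝓡∂ (d z.1 + 1)) z.2) z.2) (H.F z.1 z.2) = H.vel z := by
    rw [h1]; exact h2
  exact (congrArg (fun w : EuclideanSpace ℝ (Fin (d z.1 + 1)) => w 0) h3) ▸ h

theorem boundary_of_mem_guard (hz : z ∈ H.G) (hq : z ∈ dom d q) : coord d q z 0 = 0 := by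
  obtain ⟨O, hO, hG⟩ := H.isOpen_G
  rw [hG] at hz
  exact (mem_boundary_iff hq).1 hz.2

/-- A trajectory cannot start on the guard. -/
theorem FlowsWithin.notMem_guard (hout : H.OutwardOnGuard) (h : H.FlowsWithin x T t) (ht : t ∈ T)
    (hT : T ∈ 𝓝[>] t) : x t ∉ H.G := by
  intro hG
  have h1 := h.hasDerivWithinAt ht (self_mem_dom (x t))
  rw [vec_coord_self] at h1
  have h2 : HasDerivWithinAt (fun s => coord d (x t) (x s) 0) (H.vel (x t) 0) T t := by
    have := (EuclideanSpace.proj (𝕜 := ℝ) (0 : Fin (d (x t).1 + 1))).hasFDerivAt.comp_hasDerivWithinAt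
      t h1
    exact this
  have h3 : HasDerivWithinAt (fun s => coord d (x t) (x s) 0) (H.vel (x t) 0) (Ioi t) t :=
    h2.mono_of_mem_nhdsWithin hT
  have h4 := (hasDerivWithinAt_iff_tendsto_slope' (by simp)).1 h3
  -- The normal coordinate is `0` on the guard and nonnegative everywhere, so its forward difference
  -- quotients are nonnegative, against the outward velocity.
  refine (ge_of_tendsto h4 ?_).not_gt (vel_neg hout hG)
  filter_upwards [self_mem_nhdsWithin] with s hs
  rw [slope_def_field, boundary_of_mem_guard hG (self_mem_dom _), sub_zero]
  exact div_nonneg (coord_nonneg _ _) (sub_nonneg.2 (le_of_lt hs))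

end HybridSystem

end

noncomputable section

set_option linter.unusedSectionVars false

namespace HybridSystem

variable {J : Type*} {d : J → ℕ} {D : J → Type*}
  [∀ j, TopologicalSpace (D j)] [∀ j, ChartedSpace (EuclideanHalfSpace (d j + 1)) (D j)]
  [∀ j, IsManifold (𝓡∂ (d j + 1)) ∞ (D j)] [∀ j, T2Space (D j)]
  {H : HybridSystem d D} {x : ℝ → Σ j, D j} {T T' : Set ℝ} {t a b : ℝ} {q z : Σ j, D j}

/-! ### Executions near a point -/

theorem nhdsWithin_inter_Iio {a s : ℝ} (has : a < s) (hT : Ico a s ⊆ T) :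
    𝓝[T ∩ Iio s] s = 𝓝[<] s := by
  refine le_antisymm (nhdsWithin_mono _ inter_subset_right) ?_
  refine nhdsWithin_le_of_mem ?_
  filter_upwards [Ioo_mem_nhdsLT has] with u hu
  exact ⟨hT ⟨hu.1.le, hu.2⟩, hu.2⟩

theorem exists_isClosed_nhds (_ : HybridSystem d D) {N : Set (Σ j, D j)} (hN : N ∈ 𝓝 q) :
    ∃ N' ∈ 𝓝 q, IsClosed N' ∧ N' ⊆ N := by
  obtain ⟨r, hr, hrN⟩ := exists_box_subset (d := d) q hN
  have h := extChartAt_target_mem_nhdsWithin (I := 𝓡∂ (d q.1 + 1)) q.2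
  rw [← coord_self] at h
  obtain ⟨r', hr', h'⟩ := (nhdsWithin_hasBasis Metric.nhds_basis_closedBall _).mem_iff.1 h
  refine ⟨box d q (min r r'), box_mem_nhds q (lt_min hr hr'), isClosed_box q ?_,
    (box_mono q (min_le_left _ _)).trans hrN⟩
  refine Subset.trans ?_ h'
  exact fun u hu => ⟨Metric.closedBall_subset_closedBall (min_le_right _ _) hu.2, hu.1⟩

/-- Right after a state off the closure of the guard there are no jumps. -/
theorem IsExecution.exists_continuous_right (h : H.IsExecution T x) (htb : t < b)
    (hT : Ico t b ⊆ T) (hG : x t ∉ closure H.G) :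
    ∃ e ∈ Ioc t b, ∀ s ∈ Ioo t e, ContinuousWithinAt x T s := by
  obtain ⟨N, hN, hNc, hNG⟩ := H.exists_isClosed_nhds
    (isClosed_closure.isOpen_compl.mem_nhds hG)
  have h1 : ∀ᶠ s in 𝓝[>] t, x s ∈ N := by
    have h2 : ∀ᶠ s in 𝓝[T ∩ Ici t] t, x s ∈ N :=
      (h.rightCont t (hT ⟨le_rfl, htb⟩)).preimage_mem_nhdsWithin hN
    refine h2.filter_mono (nhdsWithin_le_of_mem ?_)
    filter_upwards [Ioo_mem_nhdsGT htb] with s hs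
    exact ⟨hT ⟨hs.1.le, hs.2⟩, hs.1.le⟩
  obtain ⟨e, he, hsub⟩ := mem_nhdsGT_iff_exists_Ioc_subset.1 h1
  refine ⟨min e b, ⟨lt_min he htb, min_le_right _ _⟩, fun s hs => ?_⟩
  have hse : s ≤ e := hs.2.le.trans (min_le_left _ _)
  have hsb : s < b := hs.2.trans_le (min_le_right _ _)
  by_contra hc
  obtain ⟨y, hy, hlim, -⟩ := h.jump s (hT ⟨hs.1.le, hsb⟩) hc
  rw [nhdsWithin_inter_Iio hs.1 ((Ico_subset_Ico_right hsb.le).trans hT)] at hlim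
  -- The exit point of a jump would be a left limit of states in the closed set `N`, which avoids
  -- the guard.
  refine hNG (hNc.mem_of_tendsto hlim ?_) (subset_closure hy)
  filter_upwards [Ioo_mem_nhdsLT hs.1] with u hu
  exact hsub ⟨hu.1, hu.2.le.trans hse⟩

/-- The execution may jump at `t` itself, where no velocity is prescribed; tangency from the right
is recovered as a limit from the jump-free interval after `t`. -/
theorem IsExecution.flowsWithin_right (h : H.IsExecution T x) (htb : t < b)
    (hT : Ico t b ⊆ T) (hG : x t ∉ closure H.G) : H.FlowsWithin x (Ici t) t := by
  obtain ⟨e, he, hcont⟩ := h.exists_continuous_right htb hT hG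
  refine flowsWithin_left_end (b := e) he.1 (fun s hs => ?_) ?_
  · refine (h.flowsWithin (hT ⟨hs.1.le, hs.2.trans_le he.2⟩) (hcont s hs)).mono fun u hu => ?_
    exact hT ⟨hu.1.le, hu.2.trans_le he.2⟩
  · refine (h.rightCont t (hT ⟨le_rfl, htb⟩)).mono_of_mem_nhdsWithin ?_
    filter_upwards [Ico_mem_nhdsGE htb] with s hs
    exact ⟨hT hs, hs.1⟩

theorem IsExecution.continuousWithinAt_zero {T : ℝ} (h : H.IsExecution (Icc 0 T) x) (hT : 0 ≤ T) :
    ContinuousWithinAt x (Icc 0 T) 0 := by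
  have := h.rightCont 0 ⟨le_rfl, hT⟩
  rwa [inter_eq_left.2 fun s hs => hs.1] at this

theorem IsExecution.restrict_zero {T T' : ℝ} (h : H.IsExecution (Icc 0 T) x) (h0 : 0 ≤ T')
    (hT : T' ≤ T) : H.IsExecution (Icc 0 T') x :=
  h.restrict (Icc_subset_Icc_right hT) ((h.flowsWithin ⟨le_rfl, h0.trans hT⟩
    (h.continuousWithinAt_zero (h0.trans hT))).mono (Icc_subset_Icc_right hT))

theorem FlowsWithin.Ici_of_Icc {T : ℝ} (h : H.FlowsWithin x (Icc 0 T) t) (ht : t ∈ Ico 0 T) :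
    H.FlowsWithin x (Ici t) t :=
  h.mono_of_mem (mem_of_superset (Icc_mem_nhdsGE_of_mem ⟨le_rfl, ht.2⟩) (Icc_subset_Icc_left ht.1))

/-- Either there are no jumps, or there is a first jump, or the execution continuously reaches the
closure of the guard before any jump. -/
theorem IsExecution.first_jump {T : ℝ} (h : H.IsExecution (Icc 0 T) x) (hT : 0 ≤ T) :
    ContinuousOn x (Icc 0 T) ∨
    (∃ t ∈ Ioc 0 T, ¬ ContinuousWithinAt x (Icc 0 T) t ∧
      ∀ s ∈ Ico 0 t, ContinuousWithinAt x (Icc 0 T) s) ∨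
    ∃ t ∈ Ico 0 T, (∀ s ∈ Icc 0 t, ContinuousWithinAt x (Icc 0 T) s) ∧ x t ∈ closure H.G := by
  -- If the infimum of the discontinuities is attained, it is the first jump. If not, jumps
  -- accumulate at it from the right, which by `IsExecution.exists_continuous_right` is possible
  -- only on the closure of the guard.
  set S := {t ∈ Icc 0 T | ¬ ContinuousWithinAt x (Icc 0 T) t} with hS
  rcases S.eq_empty_or_nonempty with hE | hE
  · left
    intro t ht
    by_contra hc
    exact (hE ▸ (⟨ht, hc⟩ : t ∈ S) : t ∈ (∅ : Set ℝ))
  · right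
    have hbdd : BddBelow S := ⟨0, fun t ht => ht.1.1⟩
    have hlt : ∀ s ∈ Ico 0 (sInf S), ContinuousWithinAt x (Icc 0 T) s := by
      intro s hs
      by_contra hc
      obtain ⟨u, hu⟩ := hE
      exact (csInf_le hbdd ⟨⟨hs.1, hs.2.le.trans ((csInf_le hbdd hu).trans hu.1.2)⟩, hc⟩).not_gt hs.2
    have h0 : 0 ≤ sInf S := le_csInf hE fun t ht => ht.1.1
    by_cases hm : sInf S ∈ S
    · left
      refine ⟨sInf S, ⟨lt_of_le_of_ne h0 ?_, hm.1.2⟩, hm.2, hlt⟩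
      intro h00
      exact hm.2 (h00 ▸ h.continuousWithinAt_zero hT)
    · right
      obtain ⟨u, hu⟩ := hE
      have hmu : sInf S < u := lt_of_le_of_ne (csInf_le hbdd hu) fun he => hm (he ▸ hu)
      have hmT : sInf S < T := hmu.trans_le hu.1.2
      refine ⟨sInf S, ⟨h0, hmT⟩, ?_, ?_⟩
      · intro s hs
        rcases hs.2.eq_or_lt with hs' | hs'
        · rw [hs']
          by_contra hc
          exact hm ⟨⟨h0, hmT.le⟩, hc⟩
        · exact hlt s ⟨hs.1, hs'⟩
      · by_contra hG
        obtain ⟨e, he, hcont⟩ := h.exists_continuous_right hmT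
          (fun s hs => ⟨h0.trans hs.1, hs.2.le⟩) hG
        obtain ⟨w, hw, hwe⟩ := exists_lt_of_csInf_lt ⟨u, hu⟩ he.1
        refine hw.2 (hcont w ⟨lt_of_le_of_ne (csInf_le hbdd hw) fun he => hm (he ▸ hw), hwe⟩)

/-- A coordinate box in which the vector field is tame, with a time `η` that is too short for a
trajectory to leave it from the box of half the size. -/
structure IsFlowBox (H : HybridSystem d D) (q : Σ j, D j)
    (A : EuclideanSpace ℝ (Fin (d q.1 + 1)) →
      EuclideanSpace ℝ (Fin (d q.1 + 1)) →L[ℝ] EuclideanSpace ℝ (Fin (d q.1 + 1)))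
    (C r η : ℝ) : Prop where
  r_pos : 0 < r
  η_pos : 0 < η
  tame : IsTameField (H.vec q) A (modelBall (𝓡∂ (d q.1 + 1)) (coord d q q) r) C
  target : modelBall (𝓡∂ (d q.1 + 1)) (coord d q q) r ⊆ (extChartAt (𝓡∂ (d q.1 + 1)) q.2).target
  small : C * η < r / 2
  small' : 2 * C * η ≤ 1
  η_le : η ≤ 1

theorem IsFlowBox.mono_time {A : EuclideanSpace ℝ (Fin (d q.1 + 1)) →
      EuclideanSpace ℝ (Fin (d q.1 + 1)) →L[ℝ] EuclideanSpace ℝ (Fin (d q.1 + 1))}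
    {C r η η' : ℝ} (hb : H.IsFlowBox q A C r η) (h0 : 0 < η') (h : η' ≤ η) :
    H.IsFlowBox q A C r η' := by
  have hC := hb.tame.pos
  exact ⟨hb.r_pos, h0, hb.tame, hb.target,
    (mul_le_mul_of_nonneg_left h hC.le).trans_lt hb.small,
    (mul_le_mul_of_nonneg_left h (by positivity)).trans hb.small', h.trans hb.η_le⟩

theorem exists_isFlowBox (H : HybridSystem d D) {N : Set (Σ j, D j)} (hN : N ∈ 𝓝 q) :
    ∃ A C r η, H.IsFlowBox q A C r η ∧ box d q r ⊆ N := by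
  obtain ⟨A, C, r, hr, htame, htarget⟩ := H.exists_isTameField_vec q
  obtain ⟨r', hr', hrN⟩ := exists_box_subset (d := d) q hN
  have hC := htame.pos
  have hmin : 0 < min r r' := lt_min hr hr'
  have hsub : modelBall (𝓡∂ (d q.1 + 1)) (coord d q q) (min r r') ⊆
      modelBall (𝓡∂ (d q.1 + 1)) (coord d q q) r :=
    inter_subset_inter_right _ (Metric.closedBall_subset_closedBall (min_le_left _ _))
  set η := min 1 (min (min r r' / (4 * C)) (1 / (2 * C))) with hη
  have hη0 : 0 < η := lt_min one_pos (lt_min (by positivity) (by positivity))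
  have h1 : η ≤ min r r' / (4 * C) := (min_le_right _ _).trans (min_le_left _ _)
  have h2 : η ≤ 1 / (2 * C) := (min_le_right _ _).trans (min_le_right _ _)
  refine ⟨A, C, min r r', η, ⟨hmin, hη0, htame.mono hsub, hsub.trans htarget, ?_, ?_,
    min_le_left _ _⟩, (box_mono q (min_le_right _ _)).trans hrN⟩
  · rw [le_div_iff₀ (by positivity)] at h1
    nlinarith
  · rw [le_div_iff₀ (by positivity)] at h2
    linarith

variable {A : EuclideanSpace ℝ (Fin (d q.1 + 1)) →
    EuclideanSpace ℝ (Fin (d q.1 + 1)) →L[ℝ] EuclideanSpace ℝ (Fin (d q.1 + 1))} {C r η : ℝ}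

theorem IsFlowBox.isClosed (hb : H.IsFlowBox q A C r η) : IsClosed (box d q r) :=
  isClosed_box q hb.target

/-- A continuous curve tangent to the field, started in the half box, stays in the box. -/
theorem IsFlowBox.stay (hb : H.IsFlowBox q A C r η) (h0 : 0 ≤ t) (ht : t ≤ η)
    (hc : ContinuousOn x (Icc 0 t)) (hx : ∀ s ∈ Ico 0 t, H.FlowsWithin x (Ici s) s)
    (hx0 : x 0 ∈ box d q (r / 2)) :
    (∀ s ∈ Icc 0 t, x s ∈ box d q r) ∧
      IsTrajectory (H.vec q) (modelBall (𝓡∂ (d q.1 + 1)) (coord d q q) r) t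
        (fun s => coord d q (x s)) := by
  have hr := hb.r_pos
  have hC := hb.tame.pos
  set y := fun s => coord d q (x s) with hy
  have hyc : ∀ s ∈ Icc 0 t, x s ∈ box d q r → ContinuousWithinAt y (Icc 0 t) s := fun s hs hsb =>
    (continuousAt_coord hsb.1).comp_continuousWithinAt (hc s hs)
  have hyd : ∀ s ∈ Ico 0 t, x s ∈ box d q r → HasDerivWithinAt y (H.vec q (y s)) (Ici s) s :=
    fun s hs hsb => (hx s hs).hasDerivWithinAt self_mem_Ici hsb.1
  set S₁ := {s ∈ Icc 0 t | x s ∈ box d q r} with hS₁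
  have hS₁c : IsClosed S₁ := hc.preimage_isClosed_of_isClosed isClosed_Icc hb.isClosed
  set S := {s ∈ S₁ | ‖y s - y 0‖ ≤ C * s} with hS
  have hSc : IsClosed S := by
    refine hS₁c.isClosed_le (f := fun s => ‖y s - y 0‖) (g := fun s => C * s) ?_ (by fun_prop)
    refine ContinuousOn.norm (ContinuousOn.sub (fun s hs => ?_) continuousOn_const)
    exact (hyc s hs.1 hs.2).mono (sep_subset _ _)
  -- Continuous induction: as long as the curve has moved at most `C * s`, the bound `hb.small`
  -- leaves it strictly inside the box, so it stays there a little longer and the speed bound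
  -- propagates.
  have hsub : Icc 0 t ⊆ S := by
    refine IsClosed.Icc_subset_of_forall_exists_gt (hSc.inter isClosed_Icc) ?_ ?_
    · exact ⟨⟨⟨le_rfl, h0⟩, box_mono q (by linarith) hx0⟩, by simp⟩
    · rintro s ⟨⟨⟨hst, hsb⟩, hsn⟩, hs⟩ w hw
      have hlt : ‖y s - coord d q q‖ < r := by
        have e : y s - coord d q q = (y s - y 0) + (y 0 - coord d q q) := by abel
        rw [e]
        refine (norm_add_le _ _).trans_lt ?_
        have h1 : C * s ≤ C * η := mul_le_mul_of_nonneg_left (hs.2.le.trans ht) hC.le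
        have h2 := hx0.2
        have h3 := hb.small
        linarith
      have hcs : ContinuousWithinAt x (Ici s) s := (hx s hs).continuousWithinAt self_mem_Ici
      have hev : ∀ᶠ u in 𝓝[≥] s, x u ∈ box d q r := by
        have h1 := ((continuousAt_coord hsb.1).comp_continuousWithinAt hcs).sub
          (continuousWithinAt_const (b := coord d q q))
        filter_upwards [hcs.preimage_mem_nhdsWithin ((isOpen_dom q).mem_nhds hsb.1),
          h1.norm.eventually (gt_mem_nhds hlt)] with u hu hu'
        exact ⟨hu, hu'.le⟩
      have hsw : s < min w t := lt_min hw hs.2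
      obtain ⟨e₀, he₀, hes₀⟩ := (mem_nhdsGE_iff_exists_Ico_subset' hsw).1
        (inter_mem hev (Icc_mem_nhdsGE hsw))
      obtain ⟨e, hse, hee₀⟩ := exists_between (mem_Ioi.1 he₀)
      have hes := (Icc_subset_Ico_right hee₀).trans hes₀
      have heIcc : e ≤ min w t := (hes ⟨hse.le, le_rfl⟩).2.2
      have het : e ≤ t := heIcc.trans (min_le_right _ _)
      refine ⟨e, ⟨⟨⟨hs.1.trans hse.le, het⟩, (hes ⟨hse.le, le_rfl⟩).1⟩, ?_⟩, hse,
        heIcc.trans (min_le_left _ _)⟩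
      have h1 : ‖y e - y s‖ ≤ C * (e - s) := by
        refine norm_image_sub_le_of_norm_deriv_right_le_segment (f' := fun u => H.vec q (y u))
          (fun u hu => ?_) (fun u hu => ?_) (fun u hu => ?_) e ⟨hse.le, le_rfl⟩
        · exact (hyc u ⟨hs.1.trans hu.1, hu.2.trans het⟩ (hes hu).1).mono
            (Icc_subset_Icc hs.1 het)
        · exact hyd u ⟨hs.1.trans hu.1, hu.2.trans_le het⟩ (hes ⟨hu.1, hu.2.le⟩).1
        · exact hb.tame.norm_le _ (coord_mem_modelBall (hes ⟨hu.1, hu.2.le⟩).1)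
      have e1 : y e - y 0 = (y e - y s) + (y s - y 0) := by abel
      rw [e1]
      refine (norm_add_le _ _).trans ?_
      linarith
  refine ⟨fun s hs => (hsub hs).1.2, h0, fun s hs => hyc s hs (hsub hs).1.2, fun s hs => ?_,
    fun s hs => coord_mem_modelBall (hsub hs).1.2⟩
  exact hyd s hs (hsub ⟨hs.1, hs.2.le⟩).1.2

/-- The part of an execution before a jump, closed up by the exit point. -/
theorem IsExecution.update_left {T : ℝ} (h : H.IsExecution (Icc 0 T) x) (ht : t ∈ Ioc 0 T)
    (hcont : ∀ s ∈ Ico 0 t, ContinuousWithinAt x (Icc 0 T) s) (hz : Tendsto x (𝓝[<] t) (𝓝 z)) :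
    H.IsExecution (Icc 0 t) (Function.update x t z) ∧
      ContinuousOn (Function.update x t z) (Icc 0 t) ∧
      ∀ s ∈ Ico 0 t, H.FlowsWithin (Function.update x t z) (Ici s) s := by
  set x' := Function.update x t z with hx'
  have hx't : x' t = z := Function.update_self _ _ _
  have hlt : ∀ s < t, x' s = x s := fun s hs => Function.update_of_ne hs.ne _ _
  have hev : ∀ s < t, ∀ᶠ u in 𝓝 s, x' u = x u := fun s hs => by
    filter_upwards [Iio_mem_nhds hs] with u hu
    exact hlt u hu
  have hflow : ∀ s ∈ Ico 0 t, H.FlowsWithin x' (Icc 0 T) s := fun s hs =>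
    (h.flowsWithin ⟨hs.1, hs.2.le.trans ht.2⟩ (hcont s hs)).congr
      (nhdsWithin_le_nhds (hev s hs.2))
  have hct : ContinuousWithinAt x' (Iic t) t := by
    rw [← Iio_insert, continuousWithinAt_insert_self, ContinuousWithinAt, hx't]
    refine hz.congr' ?_
    filter_upwards [self_mem_nhdsWithin] with s hs
    exact (hlt s hs).symm
  have hc : ContinuousOn x' (Icc 0 t) := by
    intro s hs
    rcases hs.2.eq_or_lt with rfl | hst
    · exact hct.mono fun u hu => hu.2
    · exact ((hflow s ⟨hs.1, hst⟩).continuousWithinAt ⟨hs.1, hs.2.trans ht.2⟩).mono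
        (Icc_subset_Icc_right ht.2)
  refine ⟨⟨ordConnected_Icc, fun s hs => (hc s hs).mono inter_subset_left, ?_, ?_⟩, hc, ?_⟩
  · intro s hs _
    rcases hs.2.eq_or_lt with rfl | hst
    -- At the added exit point `x` itself prescribes no velocity; tangency there is the limit from
    -- the left.
    · refine (flowsWithin_right_end ht.1 (fun u hu => ?_) hct).mono fun u hu => hu.2
      exact (hflow u ⟨hu.1.le, hu.2⟩).mono fun w hw => ⟨hw.1.le, hw.2.le.trans ht.2⟩
    · exact (hflow s ⟨hs.1, hst⟩).mono (Icc_subset_Icc_right ht.2)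
  · exact fun s hs hn => (hn (hc s hs)).elim
  · exact fun s hs => (hflow s hs).Ici_of_Icc ⟨hs.1, hs.2.trans_le ht.2⟩

theorem IsExecution.jump_Icc {T : ℝ} (h : H.IsExecution (Icc 0 T) x) (ht : t ∈ Ioc 0 T)
    (hc : ¬ ContinuousWithinAt x (Icc 0 T) t) :
    ∃ y ∈ H.G, Tendsto x (𝓝[<] t) (𝓝 y) ∧ H.R y = x t := by
  obtain ⟨y, hy, hlim, hR⟩ := h.jump t ⟨ht.1.le, ht.2⟩ hc
  rw [nhdsWithin_inter_Iio (T := Icc 0 T) ht.1 fun s hs => ⟨hs.1, hs.2.le.trans ht.2⟩] at hlim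
  exact ⟨y, hy, hlim, hR⟩

/-- Executions started in the half of a flow box that avoids the closure of the guard do not jump
for a while. -/
theorem IsFlowBox.stay_of_disjoint (hb : H.IsFlowBox q A C r η)
    (hG : box d q r ⊆ (closure H.G)ᶜ) {T : ℝ} (h0 : 0 ≤ T) (hT : T ≤ η)
    (h : H.IsExecution (Icc 0 T) x) (hx0 : x 0 ∈ box d q (r / 2)) :
    ContinuousOn x (Icc 0 T) ∧ (∀ s ∈ Icc 0 T, x s ∈ box d q r) ∧
      IsTrajectory (H.vec q) (modelBall (𝓡∂ (d q.1 + 1)) (coord d q q) r) T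
        (fun s => coord d q (x s)) := by
  rcases h.first_jump h0 with hc | ⟨t, ht, hnc, hlt⟩ | ⟨t, ht, hlt, htG⟩
  · exact ⟨hc, hb.stay h0 hT hc (fun s hs => (h.flowsWithin ⟨hs.1, hs.2.le⟩
      (hc s ⟨hs.1, hs.2.le⟩)).Ici_of_Icc hs) hx0⟩
  -- Closed up by its exit point, the part before the jump is a continuous curve to which
  -- `IsFlowBox.stay` applies. The exit point would thus lie in the box, off the guard.
  · obtain ⟨y, hy, hlim, -⟩ := h.jump_Icc ht hnc
    obtain ⟨h1, h2, h3⟩ := h.update_left ht hlt hlim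
    have h4 := (hb.stay ht.1.le (ht.2.trans hT) h2 h3
      (by rwa [Function.update_of_ne ht.1.ne])).1 t ⟨ht.1.le, le_rfl⟩
    rw [Function.update_self] at h4
    exact (hG h4 (subset_closure hy)).elim
  · have h4 := (hb.stay ht.1 (ht.2.le.trans hT)
      (fun s hs => (hlt s hs).mono (Icc_subset_Icc_right ht.2.le))
      (fun s hs => (h.flowsWithin ⟨hs.1, hs.2.le.trans ht.2.le⟩
        (hlt s ⟨hs.1, hs.2.le⟩)).Ici_of_Icc ⟨hs.1, hs.2.trans ht.2⟩) hx0).1 t ⟨ht.1, le_rfl⟩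
    exact (hG h4 htG).elim

/-- A flow box around a point of the guard, in which the field points out of the domain. -/
structure IsExitBox (H : HybridSystem d D) (q : Σ j, D j)
    (A : EuclideanSpace ℝ (Fin (d q.1 + 1)) →
      EuclideanSpace ℝ (Fin (d q.1 + 1)) →L[ℝ] EuclideanSpace ℝ (Fin (d q.1 + 1)))
    (C r η κ : ℝ) : Prop extends H.IsFlowBox q A C r η where
  κ_pos : 0 < κ
  outward : ∀ u ∈ modelBall (𝓡∂ (d q.1 + 1)) (coord d q q) r, H.vec q u 0 ≤ -κ
  guard : box d q r ∩ closure H.G ⊆ H.G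

/-- By continuity the normal velocity stays below half its negative value at `q`, which gives `κ`.
Near `q` the guard is all of the boundary, a closed set, so nearby points of its closure belong to
it. -/
theorem exists_isExitBox (hout : H.OutwardOnGuard) (hq : q ∈ H.G) {N : Set (Σ j, D j)}
    (hN : N ∈ 𝓝 q) : ∃ A C r η κ, H.IsExitBox q A C r η κ ∧ box d q r ⊆ N := by
  have hv := vel_neg hout hq
  obtain ⟨O, hO, hG⟩ := H.isOpen_G
  have hqO : q ∈ O := by rw [hG] at hq; exact hq.1
  have hcont : ContinuousWithinAt (fun u => H.vec q u 0) (range (𝓡∂ (d q.1 + 1))) (coord d q q) := by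
    have h1 := (H.contDiffWithinAt_vec q (coord_mem_target (self_mem_dom q))).continuousWithinAt
    exact (EuclideanSpace.proj (𝕜 := ℝ) (0 : Fin (d q.1 + 1))).continuous.continuousAt
      |>.comp_continuousWithinAt h1
  have hev : ∀ᶠ u in 𝓝[range (𝓡∂ (d q.1 + 1))] (coord d q q), H.vec q u 0 < H.vel q 0 / 2 := by
    refine hcont.eventually (gt_mem_nhds ?_)
    change H.vec q (coord d q q) 0 < _
    rw [vec_coord_self]
    linarith
  obtain ⟨ρ, hρ, hρ'⟩ := (nhdsWithin_hasBasis Metric.nhds_basis_closedBall _).eventually_iff.1 hev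
  obtain ⟨A, C, r, η, hb, hbN⟩ := H.exists_isFlowBox
    (inter_mem (inter_mem hN (hO.mem_nhds hqO)) (box_mem_nhds (d := d) q hρ))
  refine ⟨A, C, r, η, -(H.vel q 0 / 2), ⟨hb, by linarith, ?_, ?_⟩, fun m hm => (hbN hm).1.1⟩
  · intro u hu
    have h1 : pt d q u ∈ box d q r := by
      refine ⟨pt_mem_dom (hb.target hu), ?_⟩
      rw [coord_pt (hb.target hu)]
      simpa [dist_eq_norm] using hu.2
    have h2 := (hbN h1).2.2
    rw [coord_pt (hb.target hu)] at h2
    have := hρ' (x := u) ⟨by simpa [dist_eq_norm] using h2, hu.1⟩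
    linarith
  · rintro m ⟨hm, hmG⟩
    have hmO := (hbN hm).1.2
    rw [hG]
    refine ⟨hmO, ?_⟩
    have hcl : IsClosed {p : Σ j, D j | p.2 ∈ (𝓡∂ (d p.1 + 1)).boundary (D p.1)} := by
      rw [isClosed_sigma_iff]
      exact fun j => (𝓡∂ (d j + 1)).isClosed_boundary (M := D j) (n := ∞) (by simp)
    have hsub : H.G ⊆ {p : Σ j, D j | p.2 ∈ (𝓡∂ (d p.1 + 1)).boundary (D p.1)} := by
      rw [hG]; exact inter_subset_right
    exact closure_minimal hsub hcl hmG

variable {κ : ℝ}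

/-- The normal coordinate decreases along trajectories in an exit box. -/
theorem IsExitBox.normal_le (hb : H.IsExitBox q A C r η κ) {T : ℝ}
    {y : ℝ → EuclideanSpace ℝ (Fin (d q.1 + 1))}
    (hy : IsTrajectory (H.vec q) (modelBall (𝓡∂ (d q.1 + 1)) (coord d q q) r) T y)
    {s t : ℝ} (hs : 0 ≤ s) (hst : s ≤ t) (ht : t ≤ T) : y t 0 ≤ y s 0 - κ * (t - s) := by
  have hd : ∀ u ∈ Ico s t, HasDerivWithinAt (fun u => y u 0) (H.vec q (y u) 0) (Ici u) u := by
    intro u hu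
    exact (EuclideanSpace.proj (𝕜 := ℝ) (0 : Fin (d q.1 + 1))).hasFDerivAt.comp_hasDerivWithinAt u
      (hy.deriv u ⟨hs.trans hu.1, hu.2.trans_le ht⟩)
  have hc : ContinuousOn (fun u => y u 0) (Icc s t) :=
    (EuclideanSpace.proj (𝕜 := ℝ) (0 : Fin (d q.1 + 1))).continuous.comp_continuousOn
      (hy.cont.mono (Icc_subset_Icc hs ht))
  refine image_le_of_deriv_right_le_deriv_boundary (B := fun u => y s 0 - κ * (u - s))
    (B' := fun _ => -κ) hc hd (by simp) (by fun_prop) ?_ ?_ ⟨hst, le_rfl⟩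
  · intro u _
    have h1 := (((hasDerivAt_id u).sub_const s).const_mul κ).const_sub (y s 0)
    simpa using h1.hasDerivWithinAt
  · exact fun u hu => hb.outward _ (hy.mem u ⟨hs.trans hu.1, hu.2.le.trans ht⟩)

/-- Executions started near a point of the guard either last only for a short time, without any
jump, or soon reach the guard. -/
theorem IsExitBox.exit (hout : H.OutwardOnGuard) (hb : H.IsExitBox q A C r η κ) {T : ℝ} (h0 : 0 ≤ T)
    (h : H.IsExecution (Icc 0 T) x) (hx0 : x 0 ∈ box d q (r / 2))
    (hx0' : coord d q (x 0) 0 < κ * η) :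
    (T < η ∧ (∀ s ∈ Icc 0 T, x s ∈ box d q r) ∧
      IsTrajectory (H.vec q) (modelBall (𝓡∂ (d q.1 + 1)) (coord d q q) r) T
        (fun s => coord d q (x s))) ∨
    ∃ t ∈ Ioc 0 T, t < η ∧ ∃ z ∈ H.G, z ∈ box d q r ∧ H.R z = x t ∧
      H.IsExecution (Icc 0 t) (Function.update x t z) ∧
      IsTrajectory (H.vec q) (modelBall (𝓡∂ (d q.1 + 1)) (coord d q q) r) t
        (fun s => coord d q (Function.update x t z s)) := by
  have hκ := hb.κ_pos
  -- The normal coordinate starts below `κ * η`, decreases at rate at least `κ`, and cannot become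
  -- negative; this limits the time in the box.
  have short : ∀ t (y : ℝ → EuclideanSpace ℝ (Fin (d q.1 + 1))),
      IsTrajectory (H.vec q) (modelBall (𝓡∂ (d q.1 + 1)) (coord d q q) r) t y →
      y 0 = coord d q (x 0) → 0 ≤ y t 0 → t < η := by
    intro t y hy hy0 hyt
    have h1 := hb.normal_le hy le_rfl hy.nonneg le_rfl
    rw [hy0, sub_zero] at h1
    by_contra hcon
    have : κ * η ≤ κ * t := mul_le_mul_of_nonneg_left (not_lt.1 hcon) hκ.le
    linarith
  set T₁ := min T η with hT₁
  have hT₁0 : 0 ≤ T₁ := le_min h0 hb.η_pos.le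
  have hT₁T : T₁ ≤ T := min_le_left _ _
  have hT₁η : T₁ ≤ η := min_le_right _ _
  have h1 := h.restrict_zero hT₁0 hT₁T
  rcases h1.first_jump hT₁0 with hc | ⟨t, ht, hnc, hlt⟩ | ⟨t, ht, hlt, htG⟩
  · left
    have h2 := hb.stay hT₁0 hT₁η hc (fun s hs => (h1.flowsWithin ⟨hs.1, hs.2.le⟩
      (hc s ⟨hs.1, hs.2.le⟩)).Ici_of_Icc hs) hx0
    have h3 := short T₁ _ h2.2 rfl (coord_nonneg _ _)
    have h4 : T₁ = T := by
      rcases min_choice T η with h5 | h5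
      · exact h5
      · exact absurd (hT₁.trans h5) h3.ne
    rw [h4] at h2 h3
    exact ⟨h3, h2⟩
  · right
    obtain ⟨y, hy, hlim, hR⟩ := h1.jump_Icc ht hnc
    obtain ⟨h2, h3, h4⟩ := h1.update_left ht hlt hlim
    have h5 := hb.stay ht.1.le (ht.2.trans hT₁η) h3 h4 (by rwa [Function.update_of_ne ht.1.ne])
    have h6 := h5.1 t ⟨ht.1.le, le_rfl⟩
    rw [Function.update_self] at h6
    refine ⟨t, ⟨ht.1, ht.2.trans hT₁T⟩, ?_, y, hy, h6, hR, h2, h5.2⟩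
    exact short t _ h5.2 (by simp only [Function.update_of_ne ht.1.ne]) (coord_nonneg _ _)
  -- A continuous arrival at the closure of the guard inside the box is an arrival on the guard,
  -- from where no trajectory can continue.
  · have hfl : ∀ s ∈ Icc 0 t, H.FlowsWithin x (Ici s) s := fun s hs =>
      (h1.flowsWithin ⟨hs.1, hs.2.trans ht.2.le⟩ (hlt s hs)).Ici_of_Icc ⟨hs.1, hs.2.trans_lt ht.2⟩
    have h4 := (hb.stay ht.1 (ht.2.le.trans hT₁η)
      (fun s hs => (hlt s hs).mono (Icc_subset_Icc_right ht.2.le))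
      (fun s hs => hfl s ⟨hs.1, hs.2.le⟩) hx0).1 t ⟨ht.1, le_rfl⟩
    exact ((hfl t ⟨ht.1, le_rfl⟩).notMem_guard hout self_mem_Ici
      (mem_of_superset self_mem_nhdsWithin Ioi_subset_Ici_self) (hb.guard ⟨h4, htG⟩)).elim

end HybridSystem

end

noncomputable section

set_option linter.unusedSectionVars false

namespace HybridSystem

variable {J : Type*} {d : J → ℕ} {D : J → Type*}
  [∀ j, TopologicalSpace (D j)] [∀ j, ChartedSpace (EuclideanHalfSpace (d j + 1)) (D j)]
  [∀ j, IsManifold (𝓡∂ (d j + 1)) ∞ (D j)] [∀ j, T2Space (D j)]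
  {H : HybridSystem d D} {p q r : Σ j, D j} {T T' : ℝ}

/-! ### Linearized transport along executions -/

/-- Some execution leads from `p` to `q` in time `T`; it starts with a reset if `p` is on the
guard. -/
def Run (H : HybridSystem d D) (p q : Σ j, D j) (T : ℝ) : Prop :=
  0 ≤ T ∧ ∃ x : ℝ → Σ j, D j, H.IsExecution (Icc 0 T) x ∧
    ((p ∉ H.G ∧ x 0 = p) ∨ (p ∈ H.G ∧ x 0 = H.R p)) ∧ x T = q

theorem FirstHit.run {A : Set (Σ j, D j)} (h : H.FirstHit A p q T) : H.Run p q T := by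
  obtain ⟨x, hx, hstart, -, hq, -⟩ := h
  rcases hstart with ⟨hp, h0, hx0, -⟩ | ⟨hp, h0, hx0, -⟩
  · exact ⟨h0.le, x, hx, Or.inl ⟨hp, hx0⟩, hq⟩
  · exact ⟨h0, x, hx, Or.inr ⟨hp, hx0⟩, hq⟩

/-- The conditions on an execution over the set `S` of times, at the time `t`. -/
def ExecutionAt (H : HybridSystem d D) (S : Set ℝ) (x : ℝ → Σ j, D j) (t : ℝ) : Prop :=
  ContinuousWithinAt x (S ∩ Ici t) t ∧ (ContinuousWithinAt x S t → H.FlowsWithin x S t) ∧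
    (¬ ContinuousWithinAt x S t →
      ∃ y ∈ H.G, Tendsto x (𝓝[S ∩ Iio t] t) (𝓝 y) ∧ H.R y = x t)

theorem IsExecution.executionAt {S : Set ℝ} {x : ℝ → Σ j, D j} {t : ℝ} (h : H.IsExecution S x)
    (ht : t ∈ S) : H.ExecutionAt S x t :=
  ⟨h.rightCont t ht, h.flow t ht, h.jump t ht⟩

/-- The axioms of an execution are local in time, so gluing has to be checked only at the junction.
-/
theorem ExecutionAt.congr {S S' : Set ℝ} {x x' : ℝ → Σ j, D j} {t : ℝ}
    (h : H.ExecutionAt S x t) (hS : S =ᶠ[𝓝 t] S') (hx : x' =ᶠ[𝓝 t] x) :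
    H.ExecutionAt S' x' t := by
  have e : 𝓝[S'] t = 𝓝[S] t := (nhdsWithin_eq_iff_eventuallyEq.2 hS).symm
  have e1 : 𝓝[S' ∩ Ici t] t = 𝓝[S ∩ Ici t] t := by
    rw [nhdsWithin_inter', nhdsWithin_inter', e]
  have e2 : 𝓝[S' ∩ Iio t] t = 𝓝[S ∩ Iio t] t := by
    rw [nhdsWithin_inter', nhdsWithin_inter', e]
  have key : ∀ A : Set ℝ, Tendsto x' (𝓝[A] t) (𝓝 (x' t)) ↔ Tendsto x (𝓝[A] t) (𝓝 (x t)) := by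
    intro A
    rw [hx.self_of_nhds]
    exact tendsto_congr' (nhdsWithin_le_nhds hx)
  simp only [ExecutionAt, ContinuousWithinAt, key, e, e1, e2] at h ⊢
  refine ⟨h.1, fun hc => ?_, fun hc => ?_⟩
  · exact ((h.2.1 hc).mono_of_mem (by rw [e]; exact self_mem_nhdsWithin)).congr
      (nhdsWithin_le_nhds hx)
  · obtain ⟨y, hy, hlim, hR⟩ := h.2.2 hc
    exact ⟨y, hy, hlim.congr' (nhdsWithin_le_nhds hx.symm), by rw [hR, hx.self_of_nhds]⟩

theorem FlowsWithin.union {x : ℝ → Σ j, D j} {S S' : Set ℝ} {t : ℝ} (h : H.FlowsWithin x S t)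
    (h' : H.FlowsWithin x S' t) (ht : t ∈ S) (ht' : t ∈ S') : H.FlowsWithin x (S ∪ S') t :=
  flowsWithin_of_hasDerivWithinAt (q := x t)
    ((h.continuousWithinAt ht).union (h'.continuousWithinAt ht')) (self_mem_dom _)
    ((h.hasDerivWithinAt ht (self_mem_dom _)).union (h'.hasDerivWithinAt ht' (self_mem_dom _)))

/-- Gluing two executions, over `[0, a]` and `[a, c]`, that agree at `a`. -/
theorem IsExecution.glue {x y z : ℝ → Σ j, D j} {a c : ℝ} (hx : H.IsExecution (Icc 0 a) x)
    (hy : H.IsExecution (Icc a c) y) (h0 : 0 ≤ a) (hac : a ≤ c)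
    (hzx : EqOn z x (Iic a)) (hzy : EqOn z y (Ici a)) : H.IsExecution (Icc 0 c) z := by
  have key : ∀ t ∈ Icc 0 c, H.ExecutionAt (Icc 0 c) z t := by
    intro t ht
    rcases lt_trichotomy t a with hta | rfl | hta
    · refine (hx.executionAt ⟨ht.1, hta.le⟩).congr ?_ ?_
      · filter_upwards [Iio_mem_nhds hta] with s hs
        refine propext ⟨fun h => ⟨h.1, h.2.trans hac⟩, fun h => ⟨h.1, le_of_lt hs⟩⟩
      · filter_upwards [Iio_mem_nhds hta] with s hs
        exact hzx (mem_Iic.2 (mem_Iio.1 hs).le)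
    -- At the junction `y` is continuous from the right, so `z` is continuous there exactly when `x`
    -- is continuous from the left; otherwise `z` inherits the jump of `x`.
    · have hyc := hy.rightCont t ⟨le_rfl, hac⟩
      have eB : Icc t c ∩ Ici t = Icc t c := inter_eq_left.2 fun s hs => hs.1
      rw [eB] at hyc
      have hzB : EqOn z y (Icc t c) := fun s hs => hzy hs.1
      have hzA : EqOn z x (Icc 0 t) := fun s hs => hzx hs.2
      have htA : t ∈ Icc 0 t := ⟨h0, le_rfl⟩
      have htB : t ∈ Icc t c := ⟨le_rfl, hac⟩
      have hU : Icc 0 t ∪ Icc t c = Icc 0 c := Icc_union_Icc_eq_Icc h0 hac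
      refine ⟨?_, fun hc => ?_, fun hc => ?_⟩
      · have : Icc 0 c ∩ Ici t = Icc t c := by
          ext s; simp only [mem_inter_iff, mem_Icc, mem_Ici]
          exact ⟨fun h => ⟨h.2, h.1.2⟩, fun h => ⟨⟨h0.trans h.1, h.2⟩, h.1⟩⟩
        rw [this]
        exact hyc.congr hzB (hzB htB)
      · have hxc : ContinuousWithinAt x (Icc 0 t) t :=
          (hc.mono (Icc_subset_Icc_right hac)).congr hzA.symm (hzA htA).symm
        rw [← hU]
        refine FlowsWithin.union ?_ ?_ htA htB
        · exact (hx.flowsWithin htA hxc).congr (eventually_mem_nhdsWithin.mono fun s hs => hzA hs)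
        · exact (hy.flowsWithin htB hyc).congr (eventually_mem_nhdsWithin.mono fun s hs => hzB hs)
      · have hxc : ¬ ContinuousWithinAt x (Icc 0 t) t := fun hxc => hc <| by
          rw [← hU]
          exact (hxc.congr hzA (hzA htA)).union (hyc.congr hzB (hzB htB))
        obtain ⟨w, hw, hlim, hR⟩ := hx.jump t htA hxc
        have e : Icc 0 c ∩ Iio t = Icc 0 t ∩ Iio t := by
          ext s; simp only [mem_inter_iff, mem_Icc, mem_Iio]
          exact ⟨fun h => ⟨⟨h.1.1, h.2.le⟩, h.2⟩, fun h => ⟨⟨h.1.1, h.1.2.trans hac⟩, h.2⟩⟩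
        refine ⟨w, hw, ?_, by rw [hR, hzA htA]⟩
        rw [e]
        exact hlim.congr' (eventually_mem_nhdsWithin.mono fun s hs => (hzA hs.1).symm)
    · refine (hy.executionAt ⟨hta.le, ht.2⟩).congr ?_ ?_
      · filter_upwards [Ioi_mem_nhds hta] with s hs
        refine propext ⟨fun h => ⟨h0.trans h.1, h.2⟩, fun h => ⟨le_of_lt hs, h.2⟩⟩
      · filter_upwards [Ioi_mem_nhds hta] with s hs
        exact hzy (mem_Ici.2 (mem_Ioi.1 hs).le)
  exact ⟨ordConnected_Icc, fun t ht => (key t ht).1, fun t ht => (key t ht).2.1,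
    fun t ht => (key t ht).2.2⟩

/-- Off the guard the second motion starts at `q` without a reset, so the two curves agree at the
junction. -/
theorem Run.trans (h1 : H.Run p q T) (h2 : H.Run q r T') (hq : q ∉ H.G) :
    H.Run p r (T + T') := by
  obtain ⟨hT, x, hx, hstart, hxT⟩ := h1
  obtain ⟨hT', y, hy, ⟨-, hy0⟩ | ⟨hq', -⟩, hyT⟩ := h2
  swap
  · exact (hq hq').elim
  have hy' := hy.comp_add (-T)
  have e : (fun s => -T + s) ⁻¹' Icc 0 T' = Icc T (T + T') := by
    ext s; simp only [mem_preimage, mem_Icc]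
    constructor <;> rintro ⟨h, h'⟩ <;> constructor <;> linarith
  rw [e] at hy'
  have hz0 : ∀ s ≤ T, (if s < T then x s else y (-T + s)) = x s := by
    intro s hs
    rcases hs.eq_or_lt with rfl | hs
    · simp [hy0, hxT]
    · simp [hs]
  refine ⟨by linarith, _, hx.glue (z := fun s => if s < T then x s else y (-T + s)) hy' hT
    (by linarith) (fun s hs => hz0 s hs) fun s hs => if_neg (not_lt.2 hs), ?_, ?_⟩
  · simpa only [hz0 0 hT] using hstart
  · rw [if_neg (by linarith), ← hyT]
    congr 1
    ring

theorem abs_sub_le_add_mul {T T' T₀ T₁ C C₂ C' δ δ' : ℝ} (h1 : |T - T₀| ≤ C * δ)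
    (h2 : |T' - T₁| ≤ C₂ * δ') (hC₂ : 0 ≤ C₂) (h3 : δ' ≤ C' * δ) :
    |T + T' - (T₀ + T₁)| ≤ (C + C₂ * C') * δ := by
  have e : T + T' - (T₀ + T₁) = (T - T₀) + (T' - T₁) := by ring
  rw [e]
  refine (abs_add_le _ _).trans ?_
  have := mul_le_mul_of_nonneg_left h3 hC₂
  linarith

variable (d) in
/-- The deviation of `m` from `p`, in the preferred chart at `p`. -/
def dev (p m : Σ j, D j) : EuclideanSpace ℝ (Fin (d p.1 + 1)) := coord d p m - coord d p p

theorem tendsto_dev (p : Σ j, D j) : Tendsto (dev d p) (𝓝 p) (𝓝 0) := by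
  have h : ContinuousAt (coord d p) p := continuousAt_coord (self_mem_dom p)
  have h1 := Tendsto.sub_const h (coord d p p)
  rwa [sub_self] at h1

theorem eventually_norm_dev_lt (p : Σ j, D j) {ε : ℝ} (hε : 0 < ε) :
    ∀ᶠ m in 𝓝 p, ‖dev d p m‖ < ε := by
  have h := (tendsto_dev (d := d) p).norm
  rw [norm_zero] at h
  exact h.eventually (gt_mem_nhds hε)

theorem eventually_mul_norm_dev_lt (p : Σ j, D j) {C : ℝ} (hC : 0 ≤ C) {ε : ℝ} (hε : 0 < ε) :
    ∀ᶠ m in 𝓝 p, C * ‖dev d p m‖ < ε := by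
  filter_upwards [eventually_norm_dev_lt (d := d) p (show 0 < ε / (C + 1) by positivity)] with m hm
  rw [lt_div_iff₀ (by positivity)] at hm
  nlinarith [norm_nonneg (dev d p m)]

/-- Triples `(p', q', T)` near `(p, q, T₀)` that are related by `Q`. -/
def near (Q : (Σ j, D j) → (Σ j, D j) → ℝ → Prop) (p q : Σ j, D j) (T₀ : ℝ) :
    Filter ((Σ j, D j) × (Σ j, D j) × ℝ) :=
  (𝓝 p ×ˢ 𝓝 q ×ˢ 𝓝 T₀) ⊓ 𝓟 {w | Q w.1 w.2.1 w.2.2}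

theorem eventually_near {Q : (Σ j, D j) → (Σ j, D j) → ℝ → Prop} {T₀ : ℝ}
    {S : (Σ j, D j) → (Σ j, D j) → ℝ → Prop} :
    (∀ᶠ w in near Q p q T₀, S w.1 w.2.1 w.2.2) ↔ ∃ U ∈ 𝓝 p, ∃ W ∈ 𝓝 q, ∃ η > 0,
      ∀ p' ∈ U, ∀ q' ∈ W, ∀ T, |T - T₀| < η → Q p' q' T → S p' q' T := by
  rw [near, eventually_inf_principal, ((𝓝 p).basis_sets.prod
    ((𝓝 q).basis_sets.prod Metric.nhds_basis_ball)).eventually_iff]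
  constructor
  · rintro ⟨⟨U, W, η⟩, ⟨hU, hW, hη⟩, h⟩
    refine ⟨U, hU, W, hW, η, hη, fun p' hp' q' hq' T hT hQ => ?_⟩
    exact h (x := (p', q', T)) ⟨hp', hq', by simpa [Real.dist_eq] using hT⟩ hQ
  · rintro ⟨U, hU, W, hW, η, hη, h⟩
    refine ⟨⟨U, W, η⟩, ⟨hU, hW, hη⟩, ?_⟩
    rintro ⟨p', q', T⟩ ⟨hp', hq', hT⟩ hQ
    exact h p' hp' q' hq' T (by simpa [Real.dist_eq] using hT) hQ

/-- `Φ` is the first-order expansion at `p` of the end point, near `q`, of the motions `Q` of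
duration about `T₀`. -/
structure ExpandsOn (H : HybridSystem d D) (Q : (Σ j, D j) → (Σ j, D j) → ℝ → Prop)
    (p q : Σ j, D j) (T₀ : ℝ)
    (Φ : EuclideanSpace ℝ (Fin (d p.1 + 1)) →L[ℝ] EuclideanSpace ℝ (Fin (d q.1 + 1))) : Prop where
  vel : Φ (H.vel p) = H.vel q
  estimate : (fun w => dev d q w.2.1 - Φ (dev d p w.1) - (w.2.2 - T₀) • H.vel q)
    =o[near Q p q T₀] fun w => ‖dev d p w.1‖ + |w.2.2 - T₀|

theorem ExpandsOn.exists_nhds {Q : (Σ j, D j) → (Σ j, D j) → ℝ → Prop} {T₀ : ℝ}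
    {Φ : EuclideanSpace ℝ (Fin (d p.1 + 1)) →L[ℝ] EuclideanSpace ℝ (Fin (d q.1 + 1))}
    (h : H.ExpandsOn Q p q T₀ Φ) {ε : ℝ} (hε : 0 < ε) :
    ∃ U ∈ 𝓝 p, ∃ W ∈ 𝓝 q, ∃ η > 0, ∀ p' ∈ U, ∀ q' ∈ W, ∀ T, |T - T₀| < η →
      Q p' q' T → ‖dev d q q' - Φ (dev d p p') - (T - T₀) • H.vel q‖ ≤
      ε * (‖dev d p p'‖ + |T - T₀|) := by
  have h1 := h.estimate.def hε
  refine eventually_near.1 (h1.mono fun w hw => ?_)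
  rwa [Real.norm_of_nonneg (by positivity)] at hw

theorem ExpandsOn.of_exists_nhds {Q : (Σ j, D j) → (Σ j, D j) → ℝ → Prop} {T₀ : ℝ}
    {Φ : EuclideanSpace ℝ (Fin (d p.1 + 1)) →L[ℝ] EuclideanSpace ℝ (Fin (d q.1 + 1))}
    (hv : Φ (H.vel p) = H.vel q)
    (h : ∀ ε > 0, ∃ U ∈ 𝓝 p, ∃ W ∈ 𝓝 q, ∃ η > 0, ∀ p' ∈ U, ∀ q' ∈ W, ∀ T, |T - T₀| < η →
      Q p' q' T → ‖dev d q q' - Φ (dev d p p') - (T - T₀) • H.vel q‖ ≤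
      ε * (‖dev d p p'‖ + |T - T₀|)) : H.ExpandsOn Q p q T₀ Φ := by
  refine ⟨hv, Asymptotics.isLittleO_iff.2 fun ε hε => ?_⟩
  refine (eventually_near.2 (h ε hε)).mono fun w hw => ?_
  rw [Real.norm_of_nonneg (show 0 ≤ ‖dev d p w.1‖ + |w.2.2 - T₀| by positivity)]
  exact hw

/-- Longer executions from points near `p` pass by `q` after a time of about `T₀`. -/
def Tracks (H : HybridSystem d D) (p q : Σ j, D j) (T₀ : ℝ) : Prop :=
  ∃ C ≥ 0, ∀ V ∈ 𝓝 q, ∀ ε > 0, ∀ᶠ p' in 𝓝 p, ∀ r T, H.Run p' r T → T₀ + ε ≤ T →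
    ∃ q' ∈ V, ∃ T', |T' - T₀| ≤ C * ‖dev d p p'‖ ∧ H.Run p' q' T' ∧ H.Run q' r (T - T')

/-- Executions from points near `p` of duration almost `T₀` either end near `q` or have passed by
`q`. -/
def Sharp (H : HybridSystem d D) (p q : Σ j, D j) (T₀ : ℝ) : Prop :=
  ∃ C ≥ 0, ∀ V ∈ 𝓝 q, ∃ η > 0, ∀ᶠ p' in 𝓝 p, ∀ r T, H.Run p' r T → T₀ - η ≤ T → r ∉ V →
    ∃ q' ∈ V, ∃ T', |T' - T₀| ≤ C * ‖dev d p p'‖ ∧ H.Run p' q' T' ∧ H.Run q' r (T - T')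

variable {T₀ T₁ : ℝ}
  {Φ : EuclideanSpace ℝ (Fin (d p.1 + 1)) →L[ℝ] EuclideanSpace ℝ (Fin (d q.1 + 1))}
  {Ψ : EuclideanSpace ℝ (Fin (d q.1 + 1)) →L[ℝ] EuclideanSpace ℝ (Fin (d r.1 + 1))}

/-- When the time error is controlled by the initial deviation, so is the final deviation; this
feeds the output of one leg into the estimate for the next. -/
theorem ExpandsOn.norm_dev_le (h : H.ExpandsOn H.Run p q T₀ Φ) {C : ℝ} (hC : 0 ≤ C) :
    ∃ C' ≥ 0, ∃ U ∈ 𝓝 p, ∃ W ∈ 𝓝 q, ∀ p' ∈ U, ∀ q' ∈ W, ∀ T,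
      |T - T₀| ≤ C * ‖dev d p p'‖ → H.Run p' q' T → ‖dev d q q'‖ ≤ C' * ‖dev d p p'‖ := by
  obtain ⟨U, hU, W, hW, η, hη, hest⟩ := h.exists_nhds one_pos
  refine ⟨1 + C + ‖Φ‖ + C * ‖H.vel q‖, by positivity, _,
    inter_mem hU (eventually_mul_norm_dev_lt (d := d) p hC hη), W, hW, ?_⟩
  intro p' hp' q' hq' T hT hrun
  have h1 := hest p' hp'.1 q' hq' T (hT.trans_lt hp'.2) hrun
  have e : dev d q q' = (dev d q q' - Φ (dev d p p') - (T - T₀) • H.vel q) + Φ (dev d p p') +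
      (T - T₀) • H.vel q := by abel
  rw [e]
  refine (norm_add₃_le).trans ?_
  have h2 := Φ.le_opNorm (dev d p p')
  have h3 : ‖(T - T₀) • H.vel q‖ ≤ C * ‖dev d p p'‖ * ‖H.vel q‖ := by
    rw [norm_smul, Real.norm_eq_abs]
    exact mul_le_mul_of_nonneg_right hT (norm_nonneg _)
  linarith

/-- A motion of duration about `T₀ + T₁` has to be cut near `q`. If `T₁ > 0`, it outlasts `T₀` by a
margin. If `T₁ = 0`, its duration might fall short of `T₀`, but it ends near `r ≠ q`, hence away
from `q`, and sharpness says that it has passed by `q`. -/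
theorem Tracks.cut (h1 : H.Tracks p q T₀)
    (hc : 0 < T₁ ∨ (H.Sharp p q T₀ ∧ q ≠ r ∧ T₁ = 0)) :
    ∃ C ≥ 0, ∀ V ∈ 𝓝 q, ∃ U ∈ 𝓝 p, ∃ W ∈ 𝓝 r, ∃ η > 0, ∀ p' ∈ U, ∀ r' ∈ W, ∀ T,
      |T - (T₀ + T₁)| < η → H.Run p' r' T →
      ∃ q' ∈ V, ∃ T', |T' - T₀| ≤ C * ‖dev d p p'‖ ∧ H.Run p' q' T' ∧ H.Run q' r' (T - T') := by
  rcases hc with hT₁ | ⟨hs, hne, rfl⟩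
  · obtain ⟨C, hC, htr⟩ := h1
    refine ⟨C, hC, fun V hV => ⟨_, htr V hV (T₁ / 2) (half_pos hT₁), univ, univ_mem, T₁ / 2,
      half_pos hT₁, fun p' hp' r' _ T hT hrun => hp' r' T hrun ?_⟩⟩
    have := (abs_lt.1 hT).1
    linarith
  · obtain ⟨C, hC, htr⟩ := hs
    obtain ⟨V₀, W₀, hV₀, hW₀, hqV, hrW, hdisj⟩ := t2_separation hne
    refine ⟨C, hC, fun V hV => ?_⟩
    obtain ⟨η, hη, hU⟩ := htr (V ∩ V₀) (inter_mem hV (hV₀.mem_nhds hqV))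
    refine ⟨_, hU, W₀, hW₀.mem_nhds hrW, η, hη, fun p' hp' r' hr' T hT hrun => ?_⟩
    obtain ⟨q', hq', T', h⟩ := hp' r' T hrun (by have := (abs_lt.1 hT).1; linarith)
      fun hmem => (disjoint_left.1 hdisj hmem.2) hr'
    exact ⟨q', hq'.1, T', h⟩

/-- The chain rule for expansions of relations: cut each motion near `q`, at a time that varies with
the motion, and add the estimates of the two pieces. -/
theorem ExpandsOn.comp (h1 : H.ExpandsOn H.Run p q T₀ Φ) (ht : H.Tracks p q T₀)
    (h2 : H.ExpandsOn H.Run q r T₁ Ψ)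
    (hc : 0 < T₁ ∨ (H.Sharp p q T₀ ∧ q ≠ r ∧ T₁ = 0)) :
    H.ExpandsOn H.Run p r (T₀ + T₁) (Ψ.comp Φ) := by
  refine ExpandsOn.of_exists_nhds ?_ ?_
  · rw [ContinuousLinearMap.comp_apply, h1.vel, h2.vel]
  · intro ε hε
    obtain ⟨C, hC, hcut⟩ := ht.cut hc
    obtain ⟨C', hC', U₀, hU₀, W₀, hW₀, hdev⟩ := h1.norm_dev_le hC
    -- Each leg may use half of `ε`: the error of the first is magnified by `Ψ` and by its time
    -- error `C * δ`, that of the second by the size of the intermediate deviation and time error.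
    have hε₁ : 0 < ε / (2 * ((‖Ψ‖ + 1) * (1 + C))) := by positivity
    have hε₂ : 0 < ε / (2 * (C' + C + 1)) := by positivity
    set ε₁ := ε / (2 * ((‖Ψ‖ + 1) * (1 + C))) with hε₁'
    set ε₂ := ε / (2 * (C' + C + 1)) with hε₂'
    obtain ⟨U₁, hU₁, W₁, hW₁, η₁, hη₁, hest₁⟩ := h1.exists_nhds hε₁
    obtain ⟨U₂, hU₂, W₂, hW₂, η₂, hη₂, hest₂⟩ := h2.exists_nhds hε₂
    obtain ⟨U, hU, W, hW, η, hη, hUW⟩ := hcut (W₀ ∩ W₁ ∩ U₂)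
      (inter_mem (inter_mem hW₀ hW₁) hU₂)
    refine ⟨U ∩ U₀ ∩ U₁ ∩ {p' | C * ‖dev d p p'‖ < min η₁ (η₂ / 2)}, inter_mem (inter_mem
      (inter_mem hU hU₀) hU₁) (eventually_mul_norm_dev_lt (d := d) p hC (lt_min hη₁ (half_pos hη₂))),
      W ∩ W₂, inter_mem hW hW₂, min η (η₂ / 2), lt_min hη (half_pos hη₂), ?_⟩
    rintro p' ⟨⟨⟨hp, hp0⟩, hp1⟩, hpδ⟩ r' ⟨hr, hr2⟩ T hT hrun
    obtain ⟨q', ⟨⟨hq0, hq1⟩, hq2⟩, T', hT', hrun1, hrun2⟩ :=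
      hUW p' hp r' hr T (hT.trans_le (min_le_left _ _)) hrun
    simp only [mem_ofPred_eq] at hpδ
    set δ := ‖dev d p p'‖ with hδ
    have hδ0 : 0 ≤ δ := norm_nonneg _
    have hδ1 : C * δ < η₁ := hpδ.trans_le (min_le_left _ _)
    have hδ2 : C * δ < η₂ / 2 := hpδ.trans_le (min_le_right _ _)
    set σ := |T - (T₀ + T₁)| with hσ
    have hσ0 : 0 ≤ σ := abs_nonneg _
    have hσ2 : σ < η₂ / 2 := hT.trans_le (min_le_right _ _)
    have hs' : |T - T' - T₁| ≤ σ + C * δ := by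
      have : T - T' - T₁ = (T - (T₀ + T₁)) - (T' - T₀) := by ring
      rw [this]
      exact (abs_sub _ _).trans (add_le_add le_rfl hT')
    have e1 := hest₁ p' hp1 q' hq1 T' (hT'.trans_lt hδ1) hrun1
    have e2 := hest₂ q' hq2 r' hr2 (T - T') (by linarith) hrun2
    have e3 := hdev p' hp0 q' hq0 T' hT' hrun1
    -- The variable cutting time drops out to first order because `Ψ` maps the velocity at `q` to
    -- the velocity at `r`.
    have key : dev d r r' - (Ψ.comp Φ) (dev d p p') - (T - (T₀ + T₁)) • H.vel r =
        (dev d r r' - Ψ (dev d q q') - (T - T' - T₁) • H.vel r) +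
        Ψ (dev d q q' - Φ (dev d p p') - (T' - T₀) • H.vel q) := by
      simp only [map_sub, map_smul, h2.vel, ContinuousLinearMap.comp_apply]
      have : T - (T₀ + T₁) = (T - T' - T₁) + (T' - T₀) := by ring
      rw [this, add_smul]
      abel
    rw [key]
    refine (norm_add_le _ _).trans ?_
    have b1 : ‖dev d r r' - Ψ (dev d q q') - (T - T' - T₁) • H.vel r‖ ≤ ε / 2 * (δ + σ) := by
      refine e2.trans ?_
      calc ε₂ * (‖dev d q q'‖ + |T - T' - T₁|) ≤ ε₂ * (C' * δ + (σ + C * δ)) := by gcongr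
        _ ≤ ε₂ * ((C' + C + 1) * (δ + σ)) := by
          gcongr
          nlinarith [mul_nonneg hC' hσ0, mul_nonneg hC hσ0]
        _ = ε / 2 * (δ + σ) := by rw [hε₂']; field_simp
    have b2 : ‖Ψ (dev d q q' - Φ (dev d p p') - (T' - T₀) • H.vel q)‖ ≤ ε / 2 * (δ + σ) := by
      refine (Ψ.le_opNorm _).trans ?_
      calc ‖Ψ‖ * ‖dev d q q' - Φ (dev d p p') - (T' - T₀) • H.vel q‖
          ≤ (‖Ψ‖ + 1) * (ε₁ * (δ + C * δ)) := by
            refine mul_le_mul (by linarith) (e1.trans ?_) (norm_nonneg _) (by positivity)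
            gcongr
        _ = ε / 2 * δ := by rw [hε₁']; field_simp
        _ ≤ ε / 2 * (δ + σ) := by gcongr; linarith
    linarith

/-- The time errors add, the second being measured by the deviation at the first cut. Since `q` is
off the closure of the guard, the first cutting point is off the guard and the pieces can be
rejoined. -/
theorem Tracks.trans (h1 : H.ExpandsOn H.Run p q T₀ Φ) (ht : H.Tracks p q T₀)
    (h2 : H.Tracks q r T₁) (hT₁ : 0 ≤ T₁) (hq : q ∉ closure H.G) :
    H.Tracks p r (T₀ + T₁) := by
  obtain ⟨C, hC, htr⟩ := ht
  obtain ⟨C', hC', U₀, hU₀, W₀, hW₀, hdev⟩ := h1.norm_dev_le hC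
  obtain ⟨C₂, hC₂, htr₂⟩ := h2
  refine ⟨C + C₂ * C', by positivity, fun V hV ε hε => ?_⟩
  have hev := inter_mem (inter_mem hW₀ (htr₂ V hV (ε / 2) (half_pos hε)))
    (isClosed_closure.isOpen_compl.mem_nhds hq)
  filter_upwards [htr _ hev ε hε, hU₀, eventually_mul_norm_dev_lt (d := d) p hC (half_pos hε)]
    with p' hp' hp0 hpδ s T hrun hT
  obtain ⟨q', ⟨⟨hq0, hq'⟩, hqG⟩, T', hT', hrun1, hrun2⟩ := hp' s T hrun (by linarith)
  obtain ⟨r', hr', T'', hT'', hrun3, hrun4⟩ := hq' s (T - T') hrun2 (by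
    have := (abs_le.1 hT').2
    linarith)
  have e3 := hdev p' hp0 q' hq0 T' hT' hrun1
  refine ⟨r', hr', T' + T'', abs_sub_le_add_mul hT' hT'' hC₂ e3,
    hrun1.trans hrun3 fun h => hqG (subset_closure h), ?_⟩
  rwa [← sub_sub]

/-- Only the last leg has to be sharp: a positive `T₁` gives the margin that the first cut requires.
-/
theorem Sharp.trans (h1 : H.ExpandsOn H.Run p q T₀ Φ) (ht : H.Tracks p q T₀)
    (h2 : H.Sharp q r T₁) (hT₁ : 0 < T₁) (hq : q ∉ closure H.G) :
    H.Sharp p r (T₀ + T₁) := by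
  obtain ⟨C, hC, htr⟩ := ht
  obtain ⟨C', hC', U₀, hU₀, W₀, hW₀, hdev⟩ := h1.norm_dev_le hC
  obtain ⟨C₂, hC₂, htr₂⟩ := h2
  refine ⟨C + C₂ * C', by positivity, fun V hV => ?_⟩
  obtain ⟨η, hη, hη'⟩ := htr₂ V hV
  have hev := inter_mem (inter_mem hW₀ hη') (isClosed_closure.isOpen_compl.mem_nhds hq)
  refine ⟨min (T₁ / 2) (η / 2), lt_min (half_pos hT₁) (half_pos hη), ?_⟩
  filter_upwards [htr _ hev (T₁ / 2) (half_pos hT₁), hU₀,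
    eventually_mul_norm_dev_lt (d := d) p hC (half_pos hη)] with p' hp' hp0 hpδ s T hrun hT hsV
  have hm1 := min_le_left (T₁ / 2) (η / 2)
  have hm2 := min_le_right (T₁ / 2) (η / 2)
  obtain ⟨q', ⟨⟨hq0, hq'⟩, hqG⟩, T', hT', hrun1, hrun2⟩ := hp' s T hrun (by linarith)
  obtain ⟨r', hr', T'', hT'', hrun3, hrun4⟩ := hq' s (T - T') hrun2 (by
    have := (abs_le.1 hT').2
    linarith) hsV
  have e3 := hdev p' hp0 q' hq0 T' hT' hrun1
  refine ⟨r', hr', T' + T'', abs_sub_le_add_mul hT' hT'' hC₂ e3,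
    hrun1.trans hrun3 fun h => hqG (subset_closure h), ?_⟩
  rwa [← sub_sub]

/-- Executions from points near `p` of duration about `T₀` end near `q`, with first-order expansion
`Φ`, and longer ones pass by `q`. -/
structure Trans (H : HybridSystem d D) (p q : Σ j, D j) (T₀ : ℝ)
    (Φ : EuclideanSpace ℝ (Fin (d p.1 + 1)) →L[ℝ] EuclideanSpace ℝ (Fin (d q.1 + 1))) : Prop where
  expands : H.ExpandsOn H.Run p q T₀ Φ
  tracks : H.Tracks p q T₀

theorem Trans.comp (h1 : H.Trans p q T₀ Φ) (h2 : H.Trans q r T₁ Ψ) (hT₁ : 0 < T₁)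
    (hq : q ∉ closure H.G) : H.Trans p r (T₀ + T₁) (Ψ.comp Φ) :=
  ⟨h1.expands.comp h1.tracks h2.expands (Or.inl hT₁),
    h1.tracks.trans h1.expands h2.tracks hT₁.le hq⟩

end HybridSystem

end

noncomputable section

set_option linter.unusedSectionVars false

theorem isLittleO_extChartAt {E : Type*} [NormedAddCommGroup E] [NormedSpace ℝ E]
    {H : Type*} [TopologicalSpace H] {I : ModelWithCorners ℝ E H}
    {M : Type*} [TopologicalSpace M] [ChartedSpace H M] [IsManifold I ∞ M] {x y a : M}
    (hx : a ∈ (extChartAt I x).source) (hy : a ∈ (extChartAt I y).source) :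
    (fun m => extChartAt I y m - extChartAt I y a -
        tangentCoordChange I x y a (extChartAt I x m - extChartAt I x a))
      =o[𝓝 a] fun m => extChartAt I x m - extChartAt I x a := by
  have h1 := (hasFDerivWithinAt_tangentCoordChange (I := I) ⟨hx, hy⟩).isLittleO
  have h2 : Tendsto (extChartAt I x) (𝓝 a) (𝓝[range I] (extChartAt I x a)) :=
    tendsto_nhdsWithin_of_tendsto_nhds_of_eventually_within _ (continuousAt_extChartAt' hx)
      (Eventually.of_forall fun m => by simp [extChartAt])
  refine (h1.comp_tendsto h2).congr' ?_ EventuallyEq.rfl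
  filter_upwards [extChartAt_source_mem_nhds' hx] with m hm
  simp only [Function.comp_apply, (extChartAt I x).left_inv hm, (extChartAt I x).left_inv hx]

namespace HybridSystem

variable {J : Type*} {d : J → ℕ} {D : J → Type*}
  [∀ j, TopologicalSpace (D j)] [∀ j, ChartedSpace (EuclideanHalfSpace (d j + 1)) (D j)]
  [∀ j, IsManifold (𝓡∂ (d j + 1)) ∞ (D j)] [∀ j, T2Space (D j)]
  {H : HybridSystem d D} {p q r q₀ : Σ j, D j} {T T' T₀ T₁ : ℝ}

/-! ### First-order expansions from flow boxes -/

/-- Flow boxes use the chart at their centre, while deviations use the chart at the point itself.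
The derivatives of the chart transitions translate in both directions and match the velocities. -/
theorem exists_coordChange (H : HybridSystem d D) (hp : p ∈ dom d q) :
    ∃ (L : EuclideanSpace ℝ (Fin (d p.1 + 1)) →L[ℝ] EuclideanSpace ℝ (Fin (d q.1 + 1)))
      (L' : EuclideanSpace ℝ (Fin (d q.1 + 1)) →L[ℝ] EuclideanSpace ℝ (Fin (d p.1 + 1))),
      L (H.vel p) = H.vec q (coord d q p) ∧ L' (H.vec q (coord d q p)) = H.vel p ∧
      ((fun m => coord d q m - coord d q p - L (dev d p m)) =o[𝓝 p] dev d p) ∧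
      ((fun m => dev d p m - L' (coord d q m - coord d q p)) =o[𝓝 p]
        fun m => coord d q m - coord d q p) := by
  obtain ⟨j, x⟩ := p
  obtain ⟨l, y⟩ := q
  obtain rfl : j = l := fst_eq_of_mem_dom hp
  have hx : x ∈ (chartAt (EuclideanHalfSpace (d j + 1)) y).source :=
    mk_mem_dom (q := ⟨j, y⟩) |>.1 hp
  have hy' : x ∈ (extChartAt (𝓡∂ (d j + 1)) y).source := by rwa [extChartAt_source]
  have hx' := mem_extChartAt_source (I := 𝓡∂ (d j + 1)) x
  have h2 : ∀ y a : D j, coord d (⟨j, y⟩ : Σ j, D j) ⟨j, a⟩ = extChartAt (𝓡∂ (d j + 1)) y a :=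
    fun y a => coord_mk (⟨j, y⟩ : Σ j, D j) a
  have h3 : H.vec ⟨j, y⟩ (coord d ⟨j, y⟩ ⟨j, x⟩) =
      tangentCoordChange (𝓡∂ (d j + 1)) x y x (H.vel ⟨j, x⟩) := by
    rw [h2]; exact chartField_extChartAt (H.fld j) hx
  refine ⟨tangentCoordChange (𝓡∂ (d j + 1)) x y x, tangentCoordChange (𝓡∂ (d j + 1)) y x x,
    h3.symm, ?_, ?_, ?_⟩
  · rw [h3]
    rw [tangentCoordChange_comp ⟨⟨hx', hy'⟩, hx'⟩, tangentCoordChange_self hx']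
  · rw [Sigma.nhds_mk, Asymptotics.isLittleO_map]
    refine (isLittleO_extChartAt hx' hy').congr (fun m => ?_) fun m => ?_
    · simp only [Function.comp_apply, dev, h2]
    · simp only [Function.comp_apply, dev, h2]
  · rw [Sigma.nhds_mk, Asymptotics.isLittleO_map]
    refine (isLittleO_extChartAt hy' hx').congr (fun m => ?_) fun m => ?_
    · simp only [Function.comp_apply, dev, h2]
    · simp only [Function.comp_apply, h2]

variable {Q : (Σ j, D j) → (Σ j, D j) → ℝ → Prop}

theorem tendsto_near_fst : Tendsto (fun w => w.1) (near Q p q T₀) (𝓝 p) :=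
  tendsto_fst.mono_left inf_le_left

theorem tendsto_near_snd : Tendsto (fun w => w.2.1) (near Q p q T₀) (𝓝 q) :=
  (tendsto_fst.comp tendsto_snd).mono_left inf_le_left

theorem tendsto_near_time : Tendsto (fun w => w.2.2) (near Q p q T₀) (𝓝 T₀) :=
  (tendsto_snd.comp tendsto_snd).mono_left inf_le_left

theorem tendsto_near_size : Tendsto (fun w => ‖dev d p w.1‖ + |w.2.2 - T₀|) (near Q p q T₀)
    (𝓝 0) := by
  have h1 : Tendsto (fun w : (Σ j, D j) × (Σ j, D j) × ℝ => ‖dev d p w.1‖) (near Q p q T₀)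
      (𝓝 0) := by
    simpa using ((tendsto_dev (d := d) p).comp (tendsto_near_fst (Q := Q) (q := q) (T₀ := T₀))).norm
  have h2 : Tendsto (fun w : (Σ j, D j) × (Σ j, D j) × ℝ => |w.2.2 - T₀|) (near Q p q T₀)
      (𝓝 0) := by
    simpa using ((tendsto_near_time (Q := Q) (p := p) (q := q) (T₀ := T₀)).sub_const T₀).abs
  simpa using h1.add h2

theorem dev_isBigO_size : (fun w : (Σ j, D j) × (Σ j, D j) × ℝ => dev d p w.1) =O[near Q p q T₀]
    fun w => ‖dev d p w.1‖ + |w.2.2 - T₀| :=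
  Asymptotics.isBigO_of_le _ fun w => by
    rw [Real.norm_of_nonneg (by positivity)]
    linarith [abs_nonneg (w.2.2 - T₀)]

theorem time_isBigO_size : (fun w : (Σ j, D j) × (Σ j, D j) × ℝ => w.2.2 - T₀)
    =O[near Q p q T₀] fun w => ‖dev d p w.1‖ + |w.2.2 - T₀| :=
  Asymptotics.isBigO_of_le _ fun w => by
    rw [Real.norm_of_nonneg (show 0 ≤ ‖dev d p w.1‖ + |w.2.2 - T₀| by positivity),
      Real.norm_eq_abs]
    linarith [norm_nonneg (dev d p w.1)]

variable {A : EuclideanSpace ℝ (Fin (d q₀.1 + 1)) →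
    EuclideanSpace ℝ (Fin (d q₀.1 + 1)) →L[ℝ] EuclideanSpace ℝ (Fin (d q₀.1 + 1))} {C ρ η κ : ℝ}

/-- This transfers the expansion of trajectories in one chart to any relation `Q` whose nearby
instances are all traced by trajectories in the box. The quadratic error is of smaller order since
the deviation and time error tend to `0`. -/
theorem IsFlowBox.exists_expandsOn (hb : H.IsFlowBox q₀ A C ρ η)
    {c : ℝ → EuclideanSpace ℝ (Fin (d q₀.1 + 1))}
    (hc : IsTrajectory (H.vec q₀) (modelBall (𝓡∂ (d q₀.1 + 1)) (coord d q₀ q₀) ρ) T₀ c)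
    (hT₀ : T₀ ≤ η) (hp : p ∈ dom d q₀) (hq : q ∈ dom d q₀) (hc0 : c 0 = coord d q₀ p)
    (hcT : c T₀ = coord d q₀ q)
    (hQ : ∀ᶠ w in near Q p q T₀, w.2.2 ≤ 1 ∧ ∃ y, IsTrajectory (H.vec q₀)
      (modelBall (𝓡∂ (d q₀.1 + 1)) (coord d q₀ q₀) ρ) w.2.2 y ∧
      y 0 = coord d q₀ w.1 ∧ y w.2.2 = coord d q₀ w.2.1) :
    ∃ Φ, H.ExpandsOn Q p q T₀ Φ := by
  have hC := hb.tame.pos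
  obtain ⟨Φ, hΦ, B, hB, hest⟩ := hc.exists_expansion hb.tame (hT₀.trans hb.η_le)
    ((mul_le_mul_of_nonneg_left hT₀ (by positivity)).trans hb.small')
  obtain ⟨L, -, hL, -, hLo, -⟩ := H.exists_coordChange hp
  obtain ⟨-, M, -, hM, -, hMo⟩ := H.exists_coordChange hq
  rw [hc0, hcT] at hΦ hest
  refine ⟨(M.comp Φ).comp L, ?_, ?_⟩
  · simp only [ContinuousLinearMap.comp_apply, hL, hΦ, hM]
  set X : (Σ j, D j) × (Σ j, D j) × ℝ → ℝ := fun w => ‖dev d p w.1‖ + |w.2.2 - T₀| with hX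
  set l := near Q p q T₀ with hl
  set f := H.vec q₀ (coord d q₀ q) with hf
  set a : (Σ j, D j) × (Σ j, D j) × ℝ → EuclideanSpace ℝ (Fin (d q₀.1 + 1)) :=
    fun w => coord d q₀ w.1 - coord d q₀ p with ha
  set b : (Σ j, D j) × (Σ j, D j) × ℝ → EuclideanSpace ℝ (Fin (d q₀.1 + 1)) :=
    fun w => coord d q₀ w.2.1 - coord d q₀ q with hb'
  have hdX : (fun w : (Σ j, D j) × (Σ j, D j) × ℝ => dev d p w.1) =O[l] X := dev_isBigO_size
  have hσX : (fun w : (Σ j, D j) × (Σ j, D j) × ℝ => w.2.2 - T₀) =O[l] X := time_isBigO_size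
  have haL : (fun w => a w - L (dev d p w.1)) =o[l] X :=
    (hLo.comp_tendsto tendsto_near_fst).trans_isBigO hdX
  have haX : a =O[l] X := by
    have := haL.isBigO.add ((L.isBigO_comp _ l).trans hdX)
    simpa using this
  have hY : (fun w => ‖a w‖ + |w.2.2 - T₀|) =O[l] X := haX.norm_left.add hσX.abs_left
  have hR : (fun w => b w - Φ (a w) - (w.2.2 - T₀) • f) =o[l] X := by
    have h1 : (fun w => b w - Φ (a w) - (w.2.2 - T₀) • f) =O[l]
        fun w => (‖a w‖ + |w.2.2 - T₀|) ^ 2 := by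
      refine Asymptotics.IsBigO.of_bound B ?_
      filter_upwards [hQ] with w hw
      obtain ⟨hw1, y, hy, hy0, hyT⟩ := hw
      have := hest w.2.2 hw1 y hy
      rw [hy0, hyT] at this
      rwa [Real.norm_of_nonneg (by positivity)]
    refine (h1.trans (hY.pow 2)).trans_isLittleO ?_
    have h2 : X =o[l] fun _ => (1 : ℝ) :=
      (Asymptotics.isLittleO_one_iff ℝ).2 tendsto_near_size
    have := h2.mul_isBigO (Asymptotics.isBigO_refl X l)
    simpa [sq] using this
  have hbX : b =O[l] X := by
    have h0 : (fun w : (Σ j, D j) × (Σ j, D j) × ℝ => (w.2.2 - T₀) • f) =O[l] X := by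
      simpa using hσX.smul (Asymptotics.isBigO_const_const f (one_ne_zero (α := ℝ)) l)
    have h1 := (hR.isBigO.add ((Φ.isBigO_comp a l).trans haX)).add h0
    exact h1.congr_left fun w => by abel
  have h3 : (fun w => dev d q w.2.1 - M (b w)) =o[l] X :=
    (hMo.comp_tendsto tendsto_near_snd).trans_isBigO hbX
  have h4 := (h3.add ((M.isBigO_comp _ l).trans_isLittleO hR)).add
    (((M.comp Φ).isBigO_comp _ l).trans_isLittleO haL)
  refine h4.congr_left fun w => ?_
  simp only [map_sub, map_smul, hM, ContinuousLinearMap.comp_apply]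
  abel

end HybridSystem

end

noncomputable section

set_option linter.unusedSectionVars false

namespace HybridSystem

variable {J : Type*} {d : J → ℕ} {D : J → Type*}
  [∀ j, TopologicalSpace (D j)] [∀ j, ChartedSpace (EuclideanHalfSpace (d j + 1)) (D j)]
  [∀ j, IsManifold (𝓡∂ (d j + 1)) ∞ (D j)] [∀ j, T2Space (D j)]
  {H : HybridSystem d D} {p q r q₀ z : Σ j, D j} {t T T' T₀ T₁ : ℝ} {x : ℝ → Σ j, D j}

/-! ### Transport inside a box off the guard -/

/-- Some linearized transport exists. -/
def Transports (H : HybridSystem d D) (p q : Σ j, D j) (T₀ : ℝ) : Prop := ∃ Φ, H.Trans p q T₀ Φ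

theorem Transports.comp (h1 : H.Transports p q T₀) (h2 : H.Transports q r T₁) (hT₁ : 0 < T₁)
    (hq : q ∉ closure H.G) : H.Transports p r (T₀ + T₁) := by
  obtain ⟨Φ, hΦ⟩ := h1
  obtain ⟨Ψ, hΨ⟩ := h2
  exact ⟨_, hΦ.comp hΨ hT₁ hq⟩

theorem IsExecution.flowsWithin_Icc (h : H.IsExecution (Icc 0 T) x) (ht : t ∈ Icc 0 T)
    (hG : x t ∉ closure H.G) : H.FlowsWithin x (Icc t T) t := by
  rcases ht.2.eq_or_lt with rfl | htT
  · rw [Icc_self]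
    exact flowsWithin_singleton _ _
  · exact (h.flowsWithin_right htT (fun s hs => ⟨ht.1.trans hs.1, hs.2.le⟩) hG).mono
      fun s hs => hs.1

theorem IsExecution.segment_Icc (h : H.IsExecution (Icc 0 T) x) (ht : t ∈ Icc 0 T)
    (hG : x t ∉ closure H.G) : H.IsExecution (Icc 0 (T - t)) (fun s => x (t + s)) :=
  h.segment (Icc_subset_Icc_left ht.1) (h.flowsWithin_Icc ht hG)

theorem IsExecution.run_right (h : H.IsExecution (Icc 0 T) x) (ht : t ∈ Icc 0 T)
    (hG : x t ∉ closure H.G) (hst : (p ∉ H.G ∧ x t = p) ∨ (p ∈ H.G ∧ x t = H.R p)) :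
    H.Run p (x T) (T - t) :=
  ⟨sub_nonneg.2 ht.2, _, h.segment_Icc ht hG, by simpa using hst, by simp⟩

theorem IsExecution.run_left (h : H.IsExecution (Icc 0 T) x) (ht : t ∈ Icc 0 T)
    (hst : (p ∉ H.G ∧ x 0 = p) ∨ (p ∈ H.G ∧ x 0 = H.R p)) : H.Run p (x t) t :=
  ⟨ht.1, x, h.restrict_zero ht.1 ht.2, hst, rfl⟩

theorem exists_coord_lt_subset (hq : q ∈ dom d q₀) {V : Set (Σ j, D j)} (hV : V ∈ 𝓝 q) :
    ∃ ε > 0, ∀ m ∈ dom d q₀, ‖coord d q₀ m - coord d q₀ q‖ < ε → m ∈ V := by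
  have hc := (continuousOn_pt q₀ _ (coord_mem_target hq)).tendsto
  rw [pt_coord hq] at hc
  obtain ⟨ε, hε, h⟩ := (nhdsWithin_hasBasis Metric.nhds_basis_ball _).eventually_iff.1 (hc hV)
  refine ⟨ε, hε, fun m hm hlt => ?_⟩
  have := h ⟨by simpa [dist_eq_norm] using hlt, coord_mem_target hm⟩
  rwa [pt_coord hm] at this

variable {A : EuclideanSpace ℝ (Fin (d q₀.1 + 1)) →
    EuclideanSpace ℝ (Fin (d q₀.1 + 1)) →L[ℝ] EuclideanSpace ℝ (Fin (d q₀.1 + 1))} {C ρ η κ : ℝ}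

theorem eventually_coord_lt (hp : p ∈ dom d q₀) (K : ℝ) {ε : ℝ} (hε : 0 < ε) : ∀ᶠ p' in 𝓝 p, K * ‖coord d q₀ p' - coord d q₀ p‖ < ε := by
  have h : Tendsto (coord d q₀) (𝓝 p) (𝓝 (coord d q₀ p)) := continuousAt_coord hp
  have h1 := ((h.sub_const (coord d q₀ p)).norm).const_mul K
  rw [sub_self, norm_zero, mul_zero] at h1
  exact h1.eventually (gt_mem_nhds hε)

/-- In a box off the closure of the guard every short execution from the half box is a single
trajectory, so both the expansion and the tracking property follow from the estimates in the chart.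
-/
theorem IsFlowBox.exists_trans (hb : H.IsFlowBox q₀ A C ρ η) (hG : box d q₀ ρ ⊆ (closure H.G)ᶜ)
    (hx : H.IsExecution (Icc 0 T₀) x) (h0 : 0 ≤ T₀) (hT₀ : T₀ < η)
    (hx0 : box d q₀ (ρ / 2) ∈ 𝓝 (x 0)) : H.Transports (x 0) (x T₀) T₀ := by
  have hρ := hb.r_pos
  have hhalf : box d q₀ (ρ / 2) ⊆ box d q₀ ρ := box_mono _ (by linarith)
  obtain ⟨-, hmem, htraj⟩ := hb.stay_of_disjoint hG h0 hT₀.le hx (mem_of_mem_nhds hx0)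
  have hp := (hmem 0 ⟨le_rfl, h0⟩).1
  have hq := (hmem T₀ ⟨h0, le_rfl⟩).1
  have start : ∀ p' ∈ box d q₀ (ρ / 2), ∀ r T, H.Run p' r T → 0 ≤ T ∧
      ∃ y : ℝ → Σ j, D j, H.IsExecution (Icc 0 T) y ∧ p' ∉ H.G ∧ y 0 = p' ∧ y T = r := by
    rintro p' hp' r T ⟨hT, y, hy, ⟨hpG, hy0⟩ | ⟨hpG, -⟩, hyT⟩
    · exact ⟨hT, y, hy, hpG, hy0, hyT⟩
    · exact (hG (hhalf hp') (subset_closure hpG)).elim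
  obtain ⟨Φ, hΦ⟩ := hb.exists_expandsOn (Q := H.Run) htraj hT₀.le hp hq rfl rfl (by
    have e1 : ∀ᶠ w in near H.Run (x 0) (x T₀) T₀, H.Run w.1 w.2.1 w.2.2 :=
      eventually_inf_principal.2 (Eventually.of_forall fun w hw => hw)
    filter_upwards [e1, tendsto_near_fst hx0, tendsto_near_time (gt_mem_nhds hT₀)]
      with w hw hw1 hw2
    have hw2' : w.2.2 < η := hw2
    refine ⟨hw2'.le.trans hb.η_le, ?_⟩
    obtain ⟨hT, y, hy, -, hy0, hyT⟩ := start w.1 hw1 _ _ hw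
    exact ⟨_, (hb.stay_of_disjoint hG hT hw2'.le hy (by rw [hy0]; exact hw1)).2.2,
      by rw [hy0], by rw [hyT]⟩)
  -- With no exit time to adjust to, every motion is cut at exactly `T₀`, so the time error constant
  -- is `0`.
  refine ⟨Φ, hΦ, 0, le_rfl, fun V hV ε hε => ?_⟩
  obtain ⟨ε', hε', hsub⟩ := exists_coord_lt_subset hq hV
  filter_upwards [hx0, eventually_coord_lt hp (Real.exp C) hε'] with p' hp' hlt
    s T hrun hT
  obtain ⟨hT0, y, hy, hpG, hy0, rfl⟩ := start p' hp' _ _ hrun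
  have hTT : T₀ ≤ T := by linarith
  obtain ⟨-, hmem', htraj'⟩ := hb.stay_of_disjoint hG h0 hT₀.le (hy.restrict_zero h0 hTT)
    (by rw [hy0]; exact hp')
  have hyT := hmem' T₀ ⟨h0, le_rfl⟩
  have h1 := htraj'.dist_le hb.tame htraj (hT₀.le.trans hb.η_le) ⟨h0, le_rfl⟩
  simp only [hy0] at h1
  refine ⟨y T₀, hsub _ hyT.1 (h1.trans_lt hlt), T₀, by simp, ?_, ?_⟩
  · exact hy.run_left ⟨h0, hTT⟩ (Or.inl ⟨hpG, hy0⟩)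
  · exact hy.run_right ⟨h0, hTT⟩ (hG hyT) (Or.inl ⟨fun h => hG hyT (subset_closure h), rfl⟩)

section Orbit

variable {γ : ℝ → Σ j, D j} {a b : ℝ}

theorem IsExecution.flowsWithin_Ici (hγ : H.IsExecution univ γ) (hG : ∀ t, γ t ∉ closure H.G)
    (t : ℝ) : H.FlowsWithin γ (Ici t) t :=
  hγ.flowsWithin_right (lt_add_one t) (subset_univ _) (hG t)

theorem IsExecution.segment_univ (hγ : H.IsExecution univ γ) (hG : ∀ t, γ t ∉ closure H.G)
    (a T : ℝ) : H.IsExecution (Icc 0 T) (fun s => γ (a + s)) := by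
  have := hγ.segment (a := a) (b := a + T) (subset_univ _)
    ((hγ.flowsWithin_Ici hG a).mono fun s hs => hs.1)
  simpa using this

theorem IsExecution.eventually_trans_right (hγ : H.IsExecution univ γ)
    (hG : ∀ t, γ t ∉ closure H.G) (t : ℝ) :
    ∀ᶠ s in 𝓝[>] t, H.Transports (γ t) (γ s) (s - t) := by
  obtain ⟨A, C, r, η, hb, hbG⟩ := H.exists_isFlowBox (isClosed_closure.isOpen_compl.mem_nhds (hG t))
  filter_upwards [Ioo_mem_nhdsGT (show t < t + η by linarith [hb.η_pos])] with s hs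
  have := hb.exists_trans hbG (hγ.segment_univ hG t (s - t)) (by linarith [hs.1])
    (by linarith [hs.2]) (by simpa using box_mem_nhds (γ t) (half_pos hb.r_pos))
  rwa [add_zero, add_sub_cancel] at this

theorem IsExecution.eventually_trans_left (hγ : H.IsExecution univ γ)
    (hG : ∀ t, γ t ∉ closure H.G) {t : ℝ} (hc : ContinuousAt γ t) :
    ∀ᶠ s in 𝓝[<] t, H.Transports (γ s) (γ t) (t - s) := by
  obtain ⟨A, C, r, η, hb, hbG⟩ := H.exists_isFlowBox (isClosed_closure.isOpen_compl.mem_nhds (hG t))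
  have h1 := (eventually_mem_nhds_iff.2 (box_mem_nhds (d := d) (γ t) (half_pos hb.r_pos)))
  filter_upwards [Ioo_mem_nhdsLT (show t - η < t by linarith [hb.η_pos]),
    nhdsWithin_le_nhds (hc.eventually h1)] with s hs hs'
  have := hb.exists_trans hbG (hγ.segment_univ hG s (t - s)) (by linarith [hs.2])
    (by linarith [hs.1]) (by simpa using hs')
  rwa [add_zero, add_sub_cancel] at this

end Orbit

end HybridSystem

end

noncomputable section

set_option linter.unusedSectionVars false

namespace HybridSystem

variable {J : Type*} {d : J → ℕ} {D : J → Type*}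
  [∀ j, TopologicalSpace (D j)] [∀ j, ChartedSpace (EuclideanHalfSpace (d j + 1)) (D j)]
  [∀ j, IsManifold (𝓡∂ (d j + 1)) ∞ (D j)] [∀ j, T2Space (D j)]
  {H : HybridSystem d D} {p q r z : Σ j, D j} {t T T' T₀ T₁ : ℝ} {x : ℝ → Σ j, D j}

/-! ### The reset map, and passage through the guard -/

/-- The reset map is differentiable only along the guard, so the expansion is along `𝓝[H.G] z`; that
is enough because it is applied only at exit points. -/
theorem exists_reset_expansion (H : HybridSystem d D) (hz : z ∈ H.G) :
    Tendsto H.R (𝓝[H.G] z) (𝓝 (H.R z)) ∧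
    ∃ L : EuclideanSpace ℝ (Fin (d z.1 + 1)) →L[ℝ] EuclideanSpace ℝ (Fin (d (H.R z).1 + 1)),
      (fun m => dev d (H.R z) (H.R m) - L (dev d z m)) =o[𝓝[H.G] z] dev d z := by
  obtain ⟨j, x⟩ := z
  obtain ⟨l, r, hev, hr⟩ := H.smooth_R j x hz
  set s := {y : D j | (⟨j, y⟩ : Σ j, D j) ∈ H.G} with hs
  have hxs : x ∈ s := hz
  have hR : H.R ⟨j, x⟩ = ⟨l, r x⟩ := hev.self_of_nhdsWithin hxs
  have e : 𝓝[H.G] (⟨j, x⟩ : Σ j, D j) = map (Sigma.mk j) (𝓝[s] x) :=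
    (Topology.IsOpenEmbedding.sigmaMk.map_nhdsWithin_preimage_eq H.G x).symm
  have h2 : ∀ (j : J) (y a : D j), coord d (⟨j, y⟩ : Σ j, D j) ⟨j, a⟩ =
      extChartAt (𝓡∂ (d j + 1)) y a := fun j y a => coord_mk (⟨j, y⟩ : Σ j, D j) a
  rw [e]
  constructor
  · rw [tendsto_map'_iff, hR]
    refine Tendsto.congr' (hev.mono fun y hy => hy.symm) ?_
    exact (continuous_sigmaMk.tendsto (r x)).comp hr.continuousWithinAt
  -- The component of the reset point equals `l` only propositionally, and it must be substituted
  -- before the derivative of `r` has the required type.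
  · generalize H.R ⟨j, x⟩ = w at hR
    subst hR
    obtain ⟨L, hL⟩ : ∃ L, HasMFDerivWithinAt (𝓡∂ (d j + 1)) (𝓡∂ (d l + 1)) r s x L :=
      ⟨_, (hr.mdifferentiableWithinAt (by simp)).hasMFDerivWithinAt⟩
    refine ⟨L, ?_⟩
    rw [Asymptotics.isLittleO_map]
    have h3 := hL.2.isLittleO
    have h4 : Tendsto (extChartAt (𝓡∂ (d j + 1)) x) (𝓝[s] x)
        (𝓝[(extChartAt (𝓡∂ (d j + 1)) x).symm ⁻¹' s ∩ range (𝓡∂ (d j + 1))]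
          (extChartAt (𝓡∂ (d j + 1)) x x)) := by
      refine tendsto_nhdsWithin_of_tendsto_nhds_of_eventually_within _
        ((continuousAt_extChartAt x).mono_left nhdsWithin_le_nhds) ?_
      filter_upwards [self_mem_nhdsWithin,
        nhdsWithin_le_nhds (extChartAt_source_mem_nhds (I := 𝓡∂ (d j + 1)) x)] with y hy hy'
      refine ⟨?_, by simp [extChartAt]⟩
      rw [mem_preimage, (extChartAt (𝓡∂ (d j + 1)) x).left_inv hy']
      exact hy
    refine (h3.comp_tendsto h4).congr' ?_ ?_
    · filter_upwards [hev,
        nhdsWithin_le_nhds (extChartAt_source_mem_nhds (I := 𝓡∂ (d j + 1)) x)] with y hy hy'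
      simp only [Function.comp_apply, dev, hy, h2, writtenInExtChartAt,
        (extChartAt (𝓡∂ (d j + 1)) x).left_inv hy',
        (extChartAt (𝓡∂ (d j + 1)) x).left_inv (mem_extChartAt_source x)]
    · refine Eventually.of_forall fun y => ?_
      simp only [Function.comp_apply, dev, h2]

/-- An exit box, such that executions started with a reset from it stay away from it, and from the
guard, for a while. -/
structure IsJumpBox (H : HybridSystem d D) (q : Σ j, D j)
    (A : EuclideanSpace ℝ (Fin (d q.1 + 1)) →
      EuclideanSpace ℝ (Fin (d q.1 + 1)) →L[ℝ] EuclideanSpace ℝ (Fin (d q.1 + 1)))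
    (C r η κ : ℝ) : Prop extends H.IsExitBox q A C r η κ where
  reset_notMem_closure : ∀ m ∈ H.G, m ∈ box d q r → H.R m ∉ closure H.G
  reset_notMem : ∀ m ∈ H.G, m ∈ box d q r → H.R m ∉ box d q r
  leave : ∀ m ∈ H.G, m ∈ box d q r → ∀ (x : ℝ → Σ j, D j) (T : ℝ), 0 ≤ T → T ≤ η →
    H.IsExecution (Icc 0 T) x → x 0 = H.R m → x T ∉ box d q r

/-- Take a flow box around `H.R z`, off the closure of the guard and disjoint from a neighbourhood
of `z`. Shrink the box at `z` until its guard points reset into the half of that flow box, and use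
the smaller of the two times. -/
theorem exists_isJumpBox (hout : H.OutwardOnGuard) (hz : z ∈ H.G) (hRz : H.R z ∉ closure H.G)
    {N : Set (Σ j, D j)} (hN : N ∈ 𝓝 z) :
    ∃ A C r η κ, H.IsJumpBox z A C r η κ ∧ box d z r ⊆ N := by
  have hne : z ≠ H.R z := fun h => hRz (h ▸ subset_closure hz)
  obtain ⟨N₁, N₂, hN₁, hN₂, hz₁, hz₂, hdisj⟩ := t2_separation hne
  obtain ⟨A', C', r', η', hb', hbN'⟩ := H.exists_isFlowBox
    (inter_mem (isClosed_closure.isOpen_compl.mem_nhds hRz) (hN₂.mem_nhds hz₂))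
  have hhalf := (H.exists_reset_expansion hz).1 (box_mem_nhds (d := d) _ (half_pos hb'.r_pos))
  obtain ⟨O, hO, hOz⟩ := mem_nhdsWithin_iff_exists_mem_nhds_inter.1 hhalf
  obtain ⟨A, C, r, η, κ, hb, hbN⟩ := exists_isExitBox hout hz
    (inter_mem (inter_mem hN (hN₁.mem_nhds hz₁)) hO)
  have hsub : box d (H.R z) (r' / 2) ⊆ box d (H.R z) r' :=
    box_mono _ (by linarith [hb'.r_pos])
  have hm : 0 < min η η' := lt_min hb.η_pos hb'.η_pos
  have hR : ∀ m ∈ H.G, m ∈ box d z r → H.R m ∈ box d (H.R z) (r' / 2) := fun m hmG hm =>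
    hOz ⟨(hbN hm).2, hmG⟩
  have hd : ∀ m ∈ box d (H.R z) r', m ∉ box d z r := fun m hm hm' =>
    disjoint_left.1 hdisj (hbN hm').1.2 (hbN' hm).2
  refine ⟨A, C, r, min η η', κ, ⟨⟨hb.toIsFlowBox.mono_time hm (min_le_left _ _), hb.κ_pos,
    hb.outward, hb.guard⟩, fun m hmG hm => (hbN' (hsub (hR m hmG hm))).1,
    fun m hmG hm => hd _ (hsub (hR m hmG hm)), fun m hmG hm x T h0 hT hx hx0 => ?_⟩,
    fun m hm => (hbN hm).1.1⟩
  refine hd _ ((hb'.stay_of_disjoint (fun m hm => (hbN' hm).1) h0 (hT.trans (min_le_right _ _)) hx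
    ?_).2.1 T ⟨h0, le_rfl⟩)
  rw [hx0]
  exact hR m hmG hm

variable {A : EuclideanSpace ℝ (Fin (d z.1 + 1)) →
    EuclideanSpace ℝ (Fin (d z.1 + 1)) →L[ℝ] EuclideanSpace ℝ (Fin (d z.1 + 1))} {C ρ η κ : ℝ}

/-- At time `T₀` the reference curve is on the boundary, so the normal coordinate of `y` is at most
`Real.exp C * ‖y 0 - c 0‖`; decreasing at rate `κ`, it is used up in that amount of time divided by
`κ`. -/
theorem IsExitBox.time_le (hb : H.IsExitBox z A C ρ η κ)
    {y c : ℝ → EuclideanSpace ℝ (Fin (d z.1 + 1))}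
    (hy : IsTrajectory (H.vec z) (modelBall (𝓡∂ (d z.1 + 1)) (coord d z z) ρ) T y)
    (hc : IsTrajectory (H.vec z) (modelBall (𝓡∂ (d z.1 + 1)) (coord d z z) ρ) T₀ c)
    (hT₀ : T₀ ≤ 1) (hcT : c T₀ 0 = 0) (hyT : 0 ≤ y T 0) :
    T - T₀ ≤ Real.exp C / κ * ‖y 0 - c 0‖ := by
  have hκ := hb.κ_pos
  rcases le_total T T₀ with h | h
  · have : 0 ≤ Real.exp C / κ * ‖y 0 - c 0‖ := by positivity
    linarith
  · have h1 := hb.normal_le hy hc.nonneg h le_rfl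
    have h2 := (hy.mono hc.nonneg h Subset.rfl).dist_le hb.tame hc hT₀ ⟨hc.nonneg, le_rfl⟩
    have h3 := PiLp.norm_apply_le (y T₀ - c T₀) 0
    rw [Real.norm_eq_abs] at h3
    have h4 : (y T₀ - c T₀) 0 = y T₀ 0 := by simp [hcT]
    rw [h4] at h3
    have h5 := le_abs_self (y T₀ 0)
    rw [div_mul_eq_mul_div, le_div_iff₀ hκ]
    linarith

/-- Gronwall's inequality up to the shorter of the two durations, then the speed bound. -/
theorem IsFlowBox.exists_norm_sub_le (hb : H.IsFlowBox z A C ρ η)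
    {c : ℝ → EuclideanSpace ℝ (Fin (d z.1 + 1))}
    (hc : IsTrajectory (H.vec z) (modelBall (𝓡∂ (d z.1 + 1)) (coord d z z) ρ) T₀ c)
    (hT₀ : T₀ ≤ η) : ∀ T ≤ η, ∀ y,
      IsTrajectory (H.vec z) (modelBall (𝓡∂ (d z.1 + 1)) (coord d z z) ρ) T y →
      ‖y T - c T₀‖ ≤ (Real.exp C + C) * (‖y 0 - c 0‖ + |T - T₀|) := by
  intro T hT y hy
  have hC := hb.tame.pos
  have hexp := Real.exp_pos C
  have hn := norm_nonneg (y 0 - c 0)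
  rcases le_total T T₀ with h | h
  · have h1 := hy.dist_le hb.tame (hc.mono hy.nonneg h Subset.rfl) (hT.trans hb.η_le)
      ⟨hy.nonneg, le_rfl⟩
    have h2 := hc.norm_sub_le hb.tame hy.nonneg h le_rfl
    rw [abs_sub_comm, abs_of_nonneg (sub_nonneg.2 h)]
    have e : y T - c T₀ = (y T - c T) - (c T₀ - c T) := by abel
    rw [e]
    refine (norm_sub_le _ _).trans ?_
    nlinarith [mul_nonneg hC.le hn, mul_nonneg hexp.le (sub_nonneg.2 h)]
  · have h1 := (hy.mono hc.nonneg h Subset.rfl).dist_le hb.tame hc (hT₀.trans hb.η_le)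
      ⟨hc.nonneg, le_rfl⟩
    have h2 := hy.norm_sub_le hb.tame hc.nonneg h le_rfl
    rw [abs_of_nonneg (sub_nonneg.2 h)]
    have e : y T - c T₀ = (y T - y T₀) + (y T₀ - c T₀) := by abel
    rw [e]
    refine (norm_add_le _ _).trans ?_
    nlinarith [mul_nonneg hC.le hn, mul_nonneg hexp.le (sub_nonneg.2 h)]

theorem exists_norm_coord_sub_le (H : HybridSystem d D) (hp : p ∈ dom d q) :
    ∃ K ≥ 0, ∀ᶠ p' in 𝓝 p, ‖coord d q p' - coord d q p‖ ≤ K * ‖dev d p p'‖ := by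
  obtain ⟨L, -, -, -, hL, -⟩ := H.exists_coordChange hp
  have h1 : (fun m => coord d q m - coord d q p) =O[𝓝 p] dev d p :=
    (hL.isBigO.add (L.isBigO_comp _ _)).congr_left fun m => by abel
  obtain ⟨K, hK, h⟩ := h1.exists_nonneg
  exact ⟨K, hK, h.bound⟩

/-- Executions from points near `p`, on a trajectory that runs into the guard at `z` after time
`T₀`, either end before the guard or jump near `z`. -/
theorem IsJumpBox.dichotomy (hout : H.OutwardOnGuard) (hb : H.IsJumpBox z A C ρ η κ) (hz : z ∈ H.G)
    {c : ℝ → EuclideanSpace ℝ (Fin (d z.1 + 1))}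
    (hc : IsTrajectory (H.vec z) (modelBall (𝓡∂ (d z.1 + 1)) (coord d z z) ρ) T₀ c)
    (hT₀ : T₀ ≤ η) (hp : box d z (ρ / 2) ∈ 𝓝 p) (hp0 : coord d z p 0 < κ * η)
    (hc0 : c 0 = coord d z p) (hcT : c T₀ = coord d z z) :
    ∃ C' ≥ 0, ∀ᶠ p' in 𝓝 p, ∀ (x : ℝ → Σ j, D j) (T : ℝ), 0 ≤ T → H.IsExecution (Icc 0 T) x →
      x 0 = p' →
      (T - T₀ ≤ C' * ‖dev d p p'‖ ∧ T < η ∧ x T ∈ dom d z ∧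
        ‖dev d z (x T)‖ ≤ C' * (‖dev d p p'‖ + |T - T₀|) ∧
        IsTrajectory (H.vec z) (modelBall (𝓡∂ (d z.1 + 1)) (coord d z z) ρ) T
          (fun s => coord d z (x s))) ∨
      ∃ t ∈ Ioc 0 T, |t - T₀| ≤ C' * ‖dev d p p'‖ ∧ ∃ z' ∈ H.G, z' ∈ box d z ρ ∧
        ‖dev d z z'‖ ≤ C' * ‖dev d p p'‖ ∧ H.R z' = x t ∧
        H.IsExecution (Icc 0 t) (Function.update x t z') := by
  have hκ := hb.κ_pos
  have hC := hb.tame.pos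
  have hexp := Real.exp_pos C
  have hpz : p ∈ dom d z := (mem_of_mem_nhds hp).1
  obtain ⟨K, hK, hKev⟩ := H.exists_norm_coord_sub_le hpz
  -- `C₁` bounds the error of the exit time, `C₂` the resulting error of position; `K` accounts for
  -- the change from the chart at `z` to the chart at `p`.
  set C₁ := Real.exp C / κ * K with hC₁
  set C₂ := (Real.exp C + C) * (K + 1 + C₁) with hC₂
  have hC₁0 : 0 ≤ C₁ := by positivity
  have hC₂0 : 0 ≤ C₂ := by positivity
  have hcT0 : c T₀ 0 = 0 := by rw [hcT]; exact boundary_of_mem_guard hz (self_mem_dom z)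
  have hlt : ∀ᶠ p' in 𝓝 p, coord d z p' 0 < κ * η :=
    ((EuclideanSpace.proj (𝕜 := ℝ) (0 : Fin (d z.1 + 1))).continuous.continuousAt.comp
      (continuousAt_coord hpz)).eventually (gt_mem_nhds hp0)
  refine ⟨C₁ + C₂, by positivity, ?_⟩
  filter_upwards [hp, hKev, hlt] with p' hp' hKp hp0' x T hT hx hx0
  set δ := ‖dev d p p'‖ with hδ
  have hδ0 : 0 ≤ δ := norm_nonneg _
  have hle1 : C₁ * δ ≤ (C₁ + C₂) * δ := by nlinarith
  have upper : ∀ T y, IsTrajectory (H.vec z) (modelBall (𝓡∂ (d z.1 + 1)) (coord d z z) ρ) T y →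
      y 0 = coord d z p' → 0 ≤ y T 0 → T - T₀ ≤ C₁ * δ := by
    intro T y hy hy0 hyT
    have h := hb.time_le hy hc (hT₀.trans hb.η_le) hcT0 hyT
    rw [hy0, hc0] at h
    refine h.trans ?_
    rw [hC₁, mul_assoc]
    gcongr
  have close : ∀ T ≤ η, ∀ y,
      IsTrajectory (H.vec z) (modelBall (𝓡∂ (d z.1 + 1)) (coord d z z) ρ) T y →
      y 0 = coord d z p' → ‖y T - coord d z z‖ ≤ (Real.exp C + C) * (K * δ + |T - T₀|) := by
    intro T hT y hy hy0
    have h := hb.exists_norm_sub_le hc hT₀ T hT y hy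
    rw [hy0, hc0, hcT] at h
    refine h.trans ?_
    gcongr
  rcases hb.exit hout hT hx (by rwa [hx0]) (by rwa [hx0]) with ⟨hTη, hmem, htraj⟩ |
    ⟨t, ht, htη, z', hz', hzb, hR, hex, htraj⟩
  · left
    have hxT := (hmem T ⟨hT, le_rfl⟩).1
    refine ⟨(upper T _ htraj (by rw [hx0]) (coord_nonneg _ _)).trans hle1, hTη, hxT, ?_, htraj⟩
    refine (close T hTη.le _ htraj (by rw [hx0])).trans ?_
    have hs := abs_nonneg (T - T₀)
    have : K * δ + |T - T₀| ≤ (K + 1 + C₁) * (δ + |T - T₀|) := by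
      nlinarith [mul_nonneg hK hs, mul_nonneg hC₁0 hδ0, mul_nonneg hC₁0 hs]
    calc (Real.exp C + C) * (K * δ + |T - T₀|)
        ≤ (Real.exp C + C) * ((K + 1 + C₁) * (δ + |T - T₀|)) := by gcongr
      _ = C₂ * (δ + |T - T₀|) := by rw [hC₂]; ring
      _ ≤ (C₁ + C₂) * (δ + |T - T₀|) := by gcongr; linarith
  · right
    set y := fun s => coord d z (Function.update x t z' s) with hy
    have hy0 : y 0 = coord d z p' := by simp only [hy, Function.update_of_ne ht.1.ne, hx0]
    have hyt : y t = coord d z z' := by simp only [hy, Function.update_self]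
    have hyt0 : y t 0 = 0 := by rw [hyt]; exact boundary_of_mem_guard hz' hzb.1
    have hup := upper t y htraj hy0 hyt0.ge
    -- Both curves now end on the boundary, so the comparison of exit times applies with their roles
    -- exchanged.
    have hlow : T₀ - t ≤ C₁ * δ := by
      have h := hb.time_le hc htraj (htη.le.trans hb.η_le) hyt0 hcT0.ge
      rw [hy0, hc0, norm_sub_rev] at h
      refine h.trans ?_
      rw [hC₁, mul_assoc]
      gcongr
    have habs : |t - T₀| ≤ C₁ * δ := abs_le.2 ⟨by linarith, hup⟩
    refine ⟨t, ht, habs.trans hle1, z', hz', hzb, ?_, hR, hex⟩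
    have h := close t htη.le y htraj hy0
    rw [hyt] at h
    refine h.trans ?_
    calc (Real.exp C + C) * (K * δ + |t - T₀|)
        ≤ (Real.exp C + C) * (K * δ + C₁ * δ) := by gcongr
      _ ≤ (Real.exp C + C) * ((K + 1 + C₁) * δ) := by gcongr; nlinarith
      _ = C₂ * δ := by rw [hC₂]; ring
      _ ≤ (C₁ + C₂) * δ := by gcongr; linarith

end HybridSystem

end

/-! ### Arrival at the guard: expansion and cutting of motions -/

noncomputable section

set_option linter.unusedSectionVars false

namespace HybridSystem

variable {J : Type*} {d : J → ℕ} {D : J → Type*}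
  [∀ j, TopologicalSpace (D j)] [∀ j, ChartedSpace (EuclideanHalfSpace (d j + 1)) (D j)]
  [∀ j, IsManifold (𝓡∂ (d j + 1)) ∞ (D j)] [∀ j, T2Space (D j)]
  {H : HybridSystem d D} {p q r z : Σ j, D j} {t T T' T₀ T₁ : ℝ} {x : ℝ → Σ j, D j}

/-- Some execution leads from `p` to `q` in time `T`, without a reset at its start. -/
def Arc (H : HybridSystem d D) (p q : Σ j, D j) (T : ℝ) : Prop :=
  0 ≤ T ∧ ∃ x : ℝ → Σ j, D j, H.IsExecution (Icc 0 T) x ∧ x 0 = p ∧ x T = q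

/-- Over a single instant there is nothing to check. In particular resting at a guard point for time
`0` is an `Arc`, whereas a `Run` would begin with a reset. -/
theorem isExecution_zero (H : HybridSystem d D) (x : ℝ → Σ j, D j) :
    H.IsExecution (Icc 0 0) x := by
  rw [Icc_self]
  have hc : ∀ t ∈ ({0} : Set ℝ), ContinuousWithinAt x {0} t := by
    rintro t rfl
    exact continuousWithinAt_singleton
  refine ⟨ordConnected_singleton, fun t ht => (hc t ht).mono inter_subset_left, ?_,
    fun t ht hn => (hn (hc t ht)).elim⟩
  rintro t rfl _
  exact flowsWithin_singleton _ _

theorem arc_zero (H : HybridSystem d D) (p : Σ j, D j) : H.Arc p p 0 :=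
  ⟨le_rfl, fun _ => p, H.isExecution_zero _, rfl, rfl⟩

theorem Run.arc (h : H.Run p q T) (hp : p ∉ H.G) : H.Arc p q T := by
  obtain ⟨hT, x, hx, ⟨-, hx0⟩ | ⟨hp', -⟩, hxT⟩ := h
  · exact ⟨hT, x, hx, hx0, hxT⟩
  · exact (hp hp').elim

theorem Arc.run (h : H.Arc p q T) (hp : p ∉ H.G) : H.Run p q T := by
  obtain ⟨hT, x, hx, hx0, hxT⟩ := h
  exact ⟨hT, x, hx, Or.inl ⟨hp, hx0⟩, hxT⟩

section

variable {Q Q' : (Σ j, D j) → (Σ j, D j) → ℝ → Prop}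
  {Φ : EuclideanSpace ℝ (Fin (d p.1 + 1)) →L[ℝ] EuclideanSpace ℝ (Fin (d q.1 + 1))}

theorem eventually_near_rel : ∀ᶠ w in near Q p q T₀, Q w.1 w.2.1 w.2.2 :=
  eventually_inf_principal.2 (Eventually.of_forall fun _ hw => hw)

theorem ExpandsOn.mono (h : H.ExpandsOn Q p q T₀ Φ)
    (hQ : ∀ᶠ w in near Q' p q T₀, Q w.1 w.2.1 w.2.2) : H.ExpandsOn Q' p q T₀ Φ :=
  ⟨h.vel, h.estimate.mono (le_inf inf_le_left (le_principal_iff.2 hQ))⟩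

theorem eventually_notMem_guard (hp : p ∉ closure H.G) : ∀ᶠ p' in 𝓝 p, p' ∉ H.G := by
  filter_upwards [isClosed_closure.isOpen_compl.mem_nhds hp] with p' hp' h
  exact hp' (subset_closure h)

theorem ExpandsOn.run_of_arc (h : H.ExpandsOn H.Arc p q T₀ Φ) (hp : p ∉ closure H.G) :
    H.ExpandsOn H.Run p q T₀ Φ := by
  refine h.mono ?_
  filter_upwards [eventually_near_rel, tendsto_near_fst (eventually_notMem_guard hp)] with w hw hw'
  exact hw.arc hw'

theorem ExpandsOn.arc_of_run (h : H.ExpandsOn H.Run p q T₀ Φ) (hp : p ∉ closure H.G) :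
    H.ExpandsOn H.Arc p q T₀ Φ := by
  refine h.mono ?_
  filter_upwards [eventually_near_rel, tendsto_near_fst (eventually_notMem_guard hp)] with w hw hw'
  exact hw.run hw'

end

/-- `c` is the coordinate expression of a curve that runs from `p` into the guard at `z` in
time `T₀`, inside a jump box at `z`. -/
structure Approaches (H : HybridSystem d D) (z : Σ j, D j)
    (A : EuclideanSpace ℝ (Fin (d z.1 + 1)) →
      EuclideanSpace ℝ (Fin (d z.1 + 1)) →L[ℝ] EuclideanSpace ℝ (Fin (d z.1 + 1)))
    (C ρ η κ : ℝ) (p : Σ j, D j) (T₀ : ℝ) (c : ℝ → EuclideanSpace ℝ (Fin (d z.1 + 1))) :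
    Prop where
  jumpBox : H.IsJumpBox z A C ρ η κ
  guard : z ∈ H.G
  traj : IsTrajectory (H.vec z) (modelBall (𝓡∂ (d z.1 + 1)) (coord d z z) ρ) T₀ c
  time_lt : T₀ < η
  mem_nhds : box d z (ρ / 2) ∈ 𝓝 p
  normal_lt : coord d z p 0 < κ * η
  start : c 0 = coord d z p
  finish : c T₀ = coord d z z

variable {A : EuclideanSpace ℝ (Fin (d z.1 + 1)) →
    EuclideanSpace ℝ (Fin (d z.1 + 1)) →L[ℝ] EuclideanSpace ℝ (Fin (d z.1 + 1))} {C ρ η κ : ℝ}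
  {c : ℝ → EuclideanSpace ℝ (Fin (d z.1 + 1))}

theorem Approaches.dichotomy (hout : H.OutwardOnGuard) (h : H.Approaches z A C ρ η κ p T₀ c) :
    ∃ C' ≥ 0, ∀ᶠ p' in 𝓝 p, ∀ (x : ℝ → Σ j, D j) (T : ℝ), 0 ≤ T → H.IsExecution (Icc 0 T) x →
      x 0 = p' →
      (T - T₀ ≤ C' * ‖dev d p p'‖ ∧ T < η ∧ x T ∈ dom d z ∧
        ‖dev d z (x T)‖ ≤ C' * (‖dev d p p'‖ + |T - T₀|) ∧
        IsTrajectory (H.vec z) (modelBall (𝓡∂ (d z.1 + 1)) (coord d z z) ρ) T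
          (fun s => coord d z (x s))) ∨
      ∃ t ∈ Ioc 0 T, |t - T₀| ≤ C' * ‖dev d p p'‖ ∧ ∃ z' ∈ H.G, z' ∈ box d z ρ ∧
        ‖dev d z z'‖ ≤ C' * ‖dev d p p'‖ ∧ H.R z' = x t ∧
        H.IsExecution (Icc 0 t) (Function.update x t z') :=
  h.jumpBox.dichotomy hout h.guard h.traj h.time_lt.le h.mem_nhds h.normal_lt h.start h.finish

/-- A motion that ends near `z` at a time below `η` has not yet jumped: after a jump it would be
outside the box by `IsJumpBox.leave`. All relevant arcs are therefore trajectories in one box. -/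
theorem Approaches.exists_expandsOn_arc (hout : H.OutwardOnGuard)
    (h : H.Approaches z A C ρ η κ p T₀ c) : ∃ Φ, H.ExpandsOn H.Arc p z T₀ Φ := by
  have hb := h.jumpBox
  obtain ⟨C', hC', hdich⟩ := h.dichotomy hout
  refine hb.exists_expandsOn h.traj h.time_lt.le (mem_of_mem_nhds h.mem_nhds).1 (self_mem_dom z)
    h.start h.finish ?_
  filter_upwards [eventually_near_rel, tendsto_near_fst hdich,
    tendsto_near_snd (box_mem_nhds (d := d) z hb.r_pos),
    tendsto_near_time (gt_mem_nhds h.time_lt)] with w hw hw1 hw2 hw3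
  obtain ⟨hT, x, hx, hx0, hxT⟩ := hw
  have hw3' : w.2.2 < η := hw3
  refine ⟨hw3'.le.trans hb.η_le, ?_⟩
  rcases hw1 x _ hT hx hx0 with ⟨-, -, -, -, htraj⟩ | ⟨t, ht, -, z', hz', hzb, -, hR, -⟩
  · exact ⟨_, htraj, by rw [hx0], by rw [hxT]⟩
  · have hseg := hx.segment_Icc ⟨ht.1.le, ht.2⟩ (by
      rw [← hR]; exact hb.reset_notMem_closure z' hz' hzb)
    have := hb.leave z' hz' hzb _ _ (sub_nonneg.2 ht.2) (by linarith [ht.1]) hseg (by simp [hR])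
    rw [add_sub_cancel, hxT] at this
    exact (this hw2).elim

theorem exists_dev_lt_subset {V : Set (Σ j, D j)} (hV : V ∈ 𝓝 q) :
    ∃ ε > 0, ∀ m ∈ dom d q, ‖dev d q m‖ < ε → m ∈ V :=
  exists_coord_lt_subset (self_mem_dom q) hV

theorem IsExecution.run_exit (hx : H.IsExecution (Icc 0 t) (Function.update x t z)) (ht : 0 < t)
    (hx0 : x 0 = p) (hp : p ∉ H.G) : H.Run p z t :=
  ⟨ht.le, _, hx, Or.inl ⟨hp, by rw [Function.update_of_ne ht.ne, hx0]⟩, Function.update_self _ _ _⟩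

/-- A motion that lasts noticeably longer than `T₀` must have jumped. It is cut at its exit point,
which ends the first piece and starts the second one by a reset. -/
theorem Approaches.tracks (hout : H.OutwardOnGuard) (h : H.Approaches z A C ρ η κ p T₀ c)
    (hp : p ∉ closure H.G) : H.Tracks p z T₀ := by
  obtain ⟨C', hC', hdich⟩ := h.dichotomy hout
  refine ⟨C', hC', fun V hV ε hε => ?_⟩
  obtain ⟨ε', hε', hsub⟩ := exists_dev_lt_subset (d := d) hV
  filter_upwards [hdich, eventually_notMem_guard hp,
    eventually_mul_norm_dev_lt (d := d) p hC' (lt_min hε hε')] with p' hp' hpG hlt s T hrun hT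
  obtain ⟨hT0, x, hx, hx0, rfl⟩ := hrun.arc hpG
  have h1 := min_le_left ε ε'
  have h2 := min_le_right ε ε'
  rcases hp' x T hT0 hx hx0 with ⟨hle, -⟩ | ⟨t, ht, htT, z', hz', hzb, hzn, hR, hex⟩
  · linarith
  · refine ⟨z', hsub z' hzb.1 (by linarith), t, htT, hex.run_exit ht.1 hx0 hpG, ?_⟩
    exact hx.run_right ⟨ht.1.le, ht.2⟩
      (by rw [← hR]; exact h.jumpBox.reset_notMem_closure z' hz' hzb) (Or.inr ⟨hz', hR.symm⟩)

/-- By the dichotomy a motion that has not jumped by about time `T₀` is still close to `z`, so one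
that ends away from `z` has passed the guard. -/
theorem Approaches.sharp (hout : H.OutwardOnGuard) (h : H.Approaches z A C ρ η κ p T₀ c)
    (hp : p ∉ closure H.G) : H.Sharp p z T₀ := by
  obtain ⟨C', hC', hdich⟩ := h.dichotomy hout
  refine ⟨C', hC', fun V hV => ?_⟩
  obtain ⟨ε, hε, hsub⟩ := exists_dev_lt_subset (d := d) hV
  -- Chosen so that a time deficit of this size contributes at most `ε / 2` to the bound `C' * (δ +
  -- |T - T₀|)`.
  refine ⟨ε / (2 * (C' + 1)), by positivity, ?_⟩
  filter_upwards [hdich, eventually_notMem_guard hp,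
    eventually_mul_norm_dev_lt (d := d) p (show 0 ≤ C' * (1 + C') by positivity) (half_pos hε),
    eventually_mul_norm_dev_lt (d := d) p hC' hε] with p' hp' hpG hlt hlt' s T hrun hT hsV
  obtain ⟨hT0, x, hx, hx0, rfl⟩ := hrun.arc hpG
  rcases hp' x T hT0 hx hx0 with ⟨hle, -, hdom, hn, -⟩ |
    ⟨t, ht, htT, z', hz', hzb, hzn, hR, hex⟩
  · refine (hsV (hsub _ hdom (hn.trans_lt ?_))).elim
    set δ := ‖dev d p p'‖
    have hδ : 0 ≤ δ := norm_nonneg _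
    have hη : 0 < ε / (2 * (C' + 1)) := by positivity
    have habs : |T - T₀| ≤ ε / (2 * (C' + 1)) + C' * δ :=
      abs_le.2 ⟨by nlinarith [mul_nonneg hC' hδ], by linarith⟩
    have e : C' * (ε / (2 * (C' + 1))) ≤ ε / 2 := by
      rw [mul_div_assoc', div_le_div_iff₀ (by positivity) two_pos]
      nlinarith
    calc C' * (δ + |T - T₀|) ≤ C' * (δ + (ε / (2 * (C' + 1)) + C' * δ)) := by gcongr
      _ = C' * (1 + C') * δ + C' * (ε / (2 * (C' + 1))) := by ring
      _ < ε := by linarith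
  · refine ⟨z', hsub z' hzb.1 (by linarith), t, htT, hex.run_exit ht.1 hx0 hpG, ?_⟩
    exact hx.run_right ⟨ht.1.le, ht.2⟩
      (by rw [← hR]; exact h.jumpBox.reset_notMem_closure z' hz' hzb) (Or.inr ⟨hz', hR.symm⟩)

/-- Here the cut is made just after the reset. When `p = z` and `T₀ = 0`, nearby starting points may
themselves be on the guard; they are reset at time `0`, and continuity of the reset map along the
guard suffices. -/
theorem Approaches.tracks_reset (hout : H.OutwardOnGuard) (h : H.Approaches z A C ρ η κ p T₀ c)
    (hp : p ∉ closure H.G ∨ (p = z ∧ T₀ = 0)) : H.Tracks p (H.R z) T₀ := by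
  obtain ⟨C', hC', hdich⟩ := h.dichotomy hout
  have hRz := h.jumpBox.reset_notMem_closure z h.guard ⟨self_mem_dom z, by
    simpa using h.jumpBox.r_pos.le⟩
  refine ⟨C', hC', fun V hV ε hε => ?_⟩
  obtain ⟨N, hN, hNV⟩ := mem_nhdsWithin_iff_exists_mem_nhds_inter.1
    ((H.exists_reset_expansion h.guard).1
      (inter_mem hV (isClosed_closure.isOpen_compl.mem_nhds hRz)))
  obtain ⟨ε', hε', hsub⟩ := exists_dev_lt_subset (d := d) hN
  have hG : ∀ᶠ p' in 𝓝 p, p' ∈ H.G → T₀ = 0 ∧ p' ∈ N := by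
    rcases hp with hp | ⟨rfl, hT⟩
    · filter_upwards [eventually_notMem_guard hp] with p' h1 h2
      exact (h1 h2).elim
    · filter_upwards [hN] with p' h1 _
      exact ⟨hT, h1⟩
  filter_upwards [hdich, hG, eventually_mul_norm_dev_lt (d := d) p hC' (lt_min hε hε')]
    with p' hp' hpG hlt s T hrun hT
  have h1 := min_le_left ε ε'
  have h2 := min_le_right ε ε'
  obtain ⟨hT0, x, hx, hst, rfl⟩ := hrun
  have key : ∀ t ∈ Icc 0 T, |t - T₀| ≤ C' * ‖dev d p p'‖ → ∀ z' ∈ H.G, z' ∈ N → H.R z' = x t →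
      ∃ q' ∈ V, ∃ T', |T' - T₀| ≤ C' * ‖dev d p p'‖ ∧ H.Run p' q' T' ∧
        H.Run q' (x T) (T - T') := by
    intro t ht htT z' hz' hzN hR
    have h3 := hNV ⟨hzN, hz'⟩
    rw [mem_preimage, hR] at h3
    exact ⟨x t, h3.1, t, htT, hx.run_left ht hst, hx.run_right ht h3.2
      (Or.inl ⟨fun h => h3.2 (subset_closure h), rfl⟩)⟩
  rcases hst with ⟨hpG', hx0⟩ | ⟨hpG', hx0⟩
  · rcases hp' x T hT0 hx hx0 with ⟨hle, -⟩ | ⟨t, ht, htT, z', hz', hzb, hzn, hR, hex⟩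
    · linarith
    · exact key t ⟨ht.1.le, ht.2⟩ htT z' hz' (hsub z' hzb.1 (by linarith)) hR
  · obtain ⟨rfl, hpN⟩ := hpG hpG'
    exact key 0 ⟨le_rfl, hT0⟩ (by simpa using by positivity) p' hpG' hpN hx0.symm

end HybridSystem

end

/-! ### Linearization of the reset at a guard point -/

noncomputable section

set_option linter.unusedSectionVars false

namespace HybridSystem

variable {J : Type*} {d : J → ℕ} {D : J → Type*}
  [∀ j, TopologicalSpace (D j)] [∀ j, ChartedSpace (EuclideanHalfSpace (d j + 1)) (D j)]
  [∀ j, IsManifold (𝓡∂ (d j + 1)) ∞ (D j)] [∀ j, T2Space (D j)]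
  {H : HybridSystem d D} {p q r z : Σ j, D j} {t T T' T₀ T₁ : ℝ} {x : ℝ → Σ j, D j}

theorem tendsto_of_tendsto_dev {α : Type*} {l : Filter α} {f : α → Σ j, D j}
    (hdom : ∀ᶠ w in l, f w ∈ dom d q) (h : Tendsto (fun w => dev d q (f w)) l (𝓝 0)) :
    Tendsto f l (𝓝 q) := by
  refine tendsto_def.2 fun V hV => ?_
  obtain ⟨ε, hε, hsub⟩ := exists_dev_lt_subset (d := d) hV
  have h1 := h.norm
  rw [norm_zero] at h1
  filter_upwards [hdom, h1.eventually (gt_mem_nhds hε)] with w h2 h3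
  exact hsub _ h2 h3

/-- A degenerate approach, by the constant curve at `z`: it makes the exit dichotomy available for
all starting points near `z`. -/
theorem exists_approaches_zero (hout : H.OutwardOnGuard) (hz : z ∈ H.G)
    (hRz : H.R z ∉ closure H.G) :
    ∃ A C ρ η κ, H.Approaches z A C ρ η κ z 0 (fun _ => coord d z z) := by
  obtain ⟨A, C, ρ, η, κ, hb, -⟩ := exists_isJumpBox hout hz hRz (N := univ) univ_mem
  refine ⟨A, C, ρ, η, κ, hb, hz, ⟨le_rfl, continuousOn_const, ?_, fun _ _ => ?_⟩, hb.η_pos,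
    box_mem_nhds z (half_pos hb.r_pos), ?_, rfl, rfl⟩
  · rintro s ⟨h1, h2⟩
    exact (h1.not_gt h2).elim
  · exact coord_mem_modelBall ⟨self_mem_dom z, by simpa using hb.r_pos.le⟩
  · rw [boundary_of_mem_guard hz (self_mem_dom z)]
    exact mul_pos hb.κ_pos hb.η_pos

/-- The short motion that remains after a reset, when the exit time is not exactly the total time,
is expanded by this lemma. -/
theorem exists_expandsOn_arc_zero (hp : p ∉ closure H.G) :
    ∃ Φ, H.ExpandsOn H.Arc p p 0 Φ := by
  obtain ⟨A, C, r, η, hb, hbG⟩ := H.exists_isFlowBox (isClosed_closure.isOpen_compl.mem_nhds hp)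
  obtain ⟨Φ, hΦ⟩ := hb.exists_trans hbG (H.isExecution_zero fun _ => p) le_rfl hb.η_pos
    (box_mem_nhds p (half_pos hb.r_pos))
  exact ⟨Φ, hΦ.expands.arc_of_run hp⟩

/-- Motions that start near a guard point `z` and end near its reset: the exit point and the exit
time. -/
theorem eventually_exists_exit (hout : H.OutwardOnGuard) (hz : z ∈ H.G)
    (hRz : H.R z ∉ closure H.G) :
    ∃ C ≥ 0, ∀ᶠ w in near H.Run z (H.R z) 0, ∃ a : (Σ j, D j) × ℝ, a.1 ∈ H.G ∧ a.1 ∈ dom d z ∧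
      ‖dev d z a.1‖ ≤ C * ‖dev d z w.1‖ ∧ |a.2| ≤ C * ‖dev d z w.1‖ ∧ H.Arc w.1 a.1 a.2 ∧
      H.Arc (H.R a.1) w.2.1 (w.2.2 - a.2) := by
  obtain ⟨A, C, ρ, η, κ, happ⟩ := exists_approaches_zero hout hz hRz
  obtain ⟨C', hC', hdich⟩ := happ.dichotomy hout
  have hb := happ.jumpBox
  have hne : z ≠ H.R z := fun h => hRz (h ▸ subset_closure hz)
  obtain ⟨N₁, N₂, hN₁, hN₂, hz₁, hz₂, hdisj⟩ := t2_separation hne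
  obtain ⟨ε, hε, hsub⟩ := exists_dev_lt_subset (d := d) (hN₁.mem_nhds hz₁)
  have hsize : ∀ᶠ w in near H.Run z (H.R z) 0, C' * (‖dev d z w.1‖ + |w.2.2 - 0|) < ε := by
    have := (tendsto_near_size (d := d) (Q := H.Run) (p := z) (q := H.R z) (T₀ := 0)).const_mul C'
    rw [mul_zero] at this
    exact this.eventually (gt_mem_nhds hε)
  refine ⟨C' + 1, by positivity, ?_⟩
  filter_upwards [eventually_near_rel, tendsto_near_fst hdich, hsize,
    tendsto_near_snd (hN₂.mem_nhds hz₂), tendsto_near_fst ((isOpen_dom (d := d) z).mem_nhds (self_mem_dom z))]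
    with w hw hw1 hw2 hw3 hw4
  have hδ := norm_nonneg (dev d z w.1)
  obtain ⟨hT, x, hx, ⟨hG, hx0⟩ | ⟨hG, hx0⟩, hxT⟩ := hw
  · rcases hw1 x _ hT hx hx0 with ⟨-, -, hdom, hn, -⟩ | ⟨t, ht, htT, z', hz', hzb, hzn, hR, hex⟩
    · rw [hxT] at hdom hn
      -- Without a jump the motion would still be near `z`, but its end is near the reset point, in
      -- a disjoint neighbourhood.
      exact (disjoint_left.1 hdisj (hsub _ hdom (hn.trans_lt hw2)) hw3).elim
    · rw [sub_zero] at htT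
      refine ⟨(z', t), hz', hzb.1, by linarith, by linarith, (hex.run_exit ht.1 hx0 hG).arc hG, ?_⟩
      refine ⟨sub_nonneg.2 ht.2, _, hx.segment_Icc ⟨ht.1.le, ht.2⟩ ?_, by simp [hR], by simpa⟩
      rw [← hR]
      exact hb.reset_notMem_closure z' hz' hzb
  -- A start on the guard is its own exit point, with exit time `0`.
  · refine ⟨(w.1, 0), hG, hw4, by simp only; nlinarith, by simp only [abs_zero]; positivity,
      H.arc_zero _, ?_⟩
    rw [sub_zero]
    exact ⟨hT, x, hx, hx0, hxT⟩

/-- The linearization of the reset ("saltation"). -/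
theorem exists_expandsOn_reset (hout : H.OutwardOnGuard) (hz : z ∈ H.G)
    (hRz : H.R z ∉ closure H.G) : ∃ Φ, H.ExpandsOn H.Run z (H.R z) 0 Φ := by
  obtain ⟨A, C₁, ρ, η, κ, happ⟩ := exists_approaches_zero hout hz hRz
  obtain ⟨Φ, hΦ⟩ := happ.exists_expandsOn_arc hout
  obtain ⟨Ψ, hΨ⟩ := exists_expandsOn_arc_zero hRz
  obtain ⟨hRc, L, hL⟩ := H.exists_reset_expansion hz
  obtain ⟨C, hC, hev⟩ := eventually_exists_exit hout hz hRz
  have : Nonempty ((Σ j, D j) × ℝ) := ⟨(z, 0)⟩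
  obtain ⟨g, hg⟩ := skolem.1 hev
  set l := near H.Run z (H.R z) 0 with hl
  set X : (Σ j, D j) × (Σ j, D j) × ℝ → ℝ := fun w => ‖dev d z w.1‖ + |w.2.2 - 0| with hX
  set F₀ := H.vel z 0 with hF₀
  have hF : F₀ ≠ 0 := (vel_neg hout hz).ne
  set n : EuclideanSpace ℝ (Fin (d z.1 + 1)) →L[ℝ] ℝ := EuclideanSpace.proj 0 with hn
  have hnF : n (H.vel z) = F₀ := rfl
  -- The exit point deviates from `z` by `Φ u + σ • H.vel z`, for an initial deviation `u` and exit
  -- time `σ`. Its normal coordinate vanishes, so `σ = -F₀⁻¹ * n (Φ u)` to first order. The first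
  -- summand resets this exit point; the second is the motion after the reset during the time `-σ`.
  set S := (Ψ.comp L).comp (Φ - ((F₀⁻¹ • n).comp Φ).smulRight (H.vel z)) +
    ((F₀⁻¹ • n).comp Φ).smulRight (H.vel (H.R z)) with hS
  refine ⟨S, ?_, ?_⟩
  · simp [hS, hΦ.vel, hnF, hF]
  have hdX : (fun w : (Σ j, D j) × (Σ j, D j) × ℝ => dev d z w.1) =O[l] X := dev_isBigO_size
  have hgd : (fun w => dev d z (g w).1) =O[l] X :=
    (Asymptotics.IsBigO.of_bound C (hg.mono fun w hw => hw.2.2.1)).trans hdX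
  have hgt : (fun w => (g w).2) =O[l] X :=
    (Asymptotics.IsBigO.of_bound C (hg.mono fun w hw => hw.2.2.2.1)).trans hdX
  have hX_lim : Tendsto X l (𝓝 0) := tendsto_near_size
  have hg1 : Tendsto (fun w => (g w).1) l (𝓝 z) :=
    tendsto_of_tendsto_dev (hg.mono fun w hw => hw.2.1) (hgd.trans_tendsto hX_lim)
  have hg2 : Tendsto (fun w => (g w).2) l (𝓝 0) := hgt.trans_tendsto hX_lim
  have hgG : Tendsto (fun w => (g w).1) l (𝓝[H.G] z) :=
    tendsto_nhdsWithin_iff.2 ⟨hg1, hg.mono fun w hw => hw.1⟩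
  have e1 : (fun w => dev d z (g w).1 - Φ (dev d z w.1) - ((g w).2 - 0) • H.vel z) =o[l] X := by
    have ht : Tendsto (fun w => (w.1, (g w).1, (g w).2)) l (near H.Arc z z 0) :=
      tendsto_inf.2 ⟨tendsto_near_fst.prodMk (hg1.prodMk hg2),
        tendsto_principal.2 (hg.mono fun w hw => hw.2.2.2.2.1)⟩
    refine (hΦ.estimate.comp_tendsto ht).trans_isBigO ?_
    exact hdX.norm_left.add (by simpa using hgt.abs_left)
  have e2 : (fun w => dev d (H.R z) (H.R (g w).1) - L (dev d z (g w).1)) =o[l] X :=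
    (hL.comp_tendsto hgG).trans_isBigO hgd
  have hRd : (fun w => dev d (H.R z) (H.R (g w).1)) =O[l] X :=
    (e2.isBigO.add ((L.isBigO_comp _ l).trans hgd)).congr_left fun w => by abel
  have hTt : (fun w : (Σ j, D j) × (Σ j, D j) × ℝ => w.2.2 - (g w).2 - 0) =O[l] X :=
    ((time_isBigO_size (T₀ := 0)).sub hgt).congr_left fun w => by ring
  have e3 : (fun w => dev d (H.R z) w.2.1 - Ψ (dev d (H.R z) (H.R (g w).1)) -
      (w.2.2 - (g w).2 - 0) • H.vel (H.R z)) =o[l] X := by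
    have ht : Tendsto (fun w : (Σ j, D j) × (Σ j, D j) × ℝ => (H.R (g w).1, w.2.1, w.2.2 - (g w).2))
        l (near H.Arc (H.R z) (H.R z) 0) := by
      refine tendsto_inf.2 ⟨(hRc.comp hgG).prodMk (tendsto_near_snd.prodMk ?_),
        tendsto_principal.2 (hg.mono fun w hw => hw.2.2.2.2.2)⟩
      simpa using tendsto_near_time.sub hg2
    refine (hΨ.estimate.comp_tendsto ht).trans_isBigO ?_
    exact hRd.norm_left.add hTt.abs_left
  have e4 := (e3.add ((Ψ.isBigO_comp _ l).trans_isLittleO e2)).add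
    (((Ψ.comp L).isBigO_comp _ l).trans_isLittleO e1)
  -- The normal component of `e1` expresses `σ` through `Φ`; this rank-one multiple of it replaces
  -- `σ` in `e4`.
  have e5 := (((F₀⁻¹ • n).smulRight ((Ψ.comp L) (H.vel z) - H.vel (H.R z))).isBigO_comp
    _ l).trans_isLittleO e1
  refine (e4.sub e5).congr' ?_ EventuallyEq.rfl
  filter_upwards [hg] with w hw
  have hn0 : n (dev d z (g w).1) = 0 := by
    have h1 : n (dev d z (g w).1) = coord d z (g w).1 0 - coord d z z 0 := rfl
    rw [h1, boundary_of_mem_guard hw.1 hw.2.1, boundary_of_mem_guard hz (self_mem_dom z), sub_zero]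
  simp only [hS, map_sub, map_smul, ContinuousLinearMap.comp_apply, add_apply,
    sub_apply, ContinuousLinearMap.smulRight_apply,
    smul_apply, hn0, hnF, smul_eq_mul, sub_zero]
  match_scalars <;> field_simp <;> ring

end HybridSystem

end

noncomputable section

set_option linter.unusedSectionVars false

namespace HybridSystem

variable {J : Type*} {d : J → ℕ} {D : J → Type*}
  [∀ j, TopologicalSpace (D j)] [∀ j, ChartedSpace (EuclideanHalfSpace (d j + 1)) (D j)]
  [∀ j, IsManifold (𝓡∂ (d j + 1)) ∞ (D j)] [∀ j, T2Space (D j)]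
  {H : HybridSystem d D} {p q r z z' : Σ j, D j} {a b s t T T' T₀ T₁ τ : ℝ} {γ : ℝ → Σ j, D j}

/-! ### Transport along an orbit -/

/-- `γ` leaves its domain through the guard at `z`, at the time `t`. -/
def IsExit (H : HybridSystem d D) (γ : ℝ → Σ j, D j) (t : ℝ) (z : Σ j, D j) : Prop :=
  z ∈ H.G ∧ Tendsto γ (𝓝[<] t) (𝓝 z) ∧ H.R z = γ t

theorem IsExecution.exists_isExit (hγ : H.IsExecution univ γ) (hc : ¬ ContinuousAt γ t) :
    ∃ z, H.IsExit γ t z := by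
  obtain ⟨z, hz, hlim, hR⟩ := hγ.jump t (mem_univ t) (by rwa [continuousWithinAt_univ])
  rw [univ_inter] at hlim
  exact ⟨z, hz, hlim, hR⟩

theorem IsExit.unique (h : H.IsExit γ t z) (h' : H.IsExit γ t z') : z = z' :=
  tendsto_nhds_unique h.2.1 h'.2.1

/-- The orbit segment from `γ s` to `γ t` ends at the reset of `z`, outside the jump box, so the
exit alternative must hold. Its trajectory up to the exit point serves as the reference curve. -/
theorem IsExit.eventually_approaches (hout : H.OutwardOnGuard) (hγ : H.IsExecution univ γ)
    (hG : ∀ t, γ t ∉ closure H.G) (h : H.IsExit γ t z) :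
    ∀ᶠ s in 𝓝[<] t, ∃ A C ρ η κ c, H.Approaches z A C ρ η κ (γ s) (t - s) c := by
  obtain ⟨hz, hlim, hR⟩ := h
  obtain ⟨A, C, ρ, η, κ, hb, -⟩ := exists_isJumpBox hout hz (by rw [hR]; exact hG t)
    (N := univ) univ_mem
  have hρ := hb.r_pos
  have hn : ∀ᶠ m in 𝓝 z, coord d z m 0 < κ * η := by
    have h1 : ContinuousAt (fun m => coord d z m 0) z :=
      (EuclideanSpace.proj (𝕜 := ℝ) (0 : Fin (d z.1 + 1))).continuous.continuousAt.comp
        (continuousAt_coord (self_mem_dom z))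
    refine h1.eventually (gt_mem_nhds ?_)
    change coord d z z 0 < κ * η
    rw [boundary_of_mem_guard hz (self_mem_dom z)]
    exact mul_pos hb.κ_pos hb.η_pos
  have hgood : ∀ᶠ s in 𝓝[<] t, box d z (ρ / 2) ∈ 𝓝 (γ s) ∧ coord d z (γ s) 0 < κ * η :=
    hlim.eventually ((eventually_mem_nhds_iff.2 (box_mem_nhds (d := d) z (half_pos hρ))).and hn)
  obtain ⟨e, he, hsub⟩ := mem_nhdsLT_iff_exists_Ioo_subset.1 hgood
  filter_upwards [Ioo_mem_nhdsLT he, Ioo_mem_nhdsLT (show t - η < t by linarith [hb.η_pos])]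
    with s hs hs'
  have hseg := hγ.segment_univ hG s (t - s)
  have hs0 := hsub hs
  have hzbox : z ∈ box d z ρ := mem_of_mem_nhds (box_mem_nhds z hρ)
  have hzR := hb.reset_notMem z hz hzbox
  rw [hR] at hzR
  rcases hb.exit hout (by linarith [hs.2]) hseg (by simpa using mem_of_mem_nhds hs0.1)
    (by simpa using hs0.2) with ⟨-, hmem, -⟩ | ⟨t₁, ht₁, -, z', hz', hzb, hR', hex, htraj⟩
  · have := hmem (t - s) ⟨by linarith [hs.2], le_rfl⟩
    rw [add_sub_cancel] at this
    exact (hzR this).elim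
  -- A jump before time `t` would take the orbit out of the box, where it is known to stay until
  -- `t`.
  have ht₁' : t₁ = t - s := by
    by_contra hne
    have hlt : t₁ < t - s := lt_of_le_of_ne ht₁.2 hne
    refine hb.reset_notMem z' hz' hzb ?_
    rw [hR']
    exact box_mono z (by linarith) (mem_of_mem_nhds
      (hsub (show s + t₁ ∈ Ioo e t from ⟨by linarith [hs.1, ht₁.1], by linarith⟩)).1)
  subst ht₁'
  refine ⟨A, C, ρ, η, κ, _, hb, hz, htraj, by linarith [hs'.1], hs0.1, hs0.2, ?_, ?_⟩
  · rw [Function.update_of_ne ht₁.1.ne, add_zero]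
  · have h1 := (htraj.cont (t - s) ⟨ht₁.1.le, le_rfl⟩).tendsto
    have h2 : Tendsto (fun u => coord d z (γ (s + u))) (𝓝[<] (t - s)) (𝓝 (coord d z z)) := by
      refine (continuousAt_coord (self_mem_dom z)).tendsto.comp (hlim.comp ?_)
      refine tendsto_nhdsWithin_iff.2 ⟨?_, ?_⟩
      · have : Tendsto (fun u => s + u) (𝓝 (t - s)) (𝓝 (s + (t - s))) :=
          (by fun_prop : Continuous fun u => s + u).tendsto _
        rw [add_sub_cancel] at this
        exact this.mono_left nhdsWithin_le_nhds
      · filter_upwards [self_mem_nhdsWithin] with u hu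
        have := mem_Iio.1 hu
        exact mem_Iio.2 (by linarith)
    have h3 : 𝓝[<] (t - s) ≤ 𝓝[Icc 0 (t - s)] (t - s) :=
      nhdsWithin_le_of_mem (mem_of_superset (Ioo_mem_nhdsLT ht₁.1) Ioo_subset_Icc_self)
    refine tendsto_nhds_unique (h1.mono_left h3) (h2.congr' ?_)
    filter_upwards [self_mem_nhdsWithin] with u hu
    rw [Function.update_of_ne (ne_of_lt hu)]

/-- Passage through the guard is the approach to `z` followed by the reset, which takes time `0`;
sharpness and `z ≠ H.R z` make this composition possible. -/
theorem IsExit.eventually_transports (hout : H.OutwardOnGuard) (hγ : H.IsExecution univ γ)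
    (hG : ∀ t, γ t ∉ closure H.G) (h : H.IsExit γ t z) :
    ∀ᶠ s in 𝓝[<] t, H.Transports (γ s) z (t - s) ∧ H.Sharp (γ s) z (t - s) ∧
      H.Transports (γ s) (γ t) (t - s) := by
  have hRz : H.R z ∉ closure H.G := by rw [h.2.2]; exact hG t
  have hne : z ≠ H.R z := fun h' => hRz (h' ▸ subset_closure h.1)
  obtain ⟨Ψ, hΨ⟩ := exists_expandsOn_reset hout h.1 hRz
  filter_upwards [h.eventually_approaches hout hγ hG] with s hs
  obtain ⟨A, C, ρ, η, κ, c, happ⟩ := hs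
  obtain ⟨Φ, hΦ⟩ := happ.exists_expandsOn_arc hout
  have h1 := hΦ.run_of_arc (hG s)
  have h2 := happ.tracks hout (hG s)
  have h3 := happ.sharp hout (hG s)
  have h4 := h1.comp h2 hΨ (Or.inr ⟨h3, hne, rfl⟩)
  rw [add_zero] at h4
  rw [← h.2.2]
  exact ⟨⟨Φ, h1, h2⟩, h3, _, h4, happ.tracks_reset hout (Or.inl (hG s))⟩

theorem transports_reset (hout : H.OutwardOnGuard) (hz : z ∈ H.G) (hRz : H.R z ∉ closure H.G) :
    H.Transports z (H.R z) 0 := by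
  obtain ⟨A, C, ρ, η, κ, happ⟩ := exists_approaches_zero hout hz hRz
  obtain ⟨Ψ, hΨ⟩ := exists_expandsOn_reset hout hz hRz
  exact ⟨Ψ, hΨ, happ.tracks_reset hout (Or.inr ⟨rfl, rfl⟩)⟩

/-- Every time has short transports on both sides, and from the left they include a possible passage
through the guard. The supremum of the times reached from `a` is therefore reached, and it cannot be
smaller than `b`. -/
theorem IsExecution.transports (hout : H.OutwardOnGuard) (hγ : H.IsExecution univ γ)
    (hG : ∀ t, γ t ∉ closure H.G) (hab : a < b) : H.Transports (γ a) (γ b) (b - a) := by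
  have left : ∀ t, ∀ᶠ s in 𝓝[<] t, H.Transports (γ s) (γ t) (t - s) := by
    intro t
    by_cases hc : ContinuousAt γ t
    · exact hγ.eventually_trans_left hG hc
    · obtain ⟨z, hz⟩ := hγ.exists_isExit hc
      exact (hz.eventually_transports hout hγ hG).mono fun s hs => hs.2.2
  have comp : ∀ {s t : ℝ}, a < s → s < t → H.Transports (γ a) (γ s) (s - a) →
      H.Transports (γ s) (γ t) (t - s) → H.Transports (γ a) (γ t) (t - a) := by
    intro s t _ hst h1 h2
    have := h1.comp h2 (sub_pos.2 hst) (hG s)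
    rwa [show s - a + (t - s) = t - a by ring] at this
  set S := {t ∈ Ioc a b | H.Transports (γ a) (γ t) (t - a)} with hS
  obtain ⟨e₀, he₀, hsub₀⟩ := mem_nhdsGT_iff_exists_Ioo_subset.1 (hγ.eventually_trans_right hG a)
  obtain ⟨s₀, has₀, hs₀⟩ := exists_between (lt_min (mem_Ioi.1 he₀) hab)
  have hs₀S : s₀ ∈ S := ⟨⟨has₀, hs₀.le.trans (min_le_right _ _)⟩,
    hsub₀ ⟨has₀, hs₀.trans_le (min_le_left _ _)⟩⟩
  have hbdd : BddAbove S := ⟨b, fun t ht => ht.1.2⟩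
  set m := sSup S with hm
  have hs₀m : s₀ ≤ m := le_csSup hbdd hs₀S
  have ham : a < m := has₀.trans_le hs₀m
  have hmb : m ≤ b := csSup_le ⟨s₀, hs₀S⟩ fun t ht => ht.1.2
  have hmS : m ∈ S := by
    refine ⟨⟨ham, hmb⟩, ?_⟩
    obtain ⟨e, he, hsub⟩ := mem_nhdsLT_iff_exists_Ioo_subset.1 (left m)
    obtain ⟨s, hsS, hes⟩ := exists_lt_of_lt_csSup ⟨s₀, hs₀S⟩ (mem_Iio.1 he)
    rcases (le_csSup hbdd hsS).eq_or_lt with h | h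
    · change s = m at h
      rw [← h]
      exact hsS.2
    · exact comp hsS.1.1 h hsS.2 (hsub ⟨hes, h⟩)
  rcases hmb.eq_or_lt with h | h
  · rw [← h]
    exact hmS.2
  · obtain ⟨e, he, hsub⟩ := mem_nhdsGT_iff_exists_Ioo_subset.1 (hγ.eventually_trans_right hG m)
    obtain ⟨s, hms, hs⟩ := exists_between (lt_min (mem_Ioi.1 he) h)
    have : s ∈ S := ⟨⟨ham.trans hms, hs.le.trans (min_le_right _ _)⟩,
      comp ham hms hmS.2 (hsub ⟨hms, hs.trans_le (min_le_left _ _)⟩)⟩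
    exact ((le_csSup hbdd this).not_gt hms).elim

/-- `p` is the state of `γ` at the time `t`, or the exit point at that time. -/
def IsStateAt (H : HybridSystem d D) (γ : ℝ → Σ j, D j) (t : ℝ) (p : Σ j, D j) : Prop :=
  γ t = p ∨ H.IsExit γ t p

/-- The orbit is followed to a time just before the exit, then the approach is appended; sharpness
comes from the approach. -/
theorem IsExit.transports_left (hout : H.OutwardOnGuard) (hγ : H.IsExecution univ γ)
    (hG : ∀ t, γ t ∉ closure H.G) (h : H.IsExit γ b z) (hab : a < b) :
    H.Transports (γ a) z (b - a) ∧ H.Sharp (γ a) z (b - a) := by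
  obtain ⟨s, ⟨⟨Ψ, hΨ⟩, hsharp, -⟩, has⟩ := ((h.eventually_transports hout hγ hG).and
    (Ioo_mem_nhdsLT hab)).exists
  obtain ⟨Φ, hΦ⟩ := hγ.transports hout hG has.1
  have e : s - a + (b - s) = b - a := by ring
  have h1 := hΦ.comp hΨ (sub_pos.2 has.2) (hG s)
  have h2 := hsharp.trans hΦ.expands hΦ.tracks (sub_pos.2 has.2) (hG s)
  rw [e] at h1 h2
  exact ⟨⟨_, h1⟩, h2⟩

theorem IsStateAt.transports_from (hout : H.OutwardOnGuard) (hγ : H.IsExecution univ γ)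
    (hG : ∀ t, γ t ∉ closure H.G) (h : H.IsStateAt γ b q) (hab : a < b) :
    H.Transports (γ a) q (b - a) := by
  rcases h with rfl | h
  · exact hγ.transports hout hG hab
  · exact (h.transports_left hout hγ hG hab).1

theorem IsExit.transports_reset (hout : H.OutwardOnGuard) (hG : ∀ t, γ t ∉ closure H.G)
    (h : H.IsExit γ t z) : H.Transports z (γ t) 0 := by
  rw [← h.2.2]
  exact HybridSystem.transports_reset hout h.1 (by rw [h.2.2]; exact hG t)

theorem IsStateAt.transports (hout : H.OutwardOnGuard) (hγ : H.IsExecution univ γ)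
    (hG : ∀ t, γ t ∉ closure H.G) (hp : H.IsStateAt γ a p) (hq : H.IsStateAt γ b q)
    (hab : a < b) : H.Transports p q (b - a) := by
  have h1 := hq.transports_from hout hγ hG hab
  rcases hp with rfl | hp
  · exact h1
  · have := (hp.transports_reset hout hG).comp h1 (sub_pos.2 hab) (hG a)
    rwa [zero_add] at this

/-- Linearized transports between the points `p` and `q` of a `τ`-periodic orbit. -/
def TransportsPair (H : HybridSystem d D) (p q : Σ j, D j) (τ : ℝ) : Prop :=
  ∃ (Φ : EuclideanSpace ℝ (Fin (d p.1 + 1)) →L[ℝ] EuclideanSpace ℝ (Fin (d q.1 + 1)))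
    (Ψ : EuclideanSpace ℝ (Fin (d q.1 + 1)) →L[ℝ] EuclideanSpace ℝ (Fin (d p.1 + 1))),
    Φ (H.vel p) = H.vel q ∧ Ψ (H.vel q) = H.vel p ∧
    H.ExpandsOn H.Run p p τ (Ψ.comp Φ) ∧ H.ExpandsOn H.Run q q τ (Φ.comp Ψ)

theorem TransportsPair.symm (h : H.TransportsPair p q τ) : H.TransportsPair q p τ := by
  obtain ⟨Φ, Ψ, h1, h2, h3, h4⟩ := h
  exact ⟨Ψ, Φ, h2, h1, h4, h3⟩

/-- By periodicity `q` may be placed in the period that starts at the time of `p`. If it comes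
strictly later, both legs have positive duration and compose in either order. The case of equal
times needs separate treatment, because an exit point and its reset share a time. -/
theorem IsStateAt.transportsPair (hout : H.OutwardOnGuard) (hγ : H.IsExecution univ γ)
    (hG : ∀ t, γ t ∉ closure H.G) (hper : Function.Periodic γ τ) (hτ : 0 < τ)
    (hp : H.IsStateAt γ a p) (hq : H.IsStateAt γ b q) : H.TransportsPair p q τ := by
  have shift : ∀ {t : ℝ} {m : Σ j, D j} (n : ℤ), H.IsStateAt γ t m →
      H.IsStateAt γ (t + n • τ) m := by
    intro t m n hm
    have hn : Function.Periodic γ (n • τ) := hper.zsmul n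
    rcases hm with rfl | ⟨h1, h2, h3⟩
    · exact Or.inl (hn t)
    · refine Or.inr ⟨h1, ?_, by rw [h3, hn]⟩
      have h4 : Tendsto (fun s => s - n • τ) (𝓝[<] (t + n • τ)) (𝓝[<] t) := by
        refine tendsto_nhdsWithin_iff.2 ⟨?_, ?_⟩
        · have : Tendsto (fun s => s - n • τ) (𝓝 (t + n • τ)) (𝓝 (t + n • τ - n • τ)) :=
            (by fun_prop : Continuous fun s => s - n • τ).tendsto _
          rw [add_sub_cancel_right] at this
          exact this.mono_left nhdsWithin_le_nhds
        · filter_upwards [self_mem_nhdsWithin] with s hs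
          have := mem_Iio.1 hs
          exact mem_Iio.2 (by linarith)
      refine (h2.comp h4).congr fun s => ?_
      rw [Function.comp_apply, hn.sub_eq]
  have shift1 : ∀ {t : ℝ} {m : Σ j, D j}, H.IsStateAt γ t m → H.IsStateAt γ (t + τ) m :=
    fun hm => by simpa using shift 1 hm
  -- An exit point and its reset: one leg is the reset, of duration `0`, the other a full turn.
  -- Composition at the exit point uses sharpness of the full turn.
  have same : ∀ {a : ℝ} {p q : Σ j, D j}, γ a = q → H.IsExit γ a p → H.TransportsPair p q τ := by
    rintro a p q rfl hp
    have hne : γ a ≠ p := fun h => hG a (h ▸ subset_closure hp.1)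
    obtain ⟨Φ, hΦ⟩ := hp.transports_reset hout hG
    have hp' : H.IsExit γ (a + τ) p := by
      rcases shift1 (Or.inr hp) with h | h
      · rw [hper] at h
        exact (hne h).elim
      · exact h
    obtain ⟨⟨Ψ, hΨ⟩, hsharp⟩ := hp'.transports_left hout hγ hG (lt_add_of_pos_right a hτ)
    rw [add_sub_cancel_left] at hΨ hsharp
    have h1 := hΦ.expands.comp hΦ.tracks hΨ.expands (Or.inl hτ)
    have h2 := hΨ.expands.comp hΨ.tracks hΦ.expands (Or.inr ⟨hsharp, hne.symm, rfl⟩)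
    rw [zero_add] at h1
    rw [add_zero] at h2
    exact ⟨Φ, Ψ, hΦ.expands.vel, hΨ.expands.vel, h1, h2⟩
  have hb := shift (-toIcoDiv hτ a b) hq
  have hmem := sub_toIcoDiv_zsmul_mem_Ico hτ a b
  rw [neg_smul, ← sub_eq_add_neg] at hb
  set b' := b - toIcoDiv hτ a b • τ with hb'
  rcases hmem.1.eq_or_lt with heq | hlt
  · rw [← heq] at hb
    -- For a common point one leg is the full turn and the other the identity.
    have refl : p = q → H.TransportsPair p q τ := by
      rintro rfl
      obtain ⟨Φ, hΦ⟩ := hp.transports hout hγ hG (shift1 hp) (lt_add_of_pos_right a hτ)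
      rw [add_sub_cancel_left] at hΦ
      exact ⟨Φ, ContinuousLinearMap.id ℝ _, hΦ.expands.vel, rfl, hΦ.expands, hΦ.expands⟩
    rcases hp with hp | hp
    · rcases hb with hb | hb
      · exact refl (hp.symm.trans hb)
      · exact (same hp hb).symm
    · rcases hb with hb | hb
      · exact same hb hp
      · exact refl (hp.unique hb)
  · obtain ⟨Φ, hΦ⟩ := hp.transports hout hγ hG hb hlt
    obtain ⟨Ψ, hΨ⟩ := hb.transports hout hγ hG (shift1 hp) hmem.2
    have h1 := hΦ.expands.comp hΦ.tracks hΨ.expands (Or.inl (sub_pos.2 hmem.2))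
    have h2 := hΨ.expands.comp hΨ.tracks hΦ.expands (Or.inl (sub_pos.2 hlt))
    rw [show b' - a + (a + τ - b') = τ by ring] at h1
    rw [show a + τ - b' + (b' - a) = τ by ring] at h2
    exact ⟨Φ, Ψ, hΦ.expands.vel, hΨ.expands.vel, h1, h2⟩

end HybridSystem

end

noncomputable section

set_option linter.unusedSectionVars false

namespace HybridSystem

variable {J : Type*} {d : J → ℕ} {D : J → Type*}
  [∀ j, TopologicalSpace (D j)] [∀ j, ChartedSpace (EuclideanHalfSpace (d j + 1)) (D j)]
  [∀ j, IsManifold (𝓡∂ (d j + 1)) ∞ (D j)] [∀ j, T2Space (D j)]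
  {H : HybridSystem d D} {p q r z z' : Σ j, D j} {a b s t T T' T₀ T₁ τ : ℝ}
  {γ x y : ℝ → Σ j, D j}

/-! ### Uniqueness of executions, and the return time -/

theorem IsExecution.exists_eqOn (hx : H.IsExecution (Icc 0 T) x) (hy : H.IsExecution (Icc 0 T) y)
    (hT : 0 < T) (hxy : x 0 = y 0) (hG : x 0 ∉ closure H.G) :
    ∃ δ ∈ Ioc 0 T, EqOn x y (Icc 0 δ) := by
  obtain ⟨A, C, r, η, hb, hbG⟩ := H.exists_isFlowBox (isClosed_closure.isOpen_compl.mem_nhds hG)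
  have hδ : 0 < min η T := lt_min hb.η_pos hT
  have h0 : x 0 ∈ box d (x 0) (r / 2) := mem_of_mem_nhds (box_mem_nhds _ (half_pos hb.r_pos))
  obtain ⟨-, hxm, hxt⟩ := hb.stay_of_disjoint hbG hδ.le (min_le_left _ _)
    (hx.restrict_zero hδ.le (min_le_right _ _)) h0
  obtain ⟨-, hym, hyt⟩ := hb.stay_of_disjoint hbG hδ.le (min_le_left _ _)
    (hy.restrict_zero hδ.le (min_le_right _ _)) (by rwa [← hxy])
  refine ⟨min η T, ⟨hδ, min_le_right _ _⟩, fun s hs => ?_⟩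
  have h1 := hxt.dist_le hb.tame hyt ((min_le_left _ _).trans hb.η_le) hs
  rw [← hxy, sub_self, norm_zero, mul_zero, norm_le_zero_iff, sub_eq_zero] at h1
  rw [← pt_coord (hxm s hs).1, ← pt_coord (hym s hs).1, h1]

/-- The left limits at `t` agree. The only ambiguity is that `x` may sit at the exit point,
continuously from the left, while the right-continuous `γ` already has the reset value. -/
theorem IsExecution.eq_or_isExit (hx : H.IsExecution (Icc 0 T) x)
    (hγ : H.IsExecution univ γ) (hG : ∀ t, γ t ∉ closure H.G) (ht : t ∈ Ioc 0 T)
    (heq : EqOn x γ (Ico 0 t)) :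
    x t = γ t ∨ H.IsExit γ t (x t) ∧ H.FlowsWithin x (Icc 0 T) t := by
  have hev : x =ᶠ[𝓝[<] t] γ := by
    filter_upwards [Ioo_mem_nhdsLT ht.1] with s hs
    exact heq ⟨hs.1.le, hs.2⟩
  by_cases hxc : ContinuousWithinAt x (Icc 0 T) t
  · have h1 : Tendsto γ (𝓝[<] t) (𝓝 (x t)) := by
      refine Tendsto.congr' hev (hxc.tendsto.mono_left (nhdsWithin_le_of_mem ?_))
      filter_upwards [Ioo_mem_nhdsLT ht.1] with s hs
      exact ⟨hs.1.le, hs.2.le.trans ht.2⟩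
    by_cases hγc : ContinuousAt γ t
    · exact Or.inl (tendsto_nhds_unique h1 (hγc.tendsto.mono_left nhdsWithin_le_nhds))
    · obtain ⟨z, hz⟩ := hγ.exists_isExit hγc
      rw [tendsto_nhds_unique h1 hz.2.1]
      exact Or.inr ⟨hz, hx.flowsWithin ⟨ht.1.le, ht.2⟩ hxc⟩
  · obtain ⟨z, hz, hlim, hR⟩ := hx.jump_Icc ht hxc
    have h1 : Tendsto γ (𝓝[<] t) (𝓝 z) := hlim.congr' hev
    by_cases hγc : ContinuousAt γ t
    · have := tendsto_nhds_unique h1 (hγc.tendsto.mono_left nhdsWithin_le_nhds)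
      exact (hG t (this ▸ subset_closure hz)).elim
    · obtain ⟨z', hz'⟩ := hγ.exists_isExit hγc
      left
      rw [← hR, ← hz'.2.2, tendsto_nhds_unique h1 hz'.2.1]

/-- Executions are determined by their initial states, up to a reset at the final time. -/
theorem IsExecution.eqOn (hx : H.IsExecution (Icc 0 T) x) (hout : H.OutwardOnGuard)
    (hγ : H.IsExecution univ γ) (hG : ∀ t, γ t ∉ closure H.G) (hT : 0 ≤ T)
    (h0 : x 0 = γ 0) : EqOn x γ (Ico 0 T) := by
  set S := {t ∈ Icc 0 T | EqOn x γ (Ico 0 t)} with hS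
  have h0S : (0 : ℝ) ∈ S := ⟨⟨le_rfl, hT⟩, by simp⟩
  have hbdd : BddAbove S := ⟨T, fun t ht => ht.1.2⟩
  set m := sSup S with hm
  have h0m : 0 ≤ m := le_csSup hbdd h0S
  have hmT : m ≤ T := csSup_le ⟨0, h0S⟩ fun t ht => ht.1.2
  have heq : EqOn x γ (Ico 0 m) := by
    intro s hs
    obtain ⟨t, ht, hst⟩ := exists_lt_of_lt_csSup ⟨0, h0S⟩ hs.2
    exact ht.2 ⟨hs.1, hst⟩
  rcases hmT.eq_or_lt with h | hlt
  · rwa [← h]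
  exfalso
  have hxm : x m = γ m := by
    rcases h0m.eq_or_lt with h | h
    · rw [← h, h0]
    · rcases hx.eq_or_isExit hγ hG ⟨h, hmT⟩ heq with h1 | ⟨h1, h2⟩
      · exact h1
      -- With time remaining, `x` would have to follow the field from a guard point, which is
      -- impossible.
      · refine (h2.notMem_guard hout ⟨h0m, hmT⟩ ?_ h1.1).elim
        filter_upwards [Ioo_mem_nhdsGT hlt] with s hs
        exact ⟨h0m.trans hs.1.le, hs.2.le⟩
  have hxG : x m ∉ closure H.G := by rw [hxm]; exact hG m
  obtain ⟨δ, hδ, hδeq⟩ := (hx.segment_Icc ⟨h0m, hmT⟩ hxG).exists_eqOn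
    (hγ.segment_univ hG m (T - m)) (sub_pos.2 hlt) (by simpa using hxm) (by simpa using hxG)
  have hδ1 := hδ.1
  have hδ2 := hδ.2
  have : m + δ ∈ S := by
    refine ⟨⟨by linarith, by linarith⟩, fun s hs => ?_⟩
    rcases lt_or_ge s m with h | h
    · exact heq ⟨hs.1, h⟩
    · have := hδeq (x := s - m) ⟨by linarith, by linarith [hs.2]⟩
      simpa using this
  linarith [le_csSup hbdd this]

theorem IsExecution.comp_add_univ (hγ : H.IsExecution univ γ) (a : ℝ) :
    H.IsExecution univ (fun s => γ (a + s)) := by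
  simpa using hγ.comp_add a

/-- A single recurrence gives `γ (a + σ + s) = γ (a + s)` for `s ≥ 0` by uniqueness. Only forward
uniqueness is available, as resets need not be injective; periodicity extends the identity to all
times, and minimality applies. -/
theorem IsPeriodicOrbit.le_of_eq (hout : H.OutwardOnGuard) (hγ : H.IsPeriodicOrbit γ τ)
    (hG : ∀ t, γ t ∉ closure H.G) {σ : ℝ} (hσ : 0 < σ) (h : γ (a + σ) = γ a) : τ ≤ σ := by
  by_contra hlt
  refine hγ.minimal σ hσ (not_le.1 hlt) fun t => ?_
  have hfwd : ∀ s ≥ 0, γ (a + σ + s) = γ (a + s) := by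
    intro s hs
    have h1 := (hγ.isExecution.segment_univ hG (a + σ) (s + 1)).eqOn hout
      (hγ.isExecution.comp_add_univ a) (fun t => hG _) (by linarith) (by simpa using h)
    exact h1 ⟨hs, by linarith⟩
  -- Enough periods move `t` past `a`, into the range of `hfwd`.
  obtain ⟨n, hn⟩ := exists_nat_ge ((a - t) / τ)
  rw [div_le_iff₀ hγ.pos] at hn
  have h2 := hγ.periodic.nat_mul n
  have h3 := hfwd (t + n * τ - a) (by linarith)
  rw [← h2 (t + σ), ← h2 t]
  convert h3 using 2 <;> ring

theorem exists_isStateAt (hγ : H.IsExecution univ γ) (hp : p ∈ orbitSet γ) :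
    ∃ t, H.IsStateAt γ t p := by
  obtain ⟨t, ht | ht⟩ := hp
  · exact ⟨t, Or.inl ht⟩
  · refine ⟨t, ?_⟩
    by_cases hc : ContinuousAt γ t
    · exact Or.inl (tendsto_nhds_unique (hc.tendsto.mono_left nhdsWithin_le_nhds) ht)
    · obtain ⟨z, hz⟩ := hγ.exists_isExit hc
      rw [tendsto_nhds_unique ht hz.2.1]
      exact Or.inr hz

/-- The first return time along the orbit is the period. -/
theorem FirstHit.time_eq (hout : H.OutwardOnGuard) (hγ : H.IsPeriodicOrbit γ τ)
    (hG : ∀ t, γ t ∉ closure H.G) {A : Set (Σ j, D j)} (hp : H.IsStateAt γ a p)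
    (h : H.FirstHit A p p T) : T = τ := by
  obtain ⟨x, hx, hstart, hjump, hxT, hpA⟩ := h
  have hexec := hγ.isExecution.comp_add_univ a
  have hx0 : x 0 = γ a := by
    rcases hp with hp | hp <;> rcases hstart with ⟨h1, -, h2, -⟩ | ⟨h1, -, h2, -⟩
    · rw [h2, hp]
    · exact (hG a (hp ▸ subset_closure h1)).elim
    · exact (h1 hp.1).elim
    · rw [h2, hp.2.2]
  have hT0 : 0 ≤ T := by
    rcases hstart with ⟨-, h2, -⟩ | ⟨-, h2, -⟩
    · exact h2.le
    · exact h2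
  have heq : EqOn x (fun s => γ (a + s)) (Ico 0 T) :=
    hx.eqOn hout hexec (fun t => hG _) hT0 (by simpa using hx0)
  have hTpos : 0 < T := by
    rcases hstart with ⟨-, h2, -⟩ | ⟨h1, h2, -⟩
    · exact h2
    · refine lt_of_le_of_ne h2 fun h => ?_
      rw [← h, hx0] at hxT
      exact hG a (hxT ▸ subset_closure h1)
  -- States of the orbit are off the closure of the guard and exit points are on the guard. So the
  -- end of the execution is of the same kind as `p`, and in the exit case both states are the reset
  -- of `p`.
  have hend : γ (a + T) = γ a := by
    have h1 := hx.eq_or_isExit hexec (fun t => hG _) ⟨hTpos, le_rfl⟩ heq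
    rw [hxT] at h1
    rcases hp with hp | hp
    · rcases h1 with h1 | h1
      · rw [← h1, hp]
      · exact (hG a (hp ▸ subset_closure h1.1.1)).elim
    · rcases h1 with h1 | h1
      · exact (hG (a + T) (h1 ▸ subset_closure hp.1)).elim
      · have := h1.1.2.2
        rw [hp.2.2] at this
        exact this.symm
  refine le_antisymm ?_ (hγ.le_of_eq hout hG hTpos hend)
  by_contra hlt
  rw [not_le] at hlt
  have hτ := hγ.pos
  have hxτ : x τ = γ a := by rw [heq ⟨hτ.le, hlt⟩]; exact hγ.periodic a
  rcases hp with hp | hp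
  · rcases hstart with ⟨-, -, -, h1⟩ | ⟨h1, -⟩
    · exact h1 τ ⟨hτ, hlt⟩ (by rwa [hxτ, hp])
    · exact hG a (hp ▸ subset_closure h1)
  -- An exit point is not attained by `x` at time `τ`, but it is the left limit at the jump there,
  -- which a first hit must not leave unnoticed.
  · have hlim : Tendsto x (𝓝[<] τ) (𝓝 p) := by
      have h4 : Tendsto (fun s => a + s - τ) (𝓝[<] τ) (𝓝[<] a) := by
        refine tendsto_nhdsWithin_iff.2 ⟨?_, ?_⟩
        · have : Tendsto (fun s => a + s - τ) (𝓝 τ) (𝓝 (a + τ - τ)) :=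
            (by fun_prop : Continuous fun s => a + s - τ).tendsto _
          rw [add_sub_cancel_right] at this
          exact this.mono_left nhdsWithin_le_nhds
        · filter_upwards [self_mem_nhdsWithin] with s hs
          have := mem_Iio.1 hs
          exact mem_Iio.2 (by linarith)
      refine (hp.2.1.comp h4).congr' ?_
      filter_upwards [Ioo_mem_nhdsLT hτ] with s hs
      rw [Function.comp_apply, hγ.periodic.sub_eq, heq ⟨hs.1.le, hs.2.trans hlt⟩]
    refine hjump τ ⟨hτ, hlt.le⟩ (fun hc => ?_) p ?_ hpA
    · have h1 : Tendsto x (𝓝[<] τ) (𝓝 (x τ)) := by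
        refine hc.tendsto.mono_left (nhdsWithin_le_of_mem ?_)
        filter_upwards [Ioo_mem_nhdsLT hτ] with s hs
        exact ⟨hs.1.le, hs.2.le.trans hlt.le⟩
      have := tendsto_nhds_unique h1 hlim
      rw [hxτ] at this
      exact hG a (this ▸ subset_closure hp.1)
    · exact hlim.mono_left (nhdsWithin_mono _ fun s hs => hs.2)

end HybridSystem

end

noncomputable section

set_option linter.unusedSectionVars false

/-! ### Derivatives of Poincaré maps -/

/-- The value has its own name `y` because `P ξ = ξ` is only a propositional equality, while both
deviations have to be taken in the chart at `ξ`. -/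
theorem hasMFDerivAt_iff_isLittleO {E E' : Type*} [NormedAddCommGroup E] [NormedSpace ℝ E]
    [NormedAddCommGroup E'] [NormedSpace ℝ E'] {B B' : Type*} [TopologicalSpace B]
    [TopologicalSpace B'] {I : ModelWithCorners ℝ E B} {I' : ModelWithCorners ℝ E' B'}
    {M M' : Type*} [TopologicalSpace M] [ChartedSpace B M] [TopologicalSpace M']
    [ChartedSpace B' M'] {f : M → M'} {x : M} {y : M'} (hy : f x = y) {L : E →L[ℝ] E'} :
    HasMFDerivAt I I' f x L ↔ ContinuousAt f x ∧
      (fun m => extChartAt I' y (f m) - extChartAt I' y y -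
        L (extChartAt I x m - extChartAt I x x)) =o[𝓝 x]
          fun m => extChartAt I x m - extChartAt I x x := by
  subst hy
  refine and_congr_right fun _ => ?_
  change HasFDerivWithinAt (writtenInExtChartAt I I' x f) L (range I) (extChartAt I x x) ↔ _
  rw [hasFDerivWithinAt_iff_isLittleO, ← map_extChartAt_nhds, Asymptotics.isLittleO_map]
  refine Asymptotics.isLittleO_congr ?_ EventuallyEq.rfl
  filter_upwards [extChartAt_source_mem_nhds (I := I) x] with m hm
  simp only [Function.comp_apply, writtenInExtChartAt, (extChartAt I x).left_inv hm,
    (extChartAt I x).left_inv (mem_extChartAt_source x)]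

/-- By transversality and dimension count the ambient space is the direct sum of the image of `L`
and the line of `v`; `l` and `n` are the two coordinate projections. -/
theorem exists_splitting {E F : Type*} [NormedAddCommGroup E] [NormedSpace ℝ E]
    [FiniteDimensional ℝ E] [NormedAddCommGroup F] [NormedSpace ℝ F] [FiniteDimensional ℝ F]
    {L : E →L[ℝ] F} {v : F} (hL : Function.Injective L) (hv : v ∉ range L)
    (hd : Module.finrank ℝ F = Module.finrank ℝ E + 1) :
    ∃ (l : F →L[ℝ] E) (n : F →L[ℝ] ℝ), (∀ e, l (L e) = e) ∧ l v = 0 ∧ (∀ e, n (L e) = 0) ∧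
      n v = 1 ∧ ∀ w, L (l w) + n w • v = w := by
  set f : E × ℝ →ₗ[ℝ] F := (L : E →ₗ[ℝ] F).coprod (LinearMap.toSpanSingleton ℝ F v) with hf
  have hfa : ∀ e t, f (e, t) = L e + t • v := fun e t => by simp [hf]
  have hinj : Function.Injective f := by
    refine (injective_iff_map_eq_zero f).2 ?_
    rintro ⟨e, t⟩ h
    rw [hfa] at h
    have ht : t = 0 := by
      by_contra ht
      refine hv ⟨-(t⁻¹ • e), ?_⟩
      have h1 : L e = -(t • v) := eq_neg_of_add_eq_zero_left h
      rw [map_neg, map_smul, h1, smul_neg, neg_neg, inv_smul_smul₀ ht]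
    subst ht
    rw [zero_smul, add_zero] at h
    rw [hL (h.trans (map_zero L).symm), Prod.mk_zero_zero]
  set g := (f.linearEquivOfInjective hinj (by simp [hd])).symm.toContinuousLinearEquiv with hg
  have hgf : ∀ u, g (f u) = u := fun u =>
    (f.linearEquivOfInjective hinj (by simp [hd])).symm_apply_apply u
  have hfg : ∀ w, f (g w) = w := fun w =>
    (f.linearEquivOfInjective hinj (by simp [hd])).apply_symm_apply w
  have h1 : ∀ e, g (L e) = (e, 0) := fun e => by rw [← hgf (e, 0), hfa]; simp
  have h2 : g v = (0, 1) := by rw [← hgf (0, 1), hfa]; simp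
  refine ⟨(ContinuousLinearMap.fst ℝ E ℝ).comp (g : F →L[ℝ] E × ℝ),
    (ContinuousLinearMap.snd ℝ E ℝ).comp (g : F →L[ℝ] E × ℝ), fun e => ?_, ?_, fun e => ?_, ?_,
    fun w => ?_⟩
  · simp [h1]
  · simp [h2]
  · simp [h1]
  · simp [h2]
  · have := hfg w
    rwa [← Prod.mk.eta (p := g w), hfa] at this

/-- Half of `‖v‖` on the right is absorbed on the left. -/
theorem Asymptotics.isBigO_of_sub_isLittleO {α E F : Type*} [NormedAddCommGroup E]
    [NormedAddCommGroup F] {l : Filter α} {v w : α → E} {a : α → F} (hw : w =O[l] a)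
    (h : (fun s => v s - w s) =o[l] fun s => ‖a s‖ + ‖v s‖) : v =O[l] a := by
  obtain ⟨K, -, hK⟩ := hw.exists_nonneg
  refine IsBigO.of_bound (2 * K + 1) ?_
  filter_upwards [hK.bound, h.def (half_pos one_pos)] with s h1 h2
  rw [Real.norm_of_nonneg (by positivity)] at h2
  have h3 : ‖v s‖ ≤ ‖v s - w s‖ + ‖w s‖ := by
    simpa using norm_add_le (v s - w s) (w s)
  linarith

/-- First-order elimination of the return time `σ`. -/
theorem Asymptotics.isLittleO_return {α E F : Type*} [NormedAddCommGroup E] [NormedSpace ℝ E]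
    [NormedAddCommGroup F] [NormedSpace ℝ F] {f : Filter α} {a b : α → E} {A A' : α → F}
    {σ : α → ℝ} {L : E →L[ℝ] F} {M : F →L[ℝ] F} {l : F →L[ℝ] E} {n : F →L[ℝ] ℝ} {v : F}
    (hlL : ∀ e, l (L e) = e) (hlv : l v = 0) (hnL : ∀ e, n (L e) = 0) (hnv : n v = 1)
    (hAL : (fun s => A s - L (a s)) =o[f] a) (hBL : (fun s => A' s - L (b s)) =o[f] b)
    (hE : (fun s => A' s - M (A s) - σ s • v) =o[f] fun s => ‖A s‖ + |σ s|) :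
    (fun s => b s - (l.comp M).comp L (a s)) =o[f] a := by
  have hAa : A =O[f] a :=
    (hAL.isBigO.add (L.isBigO_comp _ _)).congr_left fun s => by abel
  -- The return point and the return time are treated as one unknown. At first the errors are
  -- controlled only by `Y`, which contains the unknown; absorption then shows that the unknown is
  -- `O(a)`, without an implicit function theorem.
  set w : α → E × ℝ := fun s => (b s, σ s) with hw
  set Y : α → ℝ := fun s => ‖a s‖ + ‖w s‖ with hY
  have hY0 : ∀ s, 0 ≤ Y s := fun s => by positivity
  have haY : a =O[f] Y := isBigO_of_le _ fun s => by
    rw [Real.norm_of_nonneg (hY0 s)]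
    exact le_add_of_nonneg_right (norm_nonneg _)
  have hwY : w =O[f] Y := isBigO_of_le _ fun s => by
    rw [Real.norm_of_nonneg (hY0 s)]
    exact le_add_of_nonneg_left (norm_nonneg _)
  have hbY : b =O[f] Y := isBigO_fst_prod.trans hwY
  have hσY : σ =O[f] Y := isBigO_snd_prod.trans hwY
  have hE' : (fun s => A' s - M (A s) - σ s • v) =o[f] Y :=
    hE.trans_isBigO ((hAa.trans haY).norm_left.add hσY.abs_left)
  have hB' : (fun s => A' s - L (b s)) =o[f] Y := hBL.trans_isBigO hbY
  have hdiff : (fun s => L (b s) - M (A s) - σ s • v) =o[f] Y :=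
    (hE'.sub hB').congr_left fun s => by abel
  -- Applying `l` removes the return time and isolates the return point; applying `n` does the
  -- opposite.
  have e1 : (fun s => b s - l (M (A s))) =o[f] Y :=
    ((l.isBigO_comp _ _).trans_isLittleO hdiff).congr_left fun s => by
      simp [hlL, hlv]
  have e2 : (fun s => σ s - -n (M (A s))) =o[f] Y :=
    ((n.isBigO_comp _ _).trans_isLittleO hdiff).neg_left.congr_left fun s => by
      simp only [map_sub, map_smul, hnL, hnv, smul_eq_mul]
      ring
  have hwa : w =O[f] a := by
    refine isBigO_of_sub_isLittleO (w := fun s => (l (M (A s)), -n (M (A s)))) ?_ ?_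
    · exact (((l.comp M).isBigO_comp _ _).trans hAa).prod_left
        (((n.comp M).isBigO_comp _ _).trans hAa).neg_left
    · exact e1.prod_left e2
  have hYa : Y =O[f] a := (isBigO_refl a _).norm_left.add hwa.norm_left
  have e3 := (e1.trans_isBigO hYa).add (((l.comp M).isBigO_comp _ _).trans_isLittleO hAL)
  refine e3.congr_left fun s => ?_
  simp only [map_sub, ContinuousLinearMap.comp_apply]
  abel

namespace HybridSystem

variable {J : Type*} {d : J → ℕ} {D : J → Type*}
  [∀ j, TopologicalSpace (D j)] [∀ j, ChartedSpace (EuclideanHalfSpace (d j + 1)) (D j)]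
  [∀ j, IsManifold (𝓡∂ (d j + 1)) ∞ (D j)] [∀ j, T2Space (D j)]
  {H : HybridSystem d D} {τ : ℝ} {γ : ℝ → Σ j, D j} {j : J}
  {B : Type*} [TopologicalSpace B] {I : ModelWithCorners ℝ (EuclideanSpace ℝ (Fin (d j))) B}
  {S : Type*} [TopologicalSpace S] [ChartedSpace B S] {ι : S → D j} {U : Set S}
  {P : S → S} {ξ : S}

theorem dev_mk (y y' : D j) : dev d (⟨j, y⟩ : Σ j, D j) ⟨j, y'⟩ =
    extChartAt (𝓡∂ (d j + 1)) y y' - extChartAt (𝓡∂ (d j + 1)) y y := by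
  have h2 : ∀ y' : D j, coord d (⟨j, y⟩ : Σ j, D j) ⟨j, y'⟩ = extChartAt (𝓡∂ (d j + 1)) y y' :=
    coord_mk (⟨j, y⟩ : Σ j, D j)
  simp only [dev, h2]

theorem IsPoincareSection.exists_isStateAt (hγ : H.IsExecution univ γ)
    (h : H.IsPoincareSection γ I ι ξ) : ∃ t, H.IsStateAt γ t ⟨j, ι ξ⟩ := by
  have h1 : (⟨j, ι ξ⟩ : Σ j, D j) ∈ orbitSet γ ∩ range (fun s : S => (⟨j, ι s⟩ : Σ j, D j)) := by
    rw [h.inter_orbit]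
    exact mem_singleton _
  exact HybridSystem.exists_isStateAt hγ h1.1

theorem ExpandsOn.isLittleO_comp {Q : (Σ j, D j) → (Σ j, D j) → ℝ → Prop} {p q : Σ j, D j}
    {T₀ : ℝ}
    {Φ : EuclideanSpace ℝ (Fin (d p.1 + 1)) →L[ℝ] EuclideanSpace ℝ (Fin (d q.1 + 1))}
    (h : H.ExpandsOn Q p q T₀ Φ) {α : Type*} {f : Filter α} {x y : α → Σ j, D j} {ρ : α → ℝ}
    (ht : Tendsto (fun s => (x s, y s, ρ s)) f (near Q p q T₀)) :
    (fun s => dev d q (y s) - Φ (dev d p (x s)) - (ρ s - T₀) • H.vel q) =o[f]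
      fun s => ‖dev d p (x s)‖ + |ρ s - T₀| := by
  have h1 := h.estimate.comp_tendsto ht
  exact h1

/-- The derivative of a Poincaré map is the linearized transport around the orbit, compressed to
the tangent space of the section along the vector field. -/
theorem IsPoincareMap.hasMFDerivAt (hout : H.OutwardOnGuard) (hγ : H.IsPeriodicOrbit γ τ)
    (hG : ∀ t, γ t ∉ closure H.G) (h : H.IsPoincareMap γ I ι U P ξ)
    {M : EuclideanSpace ℝ (Fin (d j + 1)) →L[ℝ] EuclideanSpace ℝ (Fin (d j + 1))}
    (hM : H.ExpandsOn H.Run ⟨j, ι ξ⟩ ⟨j, ι ξ⟩ τ M)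
    {L : EuclideanSpace ℝ (Fin (d j)) →L[ℝ] EuclideanSpace ℝ (Fin (d j + 1))}
    (hL : HasMFDerivAt I (𝓡∂ (d j + 1)) ι ξ L)
    {l : EuclideanSpace ℝ (Fin (d j + 1)) →L[ℝ] EuclideanSpace ℝ (Fin (d j))}
    {n : EuclideanSpace ℝ (Fin (d j + 1)) →L[ℝ] ℝ} (hlL : ∀ e, l (L e) = e)
    (hlv : l (H.vel ⟨j, ι ξ⟩) = 0) (hnL : ∀ e, n (L e) = 0) (hnv : n (H.vel ⟨j, ι ξ⟩) = 1) :
    HasMFDerivAt I I P ξ ((l.comp M).comp L) := by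
  obtain ⟨ρ, hρ, hhit⟩ := h.firstReturn
  obtain ⟨t, ht⟩ := h.isSection.exists_isStateAt hγ.isExecution
  -- The return time at `ξ` must be the `τ` of the expansion, so that nearby returns lie in `near
  -- H.Run _ _ τ`.
  have hρξ : ρ ξ = τ := by
    have h1 := hhit ξ h.mem
    rw [h.fixed] at h1
    exact h1.time_eq hout hγ hG ht
  have hLo := ((hasMFDerivAt_iff_isLittleO rfl).1 hL).2
  set a : S → EuclideanSpace ℝ (Fin (d j)) := fun s => extChartAt I ξ s - extChartAt I ξ ξ with ha
  set b : S → EuclideanSpace ℝ (Fin (d j)) := fun s => a (P s) with hb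
  set A : S → EuclideanSpace ℝ (Fin (d j + 1)) := fun s => dev d (⟨j, ι ξ⟩ : Σ j, D j) ⟨j, ι s⟩ with hA
  have hAeq : ∀ s, A s = extChartAt (𝓡∂ (d j + 1)) (ι ξ) (ι s) -
      extChartAt (𝓡∂ (d j + 1)) (ι ξ) (ι ξ) := fun s => dev_mk _ _
  have hAL : (fun s => A s - L (a s)) =o[𝓝 ξ] a := hLo.congr_left fun s => by rw [hAeq]
  have hPξ : Tendsto P (𝓝 ξ) (𝓝 ξ) := by
    have := h.continuousAt.tendsto
    rwa [h.fixed] at this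
  have hBL : (fun s => A (P s) - L (b s)) =o[𝓝 ξ] b := hAL.comp_tendsto hPξ
  have hιξ : Tendsto (fun s => (⟨j, ι s⟩ : Σ j, D j)) (𝓝 ξ) (𝓝 ⟨j, ι ξ⟩) :=
    (continuous_sigmaMk.tendsto _).comp h.isSection.isEmbedding.continuous.continuousAt
  have hnear : Tendsto (fun s => ((⟨j, ι s⟩ : Σ j, D j), (⟨j, ι (P s)⟩ : Σ j, D j), ρ s)) (𝓝 ξ)
      (near H.Run ⟨j, ι ξ⟩ ⟨j, ι ξ⟩ τ) := by
    refine tendsto_inf.2 ⟨hιξ.prodMk ((hιξ.comp hPξ).prodMk ?_), tendsto_principal.2 ?_⟩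
    · rw [← hρξ]
      exact hρ
    · filter_upwards [h.isOpen.mem_nhds h.mem] with s hs
      exact (hhit s hs).run
  have hE : (fun s => A (P s) - M (A s) - (ρ s - τ) • H.vel ⟨j, ι ξ⟩) =o[𝓝 ξ] fun s => ‖A s‖ + |ρ s - τ| :=
    hM.isLittleO_comp hnear
  exact (hasMFDerivAt_iff_isLittleO h.fixed).2 ⟨h.continuousAt,
    Asymptotics.isLittleO_return hlL hlv hnL hnv hAL hBL hE⟩

theorem linearizationMatrix_eq {L : EuclideanSpace ℝ (Fin (d j)) →L[ℝ] EuclideanSpace ℝ (Fin (d j))}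
    (h : HasMFDerivAt I I P ξ L) : linearizationMatrix I P ξ =
      (LinearMap.toMatrix (EuclideanSpace.basisFun (Fin (d j)) ℝ).toBasis
        (EuclideanSpace.basisFun (Fin (d j)) ℝ).toBasis
        (L : EuclideanSpace ℝ (Fin (d j)) →ₗ[ℝ] EuclideanSpace ℝ (Fin (d j)))).map
        (algebraMap ℝ ℂ) := by
  rw [linearizationMatrix, h.mfderiv]

theorem toMatrix_comp_map {k m : ℕ}
    (X : EuclideanSpace ℝ (Fin m) →L[ℝ] EuclideanSpace ℝ (Fin k))
    (Y : EuclideanSpace ℝ (Fin k) →L[ℝ] EuclideanSpace ℝ (Fin m)) :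
    (LinearMap.toMatrix (EuclideanSpace.basisFun (Fin k) ℝ).toBasis
        (EuclideanSpace.basisFun (Fin k) ℝ).toBasis
        (X.comp Y : EuclideanSpace ℝ (Fin k) →L[ℝ] EuclideanSpace ℝ (Fin k)).toLinearMap).map
        (algebraMap ℝ ℂ) =
      (LinearMap.toMatrix (EuclideanSpace.basisFun (Fin m) ℝ).toBasis
        (EuclideanSpace.basisFun (Fin k) ℝ).toBasis X.toLinearMap).map (algebraMap ℝ ℂ) *
      (LinearMap.toMatrix (EuclideanSpace.basisFun (Fin k) ℝ).toBasis
        (EuclideanSpace.basisFun (Fin m) ℝ).toBasis Y.toLinearMap).map (algebraMap ℝ ℂ) := by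
  rw [← Matrix.map_mul, ← LinearMap.toMatrix_comp]
  rfl

theorem IsPoincareSection.exists_splitting (h : H.IsPoincareSection γ I ι ξ) :
    ∃ (L : EuclideanSpace ℝ (Fin (d j)) →L[ℝ] EuclideanSpace ℝ (Fin (d j + 1)))
      (l : EuclideanSpace ℝ (Fin (d j + 1)) →L[ℝ] EuclideanSpace ℝ (Fin (d j)))
      (n : EuclideanSpace ℝ (Fin (d j + 1)) →L[ℝ] ℝ), HasMFDerivAt I (𝓡∂ (d j + 1)) ι ξ L ∧
      (∀ e, l (L e) = e) ∧ l (H.vel ⟨j, ι ξ⟩) = 0 ∧ (∀ e, n (L e) = 0) ∧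
      n (H.vel ⟨j, ι ξ⟩) = 1 ∧ ∀ w, L (l w) + n w • H.vel ⟨j, ι ξ⟩ = w := by
  have h1 := (h.smooth.mdifferentiable (by simp) ξ).hasMFDerivAt
  obtain ⟨L, hL⟩ : ∃ L : EuclideanSpace ℝ (Fin (d j)) →L[ℝ] EuclideanSpace ℝ (Fin (d j + 1)),
    L = mfderiv I (𝓡∂ (d j + 1)) ι ξ := ⟨_, rfl⟩
  have hinj : Function.Injective L := by rw [hL]; exact h.immersion ξ
  have hv : H.vel ⟨j, ι ξ⟩ ∉ range L := by rw [hL]; exact h.transverse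
  obtain ⟨l, n, h2⟩ := _root_.exists_splitting hinj hv (by simp)
  exact ⟨L, l, n, by rw [hL]; exact h1, h2⟩

end HybridSystem

end

/-- Two Poincaré maps `P`, `P'` of the same hybrid periodic orbit, on sections that may lie in
domains of different dimensions: their linearizations at the fixed points exist, have the same
nonzero (complex) spectrum, and the non-nilpotent parts of their Jordan canonical forms (and of any
block-diagonal forms of that kind) are similar. -/
theorem lemma1 {J : Type*} [Finite J] {d : J → ℕ} {D : J → Type*}
    [∀ j, TopologicalSpace (D j)] [∀ j, T2Space (D j)] [∀ j, SecondCountableTopology (D j)]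
    [∀ j, ConnectedSpace (D j)]
    [∀ j, ChartedSpace (EuclideanHalfSpace (d j + 1)) (D j)]
    [∀ j, IsManifold (𝓡∂ (d j + 1)) ∞ (D j)]
    (H : HybridSystem d D) (hout : H.OutwardOnGuard)
    (γ : ℝ → Σ j, D j) (τ : ℝ) (hγ : H.IsPeriodicOrbit γ τ)
    (hiso : HybridSystem.IsolatedTransitions γ τ)
    (hgraze : ∀ t, γ t ∉ closure H.G)
    {j j' : J}
    {B : Type*} [TopologicalSpace B] (I : ModelWithCorners ℝ (EuclideanSpace ℝ (Fin (d j))) B)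
    {S : Type*} [TopologicalSpace S] [ChartedSpace B S] [IsManifold I ∞ S]
    (ι : S → D j) (U : Set S) (P : S → S) (ξ : S)
    (hP : H.IsPoincareMap γ I ι U P ξ)
    {B' : Type*} [TopologicalSpace B']
    (I' : ModelWithCorners ℝ (EuclideanSpace ℝ (Fin (d j'))) B')
    {S' : Type*} [TopologicalSpace S'] [ChartedSpace B' S'] [IsManifold I' ∞ S']
    (ι' : S' → D j') (U' : Set S') (P' : S' → S') (ξ' : S')
    (hP' : H.IsPoincareMap γ I' ι' U' P' ξ') :
    MDifferentiableAt I I P ξ ∧ MDifferentiableAt I' I' P' ξ' ∧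
    spectrum ℂ (linearizationMatrix I P ξ) \ {0} =
      spectrum ℂ (linearizationMatrix I' P' ξ') \ {0} ∧
    ∀ (r m r' m' : ℕ) (A : Matrix (Fin r) (Fin r) ℂ) (N : Matrix (Fin m) (Fin m) ℂ)
      (A' : Matrix (Fin r') (Fin r') ℂ) (N' : Matrix (Fin m') (Fin m') ℂ),
      IsBlockForm (linearizationMatrix I P ξ) A N →
      IsBlockForm (linearizationMatrix I' P' ξ') A' N' →
      MatrixSimilar A A' := by
  obtain ⟨a, ha⟩ := hP.isSection.exists_isStateAt hγ.isExecution
  obtain ⟨b, hb⟩ := hP'.isSection.exists_isStateAt hγ.isExecution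
  obtain ⟨Φ, Ψ, hΦ, hΨ, hpp, hqq⟩ :=
    ha.transportsPair hout hγ.isExecution hgraze hγ.periodic hγ.pos hb
  obtain ⟨L, l, n, hL, hlL, hlv, hnL, hnv, hsplit⟩ := hP.isSection.exists_splitting
  obtain ⟨L', l', n', hL', hlL', hlv', hnL', hnv', hsplit'⟩ := hP'.isSection.exists_splitting
  have hD := hP.hasMFDerivAt hout hγ hgraze hpp hL hlL hlv hnL hnv
  have hD' := hP'.hasMFDerivAt hout hγ hgraze hqq hL' hlL' hlv' hnL' hnv'
  set X : EuclideanSpace ℝ (Fin (d j')) →L[ℝ] EuclideanSpace ℝ (Fin (d j)) :=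
    (l.comp Ψ).comp L' with hX
  set Y : EuclideanSpace ℝ (Fin (d j)) →L[ℝ] EuclideanSpace ℝ (Fin (d j')) :=
    (l'.comp Φ).comp L with hY
  -- Projecting to the second section in the middle discards only a multiple of the velocity there,
  -- which `Ψ` maps to the velocity at `ι ξ` and `l` then kills.
  have hXY : (l.comp (Ψ.comp Φ)).comp L = X.comp Y := by
    ext1 e
    change l (Ψ (Φ (L e))) = l (Ψ (L' (l' (Φ (L e)))))
    have h1 := congrArg (fun w => l (Ψ w)) (hsplit' (Φ (L e)))
    simp only [map_add, map_smul] at h1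
    rw [← h1, hΨ, hlv, smul_zero, add_zero]
  have hYX : (l'.comp (Φ.comp Ψ)).comp L' = Y.comp X := by
    ext1 e
    change l' (Φ (Ψ (L' e))) = l' (Φ (L (l (Ψ (L' e)))))
    have h1 := congrArg (fun w => l' (Φ w)) (hsplit (Ψ (L' e)))
    simp only [map_add, map_smul] at h1
    rw [← h1, hΦ, hlv', smul_zero, add_zero]
  have hDX : HasMFDerivAt I I P ξ (X.comp Y) := hD.congr_mfderiv hXY
  have hDY : HasMFDerivAt I' I' P' ξ' (Y.comp X) := hD'.congr_mfderiv hYX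
  have hM := (HybridSystem.linearizationMatrix_eq hDX).trans (HybridSystem.toMatrix_comp_map X Y)
  have hM' := (HybridSystem.linearizationMatrix_eq hDY).trans (HybridSystem.toMatrix_comp_map Y X)
  refine ⟨hD.mdifferentiableAt, hD'.mdifferentiableAt, ?_, ?_⟩
  · rw [hM, hM']
    exact Matrix.spectrum_mul_comm_diff_zero _ _
  · intro r m r' m' A N A' N' h h'
    exact h.similar_of_mul_comm hM hM' h'
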